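/- **Setting.** Let $(X,d)$ be a locally compact metric space with a countable base, and let $\Gamma$ be a locally compact, amenable (i.e. admitting a Følner sequence), unimodular group with Haar measure $|\cdot|$ and a compatible left-invariant metric $d_\Gamma$ for which balls are precompact. Let $\Gamma$ act continuously and by isometries on $X$ such that there is a $\sigma$-compact set $F'\subset X$ with compact closure for which every $x\in X$ lies in exactly one translate $\gamma F'$, and such that the map $\Phi:X\to\Gamma$, $\Phi(x)=\gamma$ for $x\in\gamma F'$, is a rough isometry: for some $a\ge1$, $b\ge0$ and all $x,y\in X$, $\frac1a d_\Gamma(\Phi(x),\Phi(y))-b\le d(x,y)\le a\,d_\Gamma(\Phi(x),\Phi(y))+b$. Let $\mathbb C^*$ be a (Hausdorff) compactification of $\mathbb C$, let $\mathcal D$ be the family of all $A\subset X$ with $d(x,y)\ge1$ for all $x\ne y$ in $A$, and let $\tilde{\mathcal D}=\{(A,h): A\in\mathcal D,\ h:A\times A\to\mathbb C^*\}$ with the vague topology. That is: for a compact space $Y$, the set $\mathcal D_Y$ of all maps $f:A\to Y$ with $A\in\mathcal D$ carries the initial topology of the maps $f\mapsto\sum_{x\in A}\varphi(x,f(x))$,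 $\varphi\in C_c(X\times Y)$; and $\tilde{\mathcal D}$ is regarded as a subspace of $\mathcal D_{\mathcal D_{\mathbb C^*}}$ through $(A,h)\mapsto(x\mapsto h(x,\cdot))$. The group $\Gamma$ acts on $\tilde{\mathcal D}$ by $\gamma(A,h)=(\gamma A,\gamma h)$, $(\gamma h)(x,y)=h(\gamma^{-1}x,\gamma^{-1}y)$. Let $\mu$ be a $\Gamma$-invariant Borel probability measure on $\tilde{\mathcal D}$ with topological support $\Omega$, where $\mu(\Omega)=1$ and $\Omega$ contains some $(A,h)$ with $A\ne\emptyset$. For $\omega=(A,h)$ write $X(\omega)=A$; put $m(\Lambda)=\int_\Omega|\Lambda\cap X(\omega)|\,d\mu(\omega)$ for Borel sets $\Lambda\subset X$ and $\mathrm{dens}(m)=m(IF')/|I|$, which is the same for all compact $I\subset\Gamma$ with $|I|>0$. Say that $H=(H_\omega)_{\omega\in\Omega}$ satisfies **(A)** if for each $\omega=(A,h)\in\Omega$ the function $h$ is $\mathbb C$-valued and is the matrix of a bounded selfadjoint operator $H_\omega$ on $\ell^2(X(\omega))$, with $\|H_\omega\|\le C$ for some $C$ independent of $\omega$; there is $R<\infty$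 with $H_\omega(x,y)=0$ whenever $\omega\in\Omega$ and $d(x,y)\ge R$; and, for given functions $s_\gamma:X\to\{z\in\mathbb C:|z|=1\}$, $s_\gamma(x)H_{\gamma\omega}(\gamma x,\gamma y)\overline{s_\gamma(y)}=H_\omega(x,y)$ for all $\gamma\in\Gamma$, $\omega\in\Omega$, $x,y\in X(\omega)$. Let $u:X\to\mathbb R$ be any measurable function with compact support, $\int_\Gamma u(\gamma^{-1}x)\,d\gamma=1$ for all $x\in X$ and $\int|u|\,dm<\infty$. Let $\nu_H$ denote the locally finite Borel measure on $\mathbb R$ with $$\int\varphi\,d\nu_H=\frac1{\mathrm{dens}(m)}\int_\Omega\mathrm{Tr}\big(u\,\varphi(H_\omega)\big)\,d\mu(\omega)\qquad(\varphi\in C_c(\mathbb R)),$$ and let $N_H(t)=\nu_H((-\infty,t])$. **Corollary.** Let $H$ satisfy (A), let $\mu$ be ergodic and let $\lambda\in\mathbb R$. Then $\nu_H$ exists and is unique, and the following are equivalent: (i) $N_H$ is discontinuous at $\lambda$. (ii) There is a measurable set $\Omega'\subset\Omega$ of positive measure such that for each $\omega\in\Omega'$ there is a nonzero compactly supported $v\in\ell^2(X(\omega))$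 with $(H_\omega-\lambda)v=0$. (iii) For almost every $\omega\in\Omega$ there are nonzero compactly supported solutions $v$ of $(H_\omega-\lambda)v=0$, and their linear span is dense in the space of all solutions $v\in\ell^2(X(\omega))$ of $(H_\omega-\lambda)v=0$. -/

import Mathlib

open MeasureTheory Set Filter Topology
open scoped ENNReal Pointwise symmDiff CompactlySupported ComplexConjugate

noncomputable section

/-! ### Uniformly discrete sets, decorated sets and their vague topologies -/

/-- The members of the family `𝓓`: subsets of `X` with mutual distances at least `1`. -/
def IsUniformlyDiscrete {X : Type*} [MetricSpace X] (A : Set X) : Prop :=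
  ∀ x ∈ A, ∀ y ∈ A, x ≠ y → 1 ≤ dist x y

/-- The space `𝓓_Y` of all functions `f : A → Y` with `A ∈ 𝓓`. -/
structure DecoratedSet (X Y : Type*) [MetricSpace X] where
  carrier : Set X
  uniformlyDiscrete : IsUniformlyDiscrete carrier
  val : carrier → Y

/-- The vague topology on `𝓓_Y`: a function `f : A → Y` is identified with the measure
`∑_{x ∈ A} δ_{(x, f x)}` on `X × Y`, tested against continuous functions of compact support.
(For such test functions the sum has only finitely many nonzero terms if `Y` is compact.) -/
instance DecoratedSet.instTopologicalSpace {X Y : Type*} [MetricSpace X] [TopologicalSpace Y] :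
    TopologicalSpace (DecoratedSet X Y) :=
  TopologicalSpace.induced
    (fun f : DecoratedSet X Y => fun φ : C_c(X × Y, ℂ) =>
      ∑ᶠ x : f.carrier, φ ((x : X), f.val x))
    inferInstance

/-- The space `𝓓̃` of all pairs `(A, h)` with `A ∈ 𝓓` and `h : A × A → Y`
(`Y` will be a compactification of `ℂ`). -/
structure Config (X Y : Type*) [MetricSpace X] where
  carrier : Set X
  uniformlyDiscrete : IsUniformlyDiscrete carrier
  h : carrier → carrier → Y

namespace Config

variable {X Y Γ : Type*} [MetricSpace X]

/-- `(A, h)` regarded as the function `A → 𝓓_Y`, `x ↦ h(x, ·)`, an element of `𝓓_{𝓓_Y}`. -/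
def toDecoratedSet (ω : Config X Y) : DecoratedSet X (DecoratedSet X Y) where
  carrier := ω.carrier
  uniformlyDiscrete := ω.uniformlyDiscrete
  val := fun x =>
    { carrier := ω.carrier, uniformlyDiscrete := ω.uniformlyDiscrete, val := ω.h x }

/-- The (vague) topology of `𝓓̃`, as a subspace of `𝓓_{𝓓_Y}`. -/
instance instTopologicalSpace [TopologicalSpace Y] : TopologicalSpace (Config X Y) :=
  TopologicalSpace.induced toDecoratedSet inferInstance

/-- `𝓓̃` carries its Borel `σ`-algebra. -/
instance instMeasurableSpace [TopologicalSpace Y] : MeasurableSpace (Config X Y) := borel _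

instance instBorelSpace [TopologicalSpace Y] : BorelSpace (Config X Y) := ⟨rfl⟩

/-- The action `γ (A, h) = (γ A, γ h)` with `(γ h)(x, y) = h(γ⁻¹ x, γ⁻¹ y)`. -/
instance instSMul [Group Γ] [MulAction Γ X] [IsIsometricSMul Γ X] :
    SMul Γ (Config X Y) where
  smul γ ω :=
    { carrier := γ • ω.carrier
      uniformlyDiscrete := by
        rintro _ ⟨x, hx, rfl⟩ _ ⟨y, hy, rfl⟩ hne
        have hxy : x ≠ y := fun e => hne (by rw [e])
        simpa using ω.uniformlyDiscrete x hx y hy hxy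
      h := fun x y =>
        ω.h ⟨γ⁻¹ • (x : X), Set.mem_smul_set_iff_inv_smul_mem.1 x.2⟩
          ⟨γ⁻¹ • (y : X), Set.mem_smul_set_iff_inv_smul_mem.1 y.2⟩ }

/-- For `x ∈ X(ω)`, the point `γ x` of `X(γ ω) = γ X(ω)`. -/
def translate [Group Γ] [MulAction Γ X] [IsIsometricSMul Γ X]
    (γ : Γ) (ω : Config X Y) (x : ω.carrier) : (γ • ω).carrier :=
  ⟨γ • (x : X), Set.smul_mem_smul_set x.2⟩

end Config

/-! ### The group and its action -/

/-- Amenability, in the form of a Følner sequence: nonempty compact sets `I n` such that, for every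
nonempty compact `K` and `ε > 0`, eventually `|I n ∆ K I n| < ε |I n|`. -/
def IsAmenableGroup {Γ : Type*} [Group Γ] [TopologicalSpace Γ] [MeasurableSpace Γ]
    (haarΓ : Measure Γ) : Prop :=
  ∃ I : ℕ → Set Γ, (∀ n, IsCompact (I n) ∧ (I n).Nonempty) ∧
    ∀ K : Set Γ, IsCompact K → K.Nonempty → ∀ ε : ℝ, 0 < ε →
      ∀ᶠ n in atTop, haarΓ (I n ∆ (K * I n)) < ENNReal.ofReal ε * haarΓ (I n)

/-- `F` is a fundamental domain (in the strict sense): every `x` lies in exactly one translate. -/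
def IsStrictFundamentalDomain (Γ : Type*) {X : Type*} [Group Γ] [MulAction Γ X]
    (F : Set X) : Prop :=
  ∀ x : X, ∃! γ : Γ, x ∈ γ • F

/-- The map `Φ : X → Γ`, `Φ x = γ` whenever `x ∈ γ F`, is a rough isometry. -/
def IsRoughIsometryOfDomain (Γ : Type*) {X : Type*} [Group Γ] [MetricSpace Γ] [MetricSpace X]
    [MulAction Γ X] (F : Set X) : Prop :=
  ∃ a b : ℝ, 1 ≤ a ∧ 0 ≤ b ∧ ∀ (x y : X) (γ δ : Γ), x ∈ γ • F → y ∈ δ • F →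
    1 / a * dist γ δ - b ≤ dist x y ∧ dist x y ≤ a * dist γ δ + b

/-! ### Operators on `ℓ²(A)` -/

/-- The Hilbert space `ℓ²(A)` with respect to counting measure. -/
abbrev EllTwo {X : Type*} (A : Set X) : Type _ := lp (fun _ : A => ℂ) 2

/-- `φ(T)` for a bounded selfadjoint operator `T` on a Hilbert space and continuous `φ`. -/
def functionalCalculus {E : Type*} [NormedAddCommGroup E] [InnerProductSpace ℂ E] [CompleteSpace E]
    (φ : ℝ → ℝ) (T : E →L[ℂ] E) : E →L[ℂ] E :=
  cfc (p := IsSelfAdjoint) φ T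

open Classical in
/-- The matrix element `T(x, y) = (T δ_y)(x)`. -/
def matrixElement {X : Type*} {A : Set X} (T : EllTwo A →L[ℂ] EllTwo A) (x y : A) : ℂ :=
  (T (lp.single 2 y (1 : ℂ)) : EllTwo A) x

/-- The trace of `u T`, i.e. `∑_{x ∈ A} u(x) T(x, x)`, for `u : X → ℝ` of compact support. -/
def weightedTrace {X : Type*} {A : Set X} (u : X → ℝ) (T : EllTwo A →L[ℂ] EllTwo A) : ℂ :=
  ∑ᶠ x : A, (u x : ℂ) * matrixElement T x x

/-- The space of `ℓ²` solutions `v` of `(T - λ) v = 0`. -/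
def solutionSpace {X : Type*} {A : Set X} (T : EllTwo A →L[ℂ] EllTwo A) (lam : ℝ) :
    Submodule ℂ (EllTwo A) :=
  Module.End.eigenspace (T : EllTwo A →ₗ[ℂ] EllTwo A) (lam : ℂ)

/-- The nontrivial compactly supported solutions of `(T - λ) v = 0`. Here `A` is a discrete
space, so that compact support means finite support. -/
def compactSolutions {X : Type*} {A : Set X} (T : EllTwo A →L[ℂ] EllTwo A) (lam : ℝ) :
    Set (EllTwo A) :=
  {v | v ∈ solutionSpace T lam ∧ v ≠ 0 ∧ (Function.support (v : A → ℂ)).Finite}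

/-- Assumption (A), for a family `H ω` indexed by `𝓓̃` of which only the members with `ω` in the
topological support `Ω` of `μ` matter; `ι : ℂ → Y` is the compactification. -/
structure SatisfiesA {X Y Γ : Type*} [MetricSpace X] [TopologicalSpace Y]
    [Group Γ] [MulAction Γ X] [IsIsometricSMul Γ X]
    (ι : ℂ → Y) (s : Γ → X → ℂ) (μ : Measure (Config X Y))
    (H : ∀ ω : Config X Y, EllTwo ω.carrier →L[ℂ] EllTwo ω.carrier) : Prop where
  /-- For `ω = (A, h)`, the operator `H ω` is the one with matrix `h`. -/
  kernel_eq : ∀ ω ∈ μ.support, ∀ x y : ω.carrier, ω.h x y = ι (matrixElement (H ω) x y)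
  bounded : ∃ C : ℝ, ∀ ω ∈ μ.support, ‖H ω‖ ≤ C
  selfAdjoint : ∀ ω ∈ μ.support, IsSelfAdjoint (H ω)
  finiteHoppingRange : ∃ R : ℝ, ∀ ω ∈ μ.support, ∀ x y : ω.carrier,
    R ≤ dist (x : X) (y : X) → matrixElement (H ω) x y = 0
  phase_norm : ∀ γ x, ‖s γ x‖ = 1
  equivariant : ∀ (γ : Γ), ∀ ω ∈ μ.support, ∀ x y : ω.carrier,
    s γ x * matrixElement (H (γ • ω)) (ω.translate γ x) (ω.translate γ y) * conj (s γ y) =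
      matrixElement (H ω) x y

/-! ### The density and the integrated density of states -/

/-- `m(Λ) = ∫ |Λ ∩ X(ω)| dμ(ω)`. -/
def intensity {X Y : Type*} [MetricSpace X] [TopologicalSpace Y] (μ : Measure (Config X Y))
    (Λ : Set X) : ℝ≥0∞ :=
  ∫⁻ ω, ((Λ ∩ ω.carrier).encard : ℝ≥0∞) ∂μ

/-- `dens(m) = m(I F) / |I|`. The quotient is the same for all compact `I ⊆ Γ` with `|I| > 0`;
here `I` is the closed unit ball around the identity. -/
def meanDensity {X Y Γ : Type*} [MetricSpace X] [TopologicalSpace Y]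
    [Group Γ] [MetricSpace Γ] [MeasurableSpace Γ] [MulAction Γ X]
    (haarΓ : Measure Γ) (F : Set X) (μ : Measure (Config X Y)) : ℝ :=
  (intensity μ (Metric.closedBall (1 : Γ) 1 • F) / haarΓ (Metric.closedBall (1 : Γ) 1)).toReal

/-- Admissible weights: `u` is measurable with compact support and `∫ u(γ⁻¹ x) dγ = 1` for all `x`.
The last clause says `∫ |u| dm < ∞`, so that traces weighted by `u` have an expectation; it is
automatic if `u` is bounded or nonnegative. -/
structure IsAdmissible {X Y Γ : Type*} [MetricSpace X] [MeasurableSpace X] [TopologicalSpace Y]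
    [Group Γ] [MeasurableSpace Γ] [MulAction Γ X]
    (haarΓ : Measure Γ) (μ : Measure (Config X Y)) (u : X → ℝ) : Prop where
  measurable : Measurable u
  hasCompactSupport : HasCompactSupport u
  integral_eq_one : ∀ x : X, ∫ γ : Γ, u (γ⁻¹ • x) ∂haarΓ = 1
  integrable : ∫⁻ ω, ∑' x : ω.carrier, ENNReal.ofReal |u x| ∂μ < ∞

/-- `ν` is the density of states measure `ν_H`: the locally finite Borel measure on `ℝ` with
`∫ φ dν = dens(m)⁻¹ ∫ Tr(u φ(H_ω)) dμ(ω)` for all `φ ∈ C_c(ℝ)`. -/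
structure IsDensityOfStates {X Y Γ : Type*} [MetricSpace X] [TopologicalSpace Y]
    [Group Γ] [MetricSpace Γ] [MeasurableSpace Γ] [MulAction Γ X]
    (haarΓ : Measure Γ) (F : Set X) (μ : Measure (Config X Y))
    (H : ∀ ω : Config X Y, EllTwo ω.carrier →L[ℂ] EllTwo ω.carrier)
    (u : X → ℝ) (ν : Measure ℝ) : Prop where
  locallyFinite : IsLocallyFiniteMeasure ν
  integral_eq : ∀ φ : C_c(ℝ, ℝ), ((∫ t, φ t ∂ν : ℝ) : ℂ) =
    ((meanDensity haarΓ F μ)⁻¹ : ℝ) * ∫ ω, weightedTrace u (functionalCalculus φ (H ω)) ∂μ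

/-- The distribution function `N(t) = ν((-∞, t])`. -/
def distributionFunction (ν : Measure ℝ) (t : ℝ) : ℝ := (ν (Iic t)).toReal

end

noncomputable section

set_option linter.unusedSectionVars false

/-! ### Uniformly discrete sets -/

section UniformlyDiscrete

variable {X : Type*} [MetricSpace X] {A K : Set X}

/-! A jump of the distribution function at `lam` is an atom of `ν`, and the atom is, up to the
positive factor 1/dens(m), the trace per unit volume of the projection `eigenProj` onto the ℓ²
solutions (`IsDensityOfStates.measure_singleton`). A positive equivariant family with trace density
zero has zero diagonal almost everywhere, and a projection with zero diagonal is zero. So continuity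
at `lam` means that almost surely there are no ℓ² solutions, and by ergodicity the alternative is
that almost surely there are some.

The core is that solutions orthogonal to all compactly supported ones have trace density zero
(`Config.traceDensity_residualProj`). Let `v` be such a solution and let it vanish on a boundary
layer of a finite region S, thick compared with the hopping range. Then the restriction of `v` to S
is again a solution, is compactly supported, hence is orthogonal to `v`, hence is zero
(`residualSpace_eq_zero_of_boundary`). The values on the boundary layer therefore determine `v` on
S, so the trace over S of the residual projection is at most the number of boundary points
(`sum_starProjection_le_card`). Along a Følner sequence this number is negligible against the
volume, and by invariance the trace per volume is the same for every region. Hence almost surely the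
compactly supported solutions span a dense subspace of the solution space, and if the latter is
nonzero, some of them are nonzero.

Trace densities are handled through Campbell measures g ↦ ∫ ∑ g(x) T_ω(x,x) dμ(ω), which are
Γ-invariant measures on X. A Fubini argument gives m(JF) = |J| · density for such a measure
(`measure_smul_domain`) and shows that the expected trace does not depend on the weight `u`
(`Config.integral_weightedTrace`). Existence and uniqueness of `ν` then follow from the
Riesz–Markov–Kakutani theorem.

Measurability rests on a countable partition of X into cells of diameter less than 1. Each cell
holds at most one point of a configuration, so operators on varying spaces get matrix entries
indexed by ℕ × ℕ. Families with measurable entries are closed under products and strong limits.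
Every operator that occurs, including the projection onto the closed span of the compactly supported
solutions, is reached from `H` in this way. -/

lemma IsUniformlyDiscrete.eq_of_dist_lt (hA : IsUniformlyDiscrete A) {x y : X} (hx : x ∈ A)
    (hy : y ∈ A) (h : dist x y < 1) : x = y := by
  by_contra hne
  exact absurd (hA x hx y hy hne) (not_le.2 h)

lemma IsUniformlyDiscrete.eq_of_dist_lt_half (hA : IsUniformlyDiscrete A) {x y z : X} (hx : x ∈ A)
    (hy : y ∈ A) (hxz : dist x z < 1 / 2) (hyz : dist y z < 1 / 2) : x = y := by
  refine hA.eq_of_dist_lt hx hy ?_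
  have := dist_triangle_right x y z
  linarith

/-- A ball of radius 1/2 contains at most one point of a uniformly discrete set, so a finite cover
by such balls gives a bound that is uniform in `A`. -/
lemma IsCompact.exists_encard_inter_le (hK : IsCompact K) :
    ∃ N : ℕ, ∀ A : Set X, IsUniformlyDiscrete A → (K ∩ A).encard ≤ N := by
  obtain ⟨t, -, ht, hcov⟩ := hK.finite_cover_balls (e := 1 / 2) (by norm_num)
  refine ⟨ht.toFinset.card, fun A hA => ?_⟩
  have key : ∀ x ∈ K ∩ A, ∃ z ∈ t, dist x z < 1 / 2 := fun x hx => by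
    simpa using hcov hx.1
  choose! f hft hfd using key
  calc (K ∩ A).encard ≤ t.encard := by
        refine encard_le_encard_of_injOn (f := f) hft ?_
        intro x hx y hy hxy
        exact hA.eq_of_dist_lt_half hx.2 hy.2 (hfd x hx) (by rw [hxy]; exact hfd y hy)
    _ = ht.toFinset.card := by rw [ht.encard_eq_coe_toFinset_card]

lemma IsUniformlyDiscrete.finite_inter (hA : IsUniformlyDiscrete A) (hK : IsCompact K) :
    (K ∩ A).Finite := by
  obtain ⟨N, hN⟩ := hK.exists_encard_inter_le
  exact finite_of_encard_le_coe (hN A hA)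

lemma IsUniformlyDiscrete.finite_support {M : Type*} [Zero M] (hA : IsUniformlyDiscrete A)
    (hK : IsCompact K) (f : A → M) (hf : ∀ x : A, (x : X) ∉ K → f x = 0) :
    (Function.support f).Finite := by
  refine Finite.subset (((hA.finite_inter hK).preimage Subtype.val_injective.injOn)) ?_
  intro x hx
  by_contra hx'
  exact hx (hf x fun h => hx' ⟨h, x.2⟩)

end UniformlyDiscrete

/-! ### Compactness of spaces of decorated sets, and continuity of translations -/

namespace DecoratedSet

variable {X Y : Type*} [MetricSpace X] [TopologicalSpace Y]

lemma exists_isCompact_eq_zero (φ : C_c(X × Y, ℂ)) :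
    ∃ K : Set X, IsCompact K ∧ ∀ p : X × Y, p.1 ∉ K → φ p = 0 := by
  refine ⟨Prod.fst '' tsupport φ, φ.hasCompactSupport.image continuous_fst, fun p hp => ?_⟩
  by_contra h
  exact hp ⟨p, subset_tsupport _ h, rfl⟩

lemma tendsto_nhds_iff {α : Type*} {l : Filter α} {f : α → DecoratedSet X Y}
    {D : DecoratedSet X Y} :
    Tendsto f l (𝓝 D) ↔ ∀ φ : C_c(X × Y, ℂ),
      Tendsto (fun a => ∑ᶠ x : (f a).carrier, φ ((x : X), (f a).val x)) l
        (𝓝 (∑ᶠ x : D.carrier, φ ((x : X), D.val x))) := by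
  rw [nhds_induced, tendsto_comap_iff, tendsto_pi_nhds]
  rfl

lemma continuous_iff {Z : Type*} [TopologicalSpace Z] {f : Z → DecoratedSet X Y} :
    Continuous f ↔ ∀ φ : C_c(X × Y, ℂ),
      Continuous (fun a => ∑ᶠ x : (f a).carrier, φ ((x : X), (f a).val x)) := by
  rw [continuous_induced_rng, continuous_pi_iff]
  rfl

lemma continuous_finsum (φ : C_c(X × Y, ℂ)) :
    Continuous fun D : DecoratedSet X Y => ∑ᶠ x : D.carrier, φ ((x : X), D.val x) :=
  continuous_iff.1 continuous_id φ

section Compact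

variable [CompactSpace Y]

/-- A continuous function on `X × Y` whose first coordinate is restricted to a compact set. -/
def testFunction (φ : C(X × Y, ℂ)) {K : Set X} (hK : IsCompact K)
    (h : ∀ p : X × Y, p.1 ∉ K → φ p = 0) : C_c(X × Y, ℂ) where
  toContinuousMap := φ
  hasCompactSupport' := by
    refine HasCompactSupport.intro' (hK.prod isCompact_univ) (hK.isClosed.prod isClosed_univ) ?_
    intro p hp
    exact h p fun hp' => hp ⟨hp', mem_univ _⟩

@[simp] lemma testFunction_apply (φ : C(X × Y, ℂ)) {K : Set X} (hK : IsCompact K)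
    (h : ∀ p : X × Y, p.1 ∉ K → φ p = 0) (p : X × Y) : testFunction φ hK h p = φ p := rfl

/-- The points that are approached by the sets `D` along an ultrafilter. -/
def limitCarrier (U : Ultrafilter (DecoratedSet X Y)) : Set X :=
  {x | ∀ ε > 0, ∀ᶠ D in (U : Filter (DecoratedSet X Y)), ∃ y ∈ D.carrier, dist y x < ε}

omit [TopologicalSpace Y] [CompactSpace Y] in
lemma limitCarrier_uniformlyDiscrete (U : Ultrafilter (DecoratedSet X Y)) :
    IsUniformlyDiscrete (limitCarrier U) := by
  intro x hx y hy hne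
  refine le_of_forall_pos_le_add fun ε hε => ?_
  set δ := min (ε / 2) (dist x y / 2)
  have hδ : 0 < δ := lt_min (by positivity) (by have := dist_pos.2 hne; positivity)
  obtain ⟨D, ⟨p, hp, hpx⟩, q, hq, hqy⟩ := ((hx δ hδ).and (hy δ hδ)).exists
  have h1 : δ ≤ ε / 2 := min_le_left _ _
  have h2 : δ ≤ dist x y / 2 := min_le_right _ _
  have hpq : p ≠ q := by
    rintro rfl
    have := dist_triangle_left x y p
    linarith
  have h3 := D.uniformlyDiscrete p hp q hq hpq
  have h4 := dist_triangle4 p x y q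
  rw [dist_comm y q] at h4
  linarith

/-- Close to `x` a set `D` has at most one point, so the point and its value can be followed along
the ultrafilter; the values converge because `Y` is compact. -/
lemma exists_limit_point (U : Ultrafilter (DecoratedSet X Y)) {x : X} (hx : x ∈ limitCarrier U) :
    ∃ (y : Y) (p : DecoratedSet X Y → X × Y), Tendsto p U (𝓝 (x, y)) ∧
      ∀ᶠ D in (U : Filter (DecoratedSet X Y)), ∃ h : (p D).1 ∈ D.carrier,
        D.val ⟨(p D).1, h⟩ = (p D).2 := by
  classical
  have h0 := hx (1 / 2) (by norm_num)
  -- `y₀` with its value in `D₀` only supplies a default for `p`, used for those `D` that have no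
  -- point near `x`.
  obtain ⟨D₀, y₀, hy₀, -⟩ := h0.exists
  let p : DecoratedSet X Y → X × Y := fun D =>
    if h : ∃ y ∈ D.carrier, dist y x < 1 / 2 then (h.choose, D.val ⟨h.choose, h.choose_spec.1⟩)
    else (y₀, D₀.val ⟨y₀, hy₀⟩)
  obtain ⟨y, -, hy⟩ := isCompact_univ.ultrafilter_le_nhds (U.map fun D => (p D).2) (by simp)
  refine ⟨y, p, ?_, ?_⟩
  · rw [nhds_prod_eq]
    refine (?_ : Tendsto (fun D => (p D).1) U (𝓝 x)).prodMk hy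
    rw [Metric.tendsto_nhds]
    intro ε hε
    filter_upwards [hx (min ε (1 / 2)) (lt_min hε (by norm_num)), h0] with D ⟨z, hz, hzx⟩ hD
    have : (p D).1 = z := by
      simp only [p, dif_pos hD]
      exact D.uniformlyDiscrete.eq_of_dist_lt_half hD.choose_spec.1 hz hD.choose_spec.2
        (hzx.trans_le (min_le_right _ _))
    rw [this]
    exact hzx.trans_le (min_le_left _ _)
  · filter_upwards [h0] with D hD
    simp only [p, dif_pos hD]
    exact ⟨hD.choose_spec.1, trivial⟩

omit [TopologicalSpace Y] [CompactSpace Y] in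
-- What is left of `K` after removing the balls around limit points is compact and consists of
-- non-limit points. Each of these has a ball that almost all `D` avoid, and finitely many such
-- balls suffice.
lemma eventually_near_limitCarrier (U : Ultrafilter (DecoratedSet X Y)) {K : Set X}
    (hK : IsCompact K) : ∀ᶠ D in (U : Filter (DecoratedSet X Y)), ∀ z ∈ D.carrier, z ∈ K →
      ∃ x ∈ K ∩ limitCarrier U, dist z x < 1 / 2 := by
  set K' := K \ ⋃ x ∈ K ∩ limitCarrier U, Metric.ball x (1 / 2)
  have hK' : IsCompact K' :=
    hK.diff (isOpen_biUnion fun _ _ => Metric.isOpen_ball)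
  have key : ∀ᶠ D in (U : Filter (DecoratedSet X Y)), ∀ y ∈ D.carrier, y ∉ K' := by
    refine hK'.induction_on (p := fun s => ∀ᶠ D in (U : Filter (DecoratedSet X Y)),
      ∀ y ∈ D.carrier, y ∉ s) (by simp)
      (fun s t hst h => h.mono fun D hD y hy hys => hD y hy (hst hys))
      (fun s t hs ht => (hs.and ht).mono fun D hD y hy hy' =>
        hy'.elim (hD.1 y hy) (hD.2 y hy)) ?_
    intro z hz
    have hzA : z ∉ limitCarrier U := fun h =>
      hz.2 (mem_biUnion (⟨hz.1, h⟩ : z ∈ K ∩ limitCarrier U) (Metric.mem_ball_self (by norm_num)))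
    simp only [limitCarrier, mem_ofPred_eq, not_forall] at hzA
    obtain ⟨ε, hε, h⟩ := hzA
    rw [← Ultrafilter.eventually_not] at h
    refine ⟨Metric.ball z ε, mem_nhdsWithin_of_mem_nhds (Metric.ball_mem_nhds z hε), ?_⟩
    exact h.mono fun D hD y hy hyz => hD ⟨y, hy, hyz⟩
  filter_upwards [key] with D hD z hz hzK
  have := hD z hz
  simp only [K', Set.mem_sdiff, not_and, not_not] at this
  obtain ⟨x, hx, hzx⟩ := mem_iUnion₂.1 (this hzK)
  exact ⟨x, hx, hzx⟩

lemma exists_le_nhds (U : Ultrafilter (DecoratedSet X Y)) :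
    ∃ D : DecoratedSet X Y, (U : Filter (DecoratedSet X Y)) ≤ 𝓝 D := by
  classical
  have hlim := fun x : limitCarrier U => exists_limit_point U x.2
  choose y p hp hmem using hlim
  have hA := limitCarrier_uniformlyDiscrete U
  refine ⟨⟨limitCarrier U, hA, y⟩, ?_⟩
  rw [← tendsto_id', tendsto_nhds_iff]
  intro φ
  obtain ⟨K, hK, hφ⟩ := exists_isCompact_eq_zero φ
  have hfin : {x : limitCarrier U | (x : X) ∈ K}.Finite :=
    ((hA.finite_inter hK).preimage Subtype.val_injective.injOn).subset fun x hx => ⟨hx, x.2⟩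
  set S := hfin.toFinset
  have hS : ∀ x, x ∈ S ↔ (x : X) ∈ K := fun x => by simp [S]
  have hlimit : ∑ᶠ x : limitCarrier U, φ ((x : X), y x) = ∑ x ∈ S, φ ((x : X), y x) := by
    refine finsum_eq_sum_of_support_subset _ fun x hx => ?_
    rw [Finset.mem_coe, hS]
    by_contra h
    exact hx (hφ _ h)
  show Tendsto _ _ (𝓝 (∑ᶠ x : limitCarrier U, φ ((x : X), y x)))
  rw [hlimit]
  have hsum : Tendsto (fun D => ∑ x ∈ S, φ (p x D)) U (𝓝 (∑ x ∈ S, φ ((x : X), y x))) :=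
    tendsto_finsetSum _ fun x _ => (φ.continuous.tendsto _).comp (hp x)
  refine hsum.congr' ?_
  have h1 : ∀ᶠ D in (U : Filter (DecoratedSet X Y)), ∀ x ∈ S, dist (p x D).1 x < 1 / 2 :=
    (Filter.eventually_all_finset S).2 fun x _ =>
      Metric.tendsto_nhds.1 ((continuous_fst.tendsto _).comp (hp x)) (1 / 2) (by norm_num)
  have h2 : ∀ᶠ D in (U : Filter (DecoratedSet X Y)), ∀ x ∈ S,
      ∃ h : (p x D).1 ∈ D.carrier, D.val ⟨(p x D).1, h⟩ = (p x D).2 :=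
    (Filter.eventually_all_finset S).2 fun x _ => hmem x
  filter_upwards [h1, h2, eventually_near_limitCarrier U hK] with D hd hD hnear
  choose hc hv using hD
  -- `q` matches the limit points in `K` with points of `D`. It is injective because limit points
  -- are at distance at least 1, and its image contains every point of `D` where `φ` does not
  -- vanish, so the two sums agree term by term.
  let q : S → D.carrier := fun x => ⟨(p x D).1, hc x x.2⟩
  have hq : Function.Injective q := by
    intro x x' hxx'
    have hxx'' : (p x D).1 = (p x' D).1 := congrArg Subtype.val hxx'
    refine Subtype.ext (Subtype.ext (hA.eq_of_dist_lt x.1.2 x'.1.2 ?_))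
    have a1 := hd x x.2
    have a2 := hd x' x'.2
    rw [← hxx''] at a2
    have := dist_triangle_left (x.1 : X) x'.1 (p x D).1
    linarith
  have hsupp : (Function.support fun z : D.carrier => φ ((z : X), D.val z)) ⊆
      (S.attach.image q : Finset D.carrier) := by
    intro z hz
    have hzK : (z : X) ∈ K := by
      by_contra h
      exact hz (hφ _ h)
    obtain ⟨x, ⟨hxK, hxA⟩, hzx⟩ := hnear z z.2 hzK
    rw [Finset.mem_coe, Finset.mem_image]
    have hxS : (⟨x, hxA⟩ : limitCarrier U) ∈ S := (hS _).2 hxK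
    exact ⟨⟨⟨x, hxA⟩, hxS⟩, Finset.mem_attach _ _, Subtype.ext
      (D.uniformlyDiscrete.eq_of_dist_lt_half (hc _ hxS) z.2 (hd _ hxS) hzx)⟩
  show _ = ∑ᶠ z : D.carrier, φ ((z : X), D.val z)
  rw [finsum_eq_sum_of_support_subset _ hsupp, Finset.sum_image fun _ _ _ _ h => hq h,
    ← Finset.sum_attach]
  refine Finset.sum_congr rfl fun x _ => ?_
  simp only [q]
  rw [hv x x.2]

/-- The topology on configurations is that of decorated sets with values in `DecoratedSet X Y`. A
function with compact support in the first variable alone is an admissible test function there only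
if this space of values is compact. -/
instance instCompactSpace : CompactSpace (DecoratedSet X Y) :=
  ⟨isCompact_iff_ultrafilter_le_nhds.2 fun U _ =>
    let ⟨D, hD⟩ := exists_le_nhds U; ⟨D, mem_univ _, hD⟩⟩

end Compact

section Translate

variable {Γ Y' : Type*} [Group Γ] [MulAction Γ X] [IsIsometricSMul Γ X]

lemma _root_.IsUniformlyDiscrete.smul {A : Set X} (hA : IsUniformlyDiscrete A) (γ : Γ) :
    IsUniformlyDiscrete (γ • A) := by
  rintro _ ⟨x, hx, rfl⟩ _ ⟨y, hy, rfl⟩ hne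
  simpa using hA x hx y hy fun e => hne (by rw [e])

/-- Translation of the carrier, combined with a map of the values. -/
def translateMap (γ : Γ) (g : Y → Y') (D : DecoratedSet X Y) : DecoratedSet X Y' where
  carrier := γ • D.carrier
  uniformlyDiscrete := D.uniformlyDiscrete.smul γ
  val := fun x => g (D.val ⟨γ⁻¹ • (x : X), Set.mem_smul_set_iff_inv_smul_mem.1 x.2⟩)

/-- The bijection `A ≃ γ A`. -/
@[simps]
def _root_.Set.translateEquiv (γ : Γ) (A : Set X) : A ≃ (γ • A : Set X) where
  toFun x := ⟨γ • (x : X), Set.smul_mem_smul_set x.2⟩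
  invFun x := ⟨γ⁻¹ • (x : X), Set.mem_smul_set_iff_inv_smul_mem.1 x.2⟩
  left_inv x := by simp
  right_inv x := by simp

/-- Test functions pull back to test functions: `g` need not be proper, but `Y` is compact, so only
the support in the first variable matters. Used twice, nested, it makes the action on configurations
continuous. -/
lemma continuous_translateMap [CompactSpace Y] [TopologicalSpace Y'] (γ : Γ) {g : Y → Y'}
    (hg : Continuous g) : Continuous (translateMap γ g : DecoratedSet X Y → DecoratedSet X Y') := by
  rw [continuous_iff]
  intro φ
  obtain ⟨K, hK, hφ⟩ := exists_isCompact_eq_zero φ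
  have hK' : IsCompact (γ⁻¹ • K) := hK.image (isometry_smul X γ⁻¹).continuous
  let ψ : C(X × Y, ℂ) := ⟨fun p => φ (γ • p.1, g p.2), φ.continuous.comp
    (((isometry_smul X γ).continuous.comp continuous_fst).prodMk (hg.comp continuous_snd))⟩
  have hψ : ∀ p : X × Y, p.1 ∉ γ⁻¹ • K → ψ p = 0 := fun p hp =>
    hφ _ fun h => hp (by simpa [Set.mem_smul_set_iff_inv_smul_mem] using h)
  refine (continuous_finsum (testFunction ψ hK' hψ)).congr fun D => ?_
  refine finsum_eq_of_bijective _ (Set.translateEquiv γ D.carrier).bijective fun x => ?_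
  simp [translateMap, ψ]

end Translate

end DecoratedSet

/-! ### Measurability of the elementary functions of a configuration -/

/-- `g` is the pointwise limit of continuous functions that vanish outside a common compact set. -/
def CompactlySupportedLimit {X : Type*} [TopologicalSpace X] (g : X → ℂ) : Prop :=
  ∃ (f : ℕ → C(X, ℂ)) (K : Set X), IsCompact K ∧ (∀ n x, x ∉ K → f n x = 0) ∧
    ∀ x, Tendsto (fun n => f n x) atTop (𝓝 (g x))

lemma IsClosed.exists_tendsto_indicator {X : Type*} [MetricSpace X] {C : Set X} (hC : IsClosed C) :
    ∃ f : ℕ → C(X, ℂ), (∀ n, ∀ x ∈ C, f n x = 1) ∧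
      ∀ x, Tendsto (fun n => f n x) atTop (𝓝 (C.indicator 1 x)) := by
  refine ⟨fun n => ⟨fun x => ((hC.apprSeq n x : NNReal) : ℂ), ?_⟩, fun n x hx => ?_, fun x => ?_⟩
  · exact Complex.continuous_ofReal.comp (NNReal.continuous_coe.comp (hC.apprSeq n).continuous)
  · simp [HasOuterApproxClosed.apprSeq_apply_eq_one hC n hx]
  · have h := tendsto_pi_nhds.1 (HasOuterApproxClosed.tendsto_apprSeq hC) x
    have h' := (Complex.continuous_ofReal.tendsto _).comp
      ((NNReal.continuous_coe.tendsto _).comp h)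
    have e : C.indicator (1 : X → ℂ) x = ((C.indicator (fun _ => (1 : NNReal)) x : NNReal) : ℂ) := by
      by_cases hx : x ∈ C <;> simp [hx]
    rw [e]
    exact h'

lemma IsOpen.exists_tendsto_indicator {X : Type*} [MetricSpace X] {V : Set X} (hV : IsOpen V) :
    ∃ f : ℕ → C(X, ℂ), (∀ n, ∀ x ∉ V, f n x = 0) ∧
      ∀ x, Tendsto (fun n => f n x) atTop (𝓝 (V.indicator 1 x)) := by
  obtain ⟨f, hf1, hf⟩ := hV.isClosed_compl.exists_tendsto_indicator
  refine ⟨fun n => 1 - f n, fun n x hx => ?_, fun x => ?_⟩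
  · simp [hf1 n x hx]
  · have := (tendsto_const_nhds (x := (1 : ℂ))).sub (hf x)
    have e : V.indicator (1 : X → ℂ) x = 1 - Vᶜ.indicator (1 : X → ℂ) x := by
      by_cases hx : x ∈ V <;> simp [hx]
    rw [e]
    exact this

lemma CompactlySupportedLimit.mul {X : Type*} [TopologicalSpace X] {g g' : X → ℂ}
    (hg : CompactlySupportedLimit g) {f : ℕ → C(X, ℂ)}
    (hf : ∀ x, Tendsto (fun n => f n x) atTop (𝓝 (g' x))) :
    CompactlySupportedLimit fun x => g x * g' x := by
  obtain ⟨k, K, hK, h0, hk⟩ := hg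
  exact ⟨fun n => k n * f n, K, hK, fun n x hx => by simp [h0 n x hx],
    fun x => (hk x).mul (hf x)⟩

/-- A set of diameter less than `1` whose indicator function is a limit of continuous functions
with common compact support. -/
structure IsSmallCell {X : Type*} [MetricSpace X] (B : Set X) : Prop where
  dist_lt : ∀ x ∈ B, ∀ y ∈ B, dist x y < 1
  limit : CompactlySupportedLimit (B.indicator (1 : X → ℂ))

lemma IsSmallCell.inter_isOpen {X : Type*} [MetricSpace X] {B V : Set X} (hB : IsSmallCell B)
    (hV : IsOpen V) : IsSmallCell (B ∩ V) := by
  obtain ⟨f, -, hf⟩ := hV.exists_tendsto_indicator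
  refine ⟨fun x hx y hy => hB.dist_lt x hx.1 y hy.1, ?_⟩
  convert hB.limit.mul hf using 2 with x
  by_cases h1 : x ∈ B <;> by_cases h2 : x ∈ V <;> simp [h1, h2]

lemma IsSmallCell.diff_isOpen {X : Type*} [MetricSpace X] {B V : Set X} (hB : IsSmallCell B)
    (hV : IsOpen V) : IsSmallCell (B \ V) := by
  obtain ⟨f, -, hf⟩ := hV.isClosed_compl.exists_tendsto_indicator
  refine ⟨fun x hx y hy => hB.dist_lt x hx.1 y hy.1, ?_⟩
  convert hB.limit.mul hf using 2 with x
  by_cases h1 : x ∈ B <;> by_cases h2 : x ∈ V <;> simp [h1, h2]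

/-- Cover X by countably many precompact open sets of small diameter and make them disjoint. Each
cell is an open set minus an open set, so its indicator is still a limit of continuous functions
with common compact support. -/
lemma exists_smallCell_partition (X : Type*) [MetricSpace X] [LocallyCompactSpace X]
    [SecondCountableTopology X] :
    ∃ B : ℕ → Set X, (∀ i, IsSmallCell (B i)) ∧ Pairwise (Function.onFun Disjoint B) ∧
      ⋃ i, B i = univ := by
  have hloc : ∀ x : X, ∃ V : Set X, IsOpen V ∧ x ∈ V ∧ (∀ y ∈ V, ∀ z ∈ V, dist y z < 1) ∧
      IsCompact (closure V) := by
    intro x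
    obtain ⟨K, hK, hxK⟩ := exists_compact_mem_nhds x
    refine ⟨interior K ∩ Metric.ball x (1 / 2), isOpen_interior.inter Metric.isOpen_ball,
      ⟨mem_interior_iff_mem_nhds.2 hxK, Metric.mem_ball_self (by norm_num)⟩, ?_,
      hK.closure_of_subset (inter_subset_left.trans interior_subset)⟩
    intro y hy z hz
    have h1 := Metric.mem_ball.1 hy.2
    have h2 := Metric.mem_ball.1 hz.2
    have := dist_triangle_right y z x
    linarith
  choose V hVo hxV hVd hVc using hloc
  have hcov : ∃ U : ℕ → Set X, (∀ i, IsOpen (U i) ∧ (∀ y ∈ U i, ∀ z ∈ U i, dist y z < 1) ∧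
      IsCompact (closure (U i))) ∧ ⋃ i, U i = univ := by
    rcases isEmpty_or_nonempty X with hX | hX
    · exact ⟨fun _ => ∅, by simp, Subsingleton.elim _ _⟩
    · obtain ⟨s, hs, hs'⟩ := TopologicalSpace.countable_cover_nhds
        fun x => (hVo x).mem_nhds (hxV x)
      have hne : s.Nonempty := by
        by_contra h
        rw [not_nonempty_iff_eq_empty] at h
        simp [h] at hs'
        exact (Set.univ_nonempty (α := X)).ne_empty hs'.symm
      obtain ⟨e, rfl⟩ := hs.exists_eq_range hne
      exact ⟨fun i => V (e i), fun i => ⟨hVo _, hVd _, hVc _⟩, by simpa using hs'⟩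
  obtain ⟨U, hU, hUcov⟩ := hcov
  refine ⟨disjointed U, fun i => ?_, disjoint_disjointed U, by rw [iUnion_disjointed, hUcov]⟩
  have hcell : IsSmallCell (U i) := by
    refine ⟨(hU i).2.1, ?_⟩
    obtain ⟨f, hf0, hf⟩ := (hU i).1.exists_tendsto_indicator
    exact ⟨f, closure (U i), (hU i).2.2, fun n x hx => hf0 n x fun h => hx (subset_closure h), hf⟩
  rw [disjointed_apply]
  refine hcell.diff_isOpen ?_
  rw [Finset.sup_set_eq_biUnion]
  exact isOpen_biUnion fun j _ => (hU j).1

namespace Config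

variable {X Y Γ : Type*} [MetricSpace X] [TopologicalSpace Y]

lemma continuous_toDecoratedSet :
    Continuous (toDecoratedSet : Config X Y → DecoratedSet X (DecoratedSet X Y)) :=
  continuous_induced_dom

section Continuity

variable [CompactSpace Y]

lemma continuous_finsum (f : C(X, ℂ)) {K : Set X} (hK : IsCompact K)
    (hf : ∀ x, x ∉ K → f x = 0) :
    Continuous fun ω : Config X Y => ∑ᶠ x : ω.carrier, f x := by
  have := (DecoratedSet.continuous_finsum (Y := DecoratedSet X Y)
    (DecoratedSet.testFunction (f.comp ⟨Prod.fst, continuous_fst⟩) hK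
      fun p hp => hf _ hp)).comp (continuous_toDecoratedSet (X := X) (Y := Y))
  exact this

/-- The inner sum is a continuous function of `h(x, ·)` as a decorated set, so the outer sum is a
test sum for the nested vague topology. -/
lemma continuous_finsum_finsum (f g : C(X, ℂ)) {K K' : Set X} (hK : IsCompact K)
    (hK' : IsCompact K') (hf : ∀ x, x ∉ K → f x = 0) (hg : ∀ x, x ∉ K' → g x = 0) (ψ : C(Y, ℂ)) :
    Continuous fun ω : Config X Y =>
      ∑ᶠ x : ω.carrier, f x * ∑ᶠ y : ω.carrier, g y * ψ (ω.h x y) := by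
  let G : C(X × Y, ℂ) := ⟨fun p => g p.1 * ψ p.2, by fun_prop⟩
  let Φ : C(DecoratedSet X Y, ℂ) := ⟨_, DecoratedSet.continuous_finsum
    (DecoratedSet.testFunction G hK' fun p hp => by simp [G, hg _ hp])⟩
  let Ψ : C(X × DecoratedSet X Y, ℂ) := ⟨fun p => f p.1 * Φ p.2, by fun_prop⟩
  exact (DecoratedSet.continuous_finsum (Y := DecoratedSet X Y)
    (DecoratedSet.testFunction Ψ hK fun p hp => by simp [Ψ, hf _ hp])).comp
      (continuous_toDecoratedSet (X := X) (Y := Y))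

lemma continuous_const_smul [Group Γ] [MulAction Γ X] [IsIsometricSMul Γ X] (γ : Γ) :
    Continuous fun ω : Config X Y => γ • ω := by
  rw [continuous_induced_rng]
  exact (DecoratedSet.continuous_translateMap γ
    (DecoratedSet.continuous_translateMap γ continuous_id)).comp continuous_toDecoratedSet

lemma measurable_const_smul [Group Γ] [MulAction Γ X] [IsIsometricSMul Γ X] (γ : Γ) :
    Measurable fun ω : Config X Y => γ • ω :=
  (continuous_const_smul γ).measurable

end Continuity

/-- The configurations that have a point in `B`. -/
def occupied (B : Set X) : Set (Config X Y) := {ω | (B ∩ ω.carrier).Nonempty}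

/-- A point of the configuration in `B`. -/
def cellPoint {B : Set X} {ω : Config X Y} (h : ω ∈ occupied B) : ω.carrier :=
  ⟨h.some, h.some_mem.2⟩

omit [TopologicalSpace Y] in
lemma cellPoint_mem {B : Set X} {ω : Config X Y} (h : ω ∈ occupied B) :
    (cellPoint h : X) ∈ B := h.some_mem.1

omit [TopologicalSpace Y] in
lemma eq_cellPoint {B : Set X} (hB : IsSmallCell B) {ω : Config X Y} (h : ω ∈ occupied B)
    {x : ω.carrier} (hx : (x : X) ∈ B) : x = cellPoint h :=
  Subtype.ext (ω.uniformlyDiscrete.eq_of_dist_lt x.2 (cellPoint h).2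
    (hB.dist_lt _ hx _ (cellPoint_mem h)))

open Classical in
/-- A point of the configuration in `B` if there is one, and an arbitrary point otherwise. -/
def point [Nonempty X] (B : Set X) (ω : Config X Y) : X :=
  if h : ω ∈ occupied B then cellPoint h else Classical.arbitrary X

omit [TopologicalSpace Y] in
lemma point_eq [Nonempty X] {B : Set X} {ω : Config X Y} (h : ω ∈ occupied B) :
    point B ω = cellPoint h := dif_pos h

omit [TopologicalSpace Y] in
open Classical in
lemma finsum_indicator_mul {B : Set X} (hB : IsSmallCell B) (ω : Config X Y) (F : ω.carrier → ℂ) :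
    ∑ᶠ x : ω.carrier, B.indicator (1 : X → ℂ) x * F x =
      if h : ω ∈ occupied B then F (cellPoint h) else 0 := by
  split_ifs with h
  · rw [finsum_eq_single _ (cellPoint h)]
    · simp [cellPoint_mem h]
    · intro x hx
      have : (x : X) ∉ B := fun hxB => hx (eq_cellPoint hB h hxB)
      simp [this]
  · refine finsum_eq_zero_of_forall_eq_zero fun x => ?_
    have : (x : X) ∉ B := fun hxB => h ⟨x, hxB, x.2⟩
    simp [this]

section Measurability

variable [CompactSpace Y]

/-- For fixed `ω` all the approximating sums run over the finitely many points in one compact set,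
so pointwise convergence of the functions gives convergence of the sums. -/
lemma measurable_finsum {g : X → ℂ} (hg : CompactlySupportedLimit g) :
    Measurable fun ω : Config X Y => ∑ᶠ x : ω.carrier, g x := by
  obtain ⟨f, K, hK, hf0, hf⟩ := hg
  refine measurable_of_tendsto_metrizable
    (fun n => (continuous_finsum (Y := Y) (f n) hK (hf0 n)).measurable) ?_
  rw [tendsto_pi_nhds]
  intro ω
  have hfin : {x : ω.carrier | (x : X) ∈ K}.Finite :=
    ((ω.uniformlyDiscrete.finite_inter hK).preimage Subtype.val_injective.injOn).subset
      fun x hx => ⟨hx, x.2⟩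
  have hg0 : ∀ x, x ∉ K → g x = 0 := fun x hx =>
    tendsto_nhds_unique (hf x) (by simp [hf0 _ x hx])
  have hsum : ∀ k : X → ℂ, (∀ x, x ∉ K → k x = 0) →
      ∑ᶠ x : ω.carrier, k x = ∑ x ∈ hfin.toFinset, k x := fun k hk =>
    finsum_eq_sum_of_support_subset _ fun x hx => by
      simpa using not_imp_comm.1 (hk x) hx
  rw [hsum g hg0]
  simp_rw [fun n => hsum (f n) (hf0 n)]
  exact tendsto_finsetSum _ fun x _ => hf x

lemma measurable_finsum_finsum {g g' : X → ℂ} (hg : CompactlySupportedLimit g)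
    (hg' : CompactlySupportedLimit g') (ψ : C(Y, ℂ)) :
    Measurable fun ω : Config X Y =>
      ∑ᶠ x : ω.carrier, g x * ∑ᶠ y : ω.carrier, g' y * ψ (ω.h x y) := by
  obtain ⟨f, K, hK, hf0, hf⟩ := hg
  obtain ⟨f', K', hK', hf0', hf'⟩ := hg'
  refine measurable_of_tendsto_metrizable
    (fun n => (continuous_finsum_finsum (f n) (f' n) hK hK' (hf0 n) (hf0' n) ψ).measurable) ?_
  rw [tendsto_pi_nhds]
  intro ω
  have hfin : ∀ {C : Set X}, IsCompact C → {x : ω.carrier | (x : X) ∈ C}.Finite := fun hC =>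
    ((ω.uniformlyDiscrete.finite_inter hC).preimage Subtype.val_injective.injOn).subset
      fun x hx => ⟨hx, x.2⟩
  have hg0 : ∀ x, x ∉ K → g x = 0 := fun x hx =>
    tendsto_nhds_unique (hf x) (by simp [hf0 _ x hx])
  have hg0' : ∀ x, x ∉ K' → g' x = 0 := fun x hx =>
    tendsto_nhds_unique (hf' x) (by simp [hf0' _ x hx])
  have hsum : ∀ {C : Set X} (hC : IsCompact C) (k : X → ℂ) (F : ω.carrier → ℂ),
      (∀ x, x ∉ C → k x = 0) →
      ∑ᶠ x : ω.carrier, k x * F x = ∑ x ∈ (hfin hC).toFinset, k x * F x := fun hC k F hk =>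
    finsum_eq_sum_of_support_subset _ fun x hx => by
      by_contra h
      simp at h
      exact hx (by simp [hk x h])
  rw [hsum hK g _ hg0]
  refine Tendsto.congr (fun n => (hsum hK (f n) _ (hf0 n)).symm) ?_
  refine tendsto_finsetSum _ fun x _ => (hf x).mul ?_
  rw [hsum hK' g' _ hg0']
  refine Tendsto.congr (fun n => (hsum hK' (f' n) _ (hf0' n)).symm) ?_
  exact tendsto_finsetSum _ fun y _ => (hf' y).mul tendsto_const_nhds

lemma measurableSet_occupied {B : Set X} (hB : IsSmallCell B) :
    MeasurableSet (occupied B : Set (Config X Y)) := by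
  classical
  have h := measurable_finsum (Y := Y) hB.limit
  have : (occupied B : Set (Config X Y)) =
      (fun ω : Config X Y => ∑ᶠ x : ω.carrier, B.indicator (1 : X → ℂ) x) ⁻¹' {0}ᶜ := by
    ext ω
    have e : ∑ᶠ x : ω.carrier, B.indicator (1 : X → ℂ) x =
        if ω ∈ occupied B then 1 else 0 := by
      simpa using finsum_indicator_mul hB ω fun _ => 1
    rw [mem_preimage, e]
    split_ifs with h <;> simp [h]
  rw [this]
  exact h (measurableSet_singleton 0).compl

/-- The point lies in an open set V exactly when the smaller cell B ∩ V is occupied; on unoccupied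
configurations it is constant. -/
lemma measurable_point [Nonempty X] [MeasurableSpace X] [BorelSpace X] {B : Set X}
    (hB : IsSmallCell B) : Measurable (point B : Config X Y → X) := by
  classical
  refine measurable_of_isOpen fun V hV => ?_
  have hocc := measurableSet_occupied (Y := Y) hB
  have hoccV := measurableSet_occupied (Y := Y) (hB.inter_isOpen hV)
  have key : ∀ ω : Config X Y, ω ∈ occupied B → (point B ω ∈ V ↔ ω ∈ occupied (B ∩ V)) := by
    intro ω h
    rw [point_eq h]
    constructor
    · exact fun hv => ⟨_, ⟨cellPoint_mem h, hv⟩, (cellPoint h).2⟩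
    · rintro ⟨x, ⟨hxB, hxV⟩, hx⟩
      rwa [← eq_cellPoint hB h (x := ⟨x, hx⟩) hxB]
  have : (point B : Config X Y → X) ⁻¹' V = occupied (B ∩ V) ∪
      ((occupied B)ᶜ ∩ {_ω | Classical.arbitrary X ∈ V}) := by
    ext ω
    by_cases h : ω ∈ occupied B
    · simp [key ω h, h]
    · have h' : ω ∉ (occupied (B ∩ V) : Set (Config X Y)) :=
        fun ⟨x, hx, hx'⟩ => h ⟨x, hx.1, hx'⟩
      simp [h, h', point]
  rw [this]
  exact hoccV.union (hocc.compl.inter (MeasurableSet.const _))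

open Classical in
-- With cell indicators as weights, the double sum has at most one nonzero term.
lemma measurable_kernel {B B' : Set X} (hB : IsSmallCell B) (hB' : IsSmallCell B') (ψ : C(Y, ℂ)) :
    Measurable fun ω : Config X Y => if h : ω ∈ occupied B then
      if h' : ω ∈ occupied B' then ψ (ω.h (cellPoint h) (cellPoint h')) else 0 else 0 := by
  convert measurable_finsum_finsum (Y := Y) hB.limit hB'.limit ψ using 2 with ω
  rw [finsum_indicator_mul hB]
  simp_rw [finsum_indicator_mul hB' ω]

end Measurability

end Config

/-! ### Kernel projections of bounded selfadjoint operators -/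

section Hilbert

variable {E : Type*} [NormedAddCommGroup E] [InnerProductSpace ℂ E] [CompleteSpace E]

/-- The orthogonal projection onto the kernel of a bounded operator. -/
def kerProj (S : E →L[ℂ] E) : E →L[ℂ] E := (S.ker).starProjection

/-- For selfadjoint `S` the orthogonal complement of the kernel is the closure of the range. The `T
n` fix the kernel, tend to zero on the range, and by the uniform norm bound also on its closure. -/
lemma tendsto_kerProj {S : E →L[ℂ] E} (hS : IsSelfAdjoint S) {T : ℕ → E →L[ℂ] E}
    (hT : ∀ n, ‖T n‖ ≤ 1) (hker : ∀ n v, S v = 0 → T n v = v)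
    (hran : ∀ v, Tendsto (fun n => T n (S v)) atTop (𝓝 0)) (v : E) :
    Tendsto (fun n => T n v) atTop (𝓝 (kerProj S v)) := by
  set w := v - kerProj S v
  have hw : w ∈ closure (range S) := by
    have h1 : w ∈ (S.ker)ᗮ := Submodule.sub_starProjection_mem_orthogonal v
    rw [ContinuousLinearMap.orthogonal_ker, hS.adjoint_eq] at h1
    exact h1
  have hw0 : Tendsto (fun n => T n w) atTop (𝓝 0) := by
    rw [Metric.tendsto_atTop]
    intro ε hε
    obtain ⟨_, ⟨x, rfl⟩, hx⟩ := Metric.mem_closure_iff.1 hw (ε / 2) (by positivity)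
    obtain ⟨N, hN⟩ := Metric.tendsto_atTop.1 (hran x) (ε / 2) (by positivity)
    refine ⟨N, fun n hn => ?_⟩
    have h1 := hN n hn
    rw [dist_zero_right] at h1 ⊢
    have h2 : ‖T n (w - S x)‖ ≤ ‖w - S x‖ :=
      ((T n).le_opNorm _).trans (mul_le_of_le_one_left (norm_nonneg _) (hT n))
    rw [dist_eq_norm] at hx
    calc ‖T n w‖ = ‖T n (w - S x) + T n (S x)‖ := by rw [← map_add, sub_add_cancel]
      _ ≤ ‖T n (w - S x)‖ + ‖T n (S x)‖ := norm_add_le _ _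
      _ < ε := by linarith
  have hfix : ∀ n, T n v = kerProj S v + T n w := by
    intro n
    have : S (kerProj S v) = 0 := Submodule.starProjection_apply_mem (U := S.ker) v
    rw [← hker n _ this, ← map_add]
    simp [w]
  simp_rw [hfix]
  simpa using tendsto_const_nhds.add hw0

lemma norm_spectrum_le {S : E →L[ℂ] E} {t : ℝ} (ht : t ∈ spectrum ℝ S) : |t| ≤ ‖S‖ := by
  have h := spectrum.norm_le_norm_mul_of_mem ht
  have h1 : ‖(1 : E →L[ℂ] E)‖ ≤ 1 := ContinuousLinearMap.norm_id_le
  calc |t| ≤ ‖S‖ * ‖(1 : E →L[ℂ] E)‖ := h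
    _ ≤ ‖S‖ := mul_le_of_le_one_right (norm_nonneg _) h1

/-- Bernoulli gives (1 + ns)(1 - s)^n ≤ (1 + s)^n (1 - s)^n ≤ 1, and (n + 1)s ≤ 1 + ns because s ≤
1. -/
lemma mul_one_sub_pow_le {s : ℝ} (h0 : 0 ≤ s) (h1 : s ≤ 1) (n : ℕ) :
    s * (1 - s) ^ n ≤ 1 / (n + 1) := by
  have hb : 1 + (n : ℝ) * s ≤ (1 + s) ^ n := one_add_mul_le_pow (by linarith) n
  have hprod : (1 + s) ^ n * (1 - s) ^ n ≤ 1 := by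
    rw [← mul_pow]
    exact pow_le_one₀ (by nlinarith) (by nlinarith)
  have hp : 0 ≤ (1 - s) ^ n := pow_nonneg (by linarith) n
  have h2 : (1 - s) ^ n ≤ 1 := pow_le_one₀ (by linarith) (by linarith)
  rw [le_div_iff₀ (by positivity)]
  have h3 : (1 + n * s) * (1 - s) ^ n ≤ 1 := (mul_le_mul_of_nonneg_right hb hp).trans hprod
  nlinarith

lemma cfc_one_sub_sq_pow {S : E →L[ℂ] E} (hS : IsSelfAdjoint S) (n : ℕ) :
    cfc (fun t : ℝ => (1 - t ^ 2) ^ n) S = (1 - S ^ 2) ^ n := by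
  rw [cfc_pow (fun t : ℝ => 1 - t ^ 2) n S, cfc_sub (fun _ : ℝ => 1) (fun t : ℝ => t ^ 2) S,
    cfc_const_one ℝ S, cfc_pow_id S 2]

lemma norm_one_sub_sq_pow_le {S : E →L[ℂ] E} (hS : IsSelfAdjoint S) (h1 : ‖S‖ ≤ 1) (n : ℕ) :
    ‖(1 - S ^ 2) ^ n‖ ≤ 1 := by
  rw [← cfc_one_sub_sq_pow hS]
  refine norm_cfc_le zero_le_one fun t ht => ?_
  have ht1 := (norm_spectrum_le ht).trans h1
  have ht2 : t ^ 2 ≤ 1 := (sq_le_one_iff_abs_le_one t).2 ht1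
  rw [Real.norm_eq_abs, abs_of_nonneg (pow_nonneg (by linarith) n)]
  exact pow_le_one₀ (by linarith) (by nlinarith [sq_nonneg t])

/-- The square of the function (1 - t²)^n t is at most t²(1 - t²)^n on the spectrum, so
`mul_one_sub_pow_le` applies with s = t². -/
lemma norm_one_sub_sq_pow_mul_le {S : E →L[ℂ] E} (hS : IsSelfAdjoint S) (h1 : ‖S‖ ≤ 1) (n : ℕ) :
    ‖(1 - S ^ 2) ^ n * S‖ ≤ Real.sqrt (1 / (n + 1)) := by
  have : (1 - S ^ 2) ^ n * S = cfc (fun t : ℝ => (1 - t ^ 2) ^ n * t) S := by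
    rw [cfc_mul (fun t : ℝ => (1 - t ^ 2) ^ n) (fun t => t) S, cfc_one_sub_sq_pow hS, cfc_id' ℝ S]
  rw [this]
  refine norm_cfc_le (Real.sqrt_nonneg _) fun t ht => ?_
  have ht1 := (norm_spectrum_le ht).trans h1
  have ht2 : t ^ 2 ≤ 1 := (sq_le_one_iff_abs_le_one t).2 ht1
  rw [Real.norm_eq_abs]
  refine Real.abs_le_sqrt ?_
  have h3 := mul_one_sub_pow_le (sq_nonneg t) ht2 n
  have h4 : 0 ≤ (1 - t ^ 2) ^ n := pow_nonneg (by linarith) n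
  have h5 : (1 - t ^ 2) ^ n ≤ 1 := pow_le_one₀ (by linarith) (by nlinarith [sq_nonneg t])
  calc ((1 - t ^ 2) ^ n * t) ^ 2 = (t ^ 2 * (1 - t ^ 2) ^ n) * (1 - t ^ 2) ^ n := by ring
    _ ≤ t ^ 2 * (1 - t ^ 2) ^ n := mul_le_of_le_one_right (by positivity) h5
    _ ≤ _ := h3

/-- The polynomials (1 - t²)^n concentrate at 0 on [-1, 1]. Reaching the kernel projection by
polynomials, rather than by Borel functional calculus, is what makes its matrix entries measurable.
-/
lemma tendsto_one_sub_sq_pow {S : E →L[ℂ] E} (hS : IsSelfAdjoint S) (h1 : ‖S‖ ≤ 1) (v : E) :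
    Tendsto (fun n : ℕ => ((1 - S ^ 2) ^ n : E →L[ℂ] E) v) atTop (𝓝 (kerProj S v)) := by
  refine tendsto_kerProj hS (fun n => norm_one_sub_sq_pow_le hS h1 n) (fun n v hv => ?_)
    (fun v => ?_) v
  · have h2 : (1 - S ^ 2 : E →L[ℂ] E) v = v := by simp [pow_two, hv]
    induction n with
    | zero => simp
    | succ n ih => rw [pow_succ, mul_apply_eq_comp, h2, ih]
  · have hlim : Tendsto (fun n : ℕ => Real.sqrt (1 / ((n : ℝ) + 1)) * ‖v‖) atTop (𝓝 0) := by
      have := (Real.continuous_sqrt.tendsto 0).comp tendsto_one_div_add_atTop_nhds_zero_nat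
      simpa using this.mul_const ‖v‖
    refine squeeze_zero_norm (fun n => ?_) hlim
    exact (((1 - S ^ 2) ^ n * S).le_opNorm v).trans
      (mul_le_mul_of_nonneg_right (norm_one_sub_sq_pow_mul_le hS h1 n) (norm_nonneg v))

lemma kerProj_smul {S : E →L[ℂ] E} {c : ℂ} (hc : c ≠ 0) : kerProj (c • S) = kerProj S := by
  have : ((c • S : E →L[ℂ] E)).ker = S.ker := by
    ext v
    simp [hc]
  unfold kerProj
  congr!

lemma tendsto_kerProj_of_norm_le {S : E →L[ℂ] E} (hS : IsSelfAdjoint S) {M : ℝ} (hM : 0 < M)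
    (h : ‖S‖ ≤ M) (v : E) :
    Tendsto (fun n : ℕ => ((1 - (((M⁻¹ : ℝ) : ℂ) • S) ^ 2) ^ n : E →L[ℂ] E) v) atTop
      (𝓝 (kerProj S v)) := by
  rw [← kerProj_smul (S := S) (c := ((M⁻¹ : ℝ) : ℂ))
    (Complex.ofReal_ne_zero.2 (inv_ne_zero hM.ne'))]
  refine tendsto_one_sub_sq_pow ?_ ?_ v
  · exact IsSelfAdjoint.smul (Complex.conj_ofReal _) hS
  · rw [norm_smul, Complex.norm_real, norm_inv, Real.norm_of_nonneg hM.le, inv_mul_le_iff₀ hM,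
      mul_one]
    exact h

lemma kerProj_isPositive (S : E →L[ℂ] E) : (kerProj S).IsPositive :=
  ContinuousLinearMap.IsPositive.of_isStarProjection (isStarProjection_starProjection)

lemma norm_kerProj_le (S : E →L[ℂ] E) : ‖kerProj S‖ ≤ 1 := Submodule.starProjection_norm_le _

omit [CompleteSpace E] in
lemma starProjection_sub_starProjection (K L : Submodule ℂ E) [K.HasOrthogonalProjection]
    [L.HasOrthogonalProjection] [(Kᗮ ⊓ L).HasOrthogonalProjection] (h : K ≤ L) :
    (Kᗮ ⊓ L).starProjection = L.starProjection - K.starProjection := by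
  ext v
  apply Submodule.eq_starProjection_of_mem_of_inner_eq_zero
  · refine ⟨fun u hu => ?_, L.sub_mem (Submodule.starProjection_apply_mem L v)
      (h (Submodule.starProjection_apply_mem K v))⟩
    have h1 : inner ℂ u (v - L.starProjection v) = 0 :=
      Submodule.sub_starProjection_mem_orthogonal v u (h hu)
    have h2 : inner ℂ u (v - K.starProjection v) = 0 :=
      Submodule.sub_starProjection_mem_orthogonal v u hu
    rw [sub_apply, inner_sub_right]
    rw [inner_sub_right] at h1 h2
    linear_combination h2 - h1
  · rintro w ⟨hw1, hw2⟩
    have h1 : inner ℂ (v - L.starProjection v) w = 0 :=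
      Submodule.starProjection_inner_eq_zero v w hw2
    have h2 : inner ℂ (K.starProjection v) w = 0 := hw1 _ (Submodule.starProjection_apply_mem K v)
    rw [sub_apply, ← sub_add, inner_add_left, h1, h2, add_zero]

lemma functionalCalculus_conj {F : Type*} [NormedAddCommGroup F] [InnerProductSpace ℂ F]
    [CompleteSpace F] (U : E ≃ₗᵢ[ℂ] F) {T : E →L[ℂ] E} (hT : IsSelfAdjoint T) {φ : ℝ → ℝ}
    (hφ : Continuous φ) :
    functionalCalculus φ (U.conjStarAlgEquiv T) = U.conjStarAlgEquiv (functionalCalculus φ T) := by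
  have hcont : Continuous (U.conjStarAlgEquiv : (E →L[ℂ] E) → (F →L[ℂ] F)) := by
    have : Continuous fun x : E →L[ℂ] E =>
        (U : E →L[ℂ] F) ∘L x ∘L (U.symm : F →L[ℂ] E) :=
      continuous_const.clm_comp (continuous_id.clm_comp continuous_const)
    exact this
  unfold functionalCalculus
  exact (StarAlgHomClass.map_cfc (S := ℂ) U.conjStarAlgEquiv φ T
    hφ.continuousOn hcont hT (hT.map _)).symm

/-- A real polynomial of a bounded operator, written with complex coefficients. -/
def polynomialOperator (p : Polynomial ℝ) (T : E →L[ℂ] E) : E →L[ℂ] E :=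
  ∑ i ∈ Finset.range (p.natDegree + 1), (p.coeff i : ℂ) • T ^ i

lemma cfc_polynomial_eq {T : E →L[ℂ] E} (hT : IsSelfAdjoint T) (p : Polynomial ℝ) :
    functionalCalculus (fun t => p.eval t) T = polynomialOperator p T := by
  unfold functionalCalculus polynomialOperator
  rw [cfc_polynomial p T hT, Polynomial.aeval_eq_sum_range]
  refine Finset.sum_congr rfl fun i _ => ?_
  ext v
  simp

lemma norm_functionalCalculus_sub_le {T : E →L[ℂ] E} {C : ℝ} (hC : ‖T‖ ≤ C) {φ ψ : ℝ → ℝ}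
    (hφ : Continuous φ) (hψ : Continuous ψ) {ε : ℝ} (hε : 0 ≤ ε)
    (h : ∀ t ∈ Icc (-C) C, |φ t - ψ t| ≤ ε) :
    ‖functionalCalculus φ T - functionalCalculus ψ T‖ ≤ ε := by
  unfold functionalCalculus
  rw [← cfc_sub φ ψ T hφ.continuousOn hψ.continuousOn]
  exact norm_cfc_le hε fun t ht => h t (abs_le.1 ((norm_spectrum_le ht).trans hC))

lemma functionalCalculus_congr {T : E →L[ℂ] E} {C : ℝ} (hC : ‖T‖ ≤ C) {φ ψ : ℝ → ℝ}
    (h : ∀ t ∈ Icc (-C) C, φ t = ψ t) : functionalCalculus φ T = functionalCalculus ψ T :=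
  cfc_congr fun t ht => h t (abs_le.1 ((norm_spectrum_le ht).trans hC))

lemma norm_functionalCalculus_le {T : E →L[ℂ] E} {φ : ℝ → ℝ} {ε : ℝ} (hε : 0 ≤ ε)
    (h : ∀ t, |φ t| ≤ ε) : ‖functionalCalculus φ T‖ ≤ ε :=
  norm_cfc_le hε fun t _ => h t

lemma functionalCalculus_add (T : E →L[ℂ] E) {φ ψ : ℝ → ℝ} (hφ : Continuous φ)
    (hψ : Continuous ψ) : functionalCalculus (fun t => φ t + ψ t) T =
      functionalCalculus φ T + functionalCalculus ψ T :=
  cfc_add T φ ψ hφ.continuousOn hψ.continuousOn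

lemma functionalCalculus_smul (T : E →L[ℂ] E) (c : ℝ) {φ : ℝ → ℝ} (hφ : Continuous φ) :
    functionalCalculus (fun t => c * φ t) T = (c : ℂ) • functionalCalculus φ T := by
  unfold functionalCalculus
  rw [cfc_const_mul c φ T hφ.continuousOn]
  ext v
  simp

lemma functionalCalculus_isPositive {T : E →L[ℂ] E} {φ : ℝ → ℝ} (h : ∀ t, 0 ≤ φ t) :
    (functionalCalculus φ T).IsPositive :=
  (ContinuousLinearMap.nonneg_iff_isPositive _).1 (cfc_nonneg fun t _ => h t)

/-- The powers that converge to the kernel projection, as a function of the operator. -/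
lemma functionalCalculus_one_sub_sq_pow {T : E →L[ℂ] E} (hT : IsSelfAdjoint T) (lam M : ℝ)
    (n : ℕ) : functionalCalculus (fun t => (1 - (M⁻¹ * (t - lam)) ^ 2) ^ n) T =
      (1 - (((M⁻¹ : ℝ) : ℂ) • (T - (lam : ℂ) • 1)) ^ 2) ^ n := by
  have h1 : cfc (fun t : ℝ => M⁻¹ * (t - lam)) T = ((M⁻¹ : ℝ) : ℂ) • (T - (lam : ℂ) • 1) := by
    rw [cfc_const_mul M⁻¹ (fun t : ℝ => t - lam) T, cfc_sub (fun t : ℝ => t) (fun _ => lam) T,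
      cfc_id' ℝ T, cfc_const lam T, Algebra.algebraMap_eq_smul_one]
    ext v
    simp [-Complex.ofReal_inv]
  unfold functionalCalculus
  rw [cfc_pow (fun t : ℝ => 1 - (M⁻¹ * (t - lam)) ^ 2) n T,
    cfc_sub (fun _ : ℝ => 1) (fun t : ℝ => (M⁻¹ * (t - lam)) ^ 2) T,
    cfc_const_one ℝ T, cfc_pow (fun t : ℝ => M⁻¹ * (t - lam)) 2 T, h1]

end Hilbert

/-! ### Matrix elements of operators on `ℓ²(A)` -/

section EllTwo

variable {X : Type*} {A : Set X}

open Classical in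
/-- The unit vector at `x`. -/
def unitVector (x : A) : EllTwo A := lp.single 2 x (1 : ℂ)

lemma matrixElement_def (T : EllTwo A →L[ℂ] EllTwo A) (x y : A) :
    matrixElement T x y = (T (unitVector y) : EllTwo A) x := rfl

lemma inner_unitVector (x : A) (v : EllTwo A) : inner ℂ (unitVector x) v = v x := by
  classical
  unfold unitVector
  rw [lp.inner_single_left]
  simp

lemma matrixElement_eq_inner (T : EllTwo A →L[ℂ] EllTwo A) (x y : A) :
    matrixElement T x y = inner ℂ (unitVector x) (T (unitVector y)) := by
  rw [inner_unitVector, matrixElement_def]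

lemma norm_unitVector (x : A) : ‖unitVector x‖ = 1 := by
  classical
  unfold unitVector
  rw [lp.norm_single (by norm_num)]
  simp

lemma unitVector_apply_self (x : A) : unitVector x x = 1 := by
  classical
  exact lp.single_apply_self 2 x _

lemma unitVector_apply_ne {x y : A} (h : y ≠ x) : unitVector x y = 0 := by
  classical
  exact lp.single_apply_ne 2 x _ h

lemma hasSum_smul_unitVector (v : EllTwo A) : HasSum (fun x => v x • unitVector x) v := by
  classical
  convert lp.hasSum_single (p := 2) (by norm_num) v using 2 with x
  rw [unitVector, ← lp.single_smul]
  simp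

lemma hasSum_matrixElement_mul (T : EllTwo A →L[ℂ] EllTwo A) (v : EllTwo A) (x : A) :
    HasSum (fun y => matrixElement T x y * v y) ((T v) x) := by
  have h := (hasSum_smul_unitVector v).mapL ((innerSL ℂ (unitVector x)).comp T)
  simp only [ContinuousLinearMap.comp_apply, innerSL_apply_apply, map_smul, smul_eq_mul,
    inner_unitVector] at h
  have e : (fun y => matrixElement T x y * v y) = fun y => v y * (T (unitVector y) : EllTwo A) x :=
    funext fun y => mul_comm _ _
  rw [e]
  exact h

lemma hasSum_matrixElement_comp (S T : EllTwo A →L[ℂ] EllTwo A) (x y : A) :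
    HasSum (fun z => matrixElement S x z * matrixElement T z y) (matrixElement (S * T) x y) :=
  hasSum_matrixElement_mul S (T (unitVector y)) x

lemma ellTwo_ext {v w : EllTwo A} (h : ∀ x, v x = w x) : v = w := lp.ext (funext h)

lemma operator_ext {S T : EllTwo A →L[ℂ] EllTwo A}
    (h : ∀ x y, matrixElement S x y = matrixElement T x y) : S = T := by
  ext1 v
  refine ellTwo_ext fun x => ?_
  have h1 := hasSum_matrixElement_mul S v x
  simp_rw [h] at h1
  exact h1.unique (hasSum_matrixElement_mul T v x)

lemma norm_matrixElement_le (T : EllTwo A →L[ℂ] EllTwo A) (x y : A) :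
    ‖matrixElement T x y‖ ≤ ‖T‖ := by
  rw [matrixElement_eq_inner]
  refine (norm_inner_le_norm _ _).trans ?_
  rw [norm_unitVector, one_mul]
  simpa [norm_unitVector] using T.le_opNorm (unitVector y)

lemma matrixElement_add (S T : EllTwo A →L[ℂ] EllTwo A) (x y : A) :
    matrixElement (S + T) x y = matrixElement S x y + matrixElement T x y := rfl

lemma matrixElement_sub (S T : EllTwo A →L[ℂ] EllTwo A) (x y : A) :
    matrixElement (S - T) x y = matrixElement S x y - matrixElement T x y := by
  simp [matrixElement_eq_inner]

lemma matrixElement_smul (c : ℂ) (T : EllTwo A →L[ℂ] EllTwo A) (x y : A) :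
    matrixElement (c • T) x y = c * matrixElement T x y := rfl

open Classical in
lemma matrixElement_one (x y : A) :
    matrixElement (1 : EllTwo A →L[ℂ] EllTwo A) x y = if x = y then 1 else 0 := by
  rw [matrixElement_def]
  split_ifs with h
  · subst h
    exact unitVector_apply_self x
  · exact unitVector_apply_ne h

lemma tendsto_matrixElement {ι : Type*} {l : Filter ι} {T : ι → EllTwo A →L[ℂ] EllTwo A}
    {S : EllTwo A →L[ℂ] EllTwo A} (h : ∀ v, Tendsto (fun n => T n v) l (𝓝 (S v))) (x y : A) :
    Tendsto (fun n => matrixElement (T n) x y) l (𝓝 (matrixElement S x y)) := by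
  simp_rw [matrixElement_eq_inner]
  exact tendsto_const_nhds.inner (h _)

lemma matrixElement_self_im {T : EllTwo A →L[ℂ] EllTwo A} (hT : T.IsPositive) (x : A) :
    (matrixElement T x x).im = 0 := by
  rw [matrixElement_eq_inner]
  have := hT.inner_nonneg_right (unitVector x)
  exact (Complex.le_def.1 this).2.symm

lemma matrixElement_self_re_nonneg {T : EllTwo A →L[ℂ] EllTwo A} (hT : T.IsPositive) (x : A) :
    0 ≤ (matrixElement T x x).re := by
  rw [matrixElement_eq_inner]
  have := hT.inner_nonneg_right (unitVector x)
  exact (Complex.le_def.1 this).1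

lemma matrixElement_starProjection_self (K : Submodule ℂ (EllTwo A)) [K.HasOrthogonalProjection]
    (x : A) : matrixElement K.starProjection x x = (‖K.starProjection (unitVector x)‖ ^ 2 : ℝ) := by
  rw [matrixElement_eq_inner]
  have h := Submodule.starProjection_inner_eq_zero (unitVector x) (K.starProjection (unitVector x))
    (Submodule.starProjection_apply_mem K (unitVector x))
  rw [inner_sub_left, sub_eq_zero] at h
  rw [h, inner_self_eq_norm_sq_to_K]
  norm_cast

/-- A projection whose diagonal matrix elements vanish is zero. -/
lemma starProjection_eq_zero_of_diagonal {K : Submodule ℂ (EllTwo A)} [K.HasOrthogonalProjection]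
    (h : ∀ x, matrixElement K.starProjection x x = 0) : K.starProjection = 0 := by
  refine operator_ext fun x y => ?_
  have h1 := h y
  rw [matrixElement_starProjection_self] at h1
  have h2 : K.starProjection (unitVector y) = 0 := by
    have h3 : ‖K.starProjection (unitVector y)‖ ^ 2 = 0 := by exact_mod_cast h1
    simpa using h3
  rw [matrixElement_def, matrixElement_def, h2]
  rfl

/-- If the vectors of `W` are determined on `S` by their values on `B`, then the trace on `S`
of the projection onto `W` is at most the cardinality of `B`. -/
lemma sum_starProjection_le_card (W : Submodule ℂ (EllTwo A)) [W.HasOrthogonalProjection]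
    (S B : Finset A) (h : ∀ v ∈ W, (∀ x ∈ B, v x = 0) → ∀ x ∈ S, v x = 0) :
    ∑ x ∈ S, ‖W.starProjection (unitVector x)‖ ^ 2 ≤ (B.card : ℝ) := by
  classical
  -- `D` is spanned by the vectors that represent, within `W`, evaluation at the points of `B`; its
  -- dimension is at most the cardinality of `B`.
  set D := Submodule.span ℂ ((B.image fun z => W.starProjection (unitVector z) :
    Finset (EllTwo A)) : Set (EllTwo A))
  have hDW : D ≤ W := by
    refine Submodule.span_le.2 fun v hv => ?_
    obtain ⟨z, -, rfl⟩ := Finset.mem_image.1 (Finset.mem_coe.1 hv)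
    exact Submodule.starProjection_apply_mem W _
  have hdim : Module.finrank ℂ D ≤ B.card :=
    (finrank_span_finset_le_card _).trans Finset.card_image_le
  have hcoord : ∀ v ∈ W, ∀ x, inner ℂ (W.starProjection (unitVector x)) v = v x := by
    intro v hv x
    have h1 := Submodule.starProjection_inner_eq_zero (unitVector x) v hv
    rw [inner_sub_left, sub_eq_zero, inner_unitVector] at h1
    exact h1.symm
  -- The component `r` of the projected unit vector orthogonal to `D` lies in `W` and vanishes on
  -- `B`, hence at `x`. Vanishing at `x` means orthogonality to the projected unit vector, so `r` is
  -- orthogonal to itself.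
  have hmem : ∀ x ∈ S, W.starProjection (unitVector x) ∈ D := by
    intro x hx
    set p := W.starProjection (unitVector x)
    have hp : p ∈ W := Submodule.starProjection_apply_mem W _
    set r := p - D.starProjection p
    have hrW : r ∈ W := W.sub_mem hp (hDW (Submodule.starProjection_apply_mem D _))
    have hrD : ∀ w ∈ D, inner ℂ w r = 0 := Submodule.sub_starProjection_mem_orthogonal p
    have hr0 : ∀ z ∈ B, r z = 0 := fun z hz => by
      rw [← hcoord r hrW z]
      exact hrD _ (Submodule.subset_span
        (Finset.mem_coe.2 (Finset.mem_image_of_mem _ hz)))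
    have hrx := h r hrW hr0 x hx
    rw [← hcoord r hrW x] at hrx
    have hrr : inner ℂ r r = 0 := by
      have h2 := hrD _ (Submodule.starProjection_apply_mem D p)
      calc inner ℂ r r = inner ℂ p r - inner ℂ (D.starProjection p) r := by
            rw [← inner_sub_left]
        _ = 0 := by rw [hrx, h2, sub_zero]
    have hr : r = 0 := inner_self_eq_zero.1 hrr
    rw [sub_eq_zero.1 hr]
    exact Submodule.starProjection_apply_mem D _
  let b := stdOrthonormalBasis ℂ D
  -- Expanding in an orthonormal basis of `D` turns the trace over `S` into a sum of squared masses
  -- on `S`, at most 1 for each basis vector.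
  have hnorm : ∀ x ∈ S, ‖W.starProjection (unitVector x)‖ ^ 2 =
      ∑ k, ‖(b k : EllTwo A) x‖ ^ 2 := by
    intro x hx
    have h1 := b.sum_sq_norm_inner_right ⟨_, hmem x hx⟩
    rw [Submodule.coe_norm] at h1
    rw [← h1]
    refine Finset.sum_congr rfl fun k _ => ?_
    rw [Submodule.coe_inner, ← inner_conj_symm, RCLike.norm_conj, hcoord _ (hDW (b k).2)]
  have hbessel : ∀ k, ∑ x ∈ S, ‖(b k : EllTwo A) x‖ ^ 2 ≤ 1 := by
    intro k
    have h1 := lp.sum_rpow_le_norm_rpow (p := 2) (by norm_num) (b k : EllTwo A) S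
    have h2 : ‖(b k : EllTwo A)‖ = 1 := by
      rw [← Submodule.coe_norm]
      exact b.orthonormal.1 k
    simpa [h2] using h1
  calc ∑ x ∈ S, ‖W.starProjection (unitVector x)‖ ^ 2
      = ∑ x ∈ S, ∑ k, ‖(b k : EllTwo A) x‖ ^ 2 := Finset.sum_congr rfl hnorm
    _ = ∑ k, ∑ x ∈ S, ‖(b k : EllTwo A) x‖ ^ 2 := Finset.sum_comm
    _ ≤ ∑ _k : Fin (Module.finrank ℂ D), (1 : ℝ) := Finset.sum_le_sum fun k _ => hbessel k
    _ = Module.finrank ℂ D := by simp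
    _ ≤ B.card := by exact_mod_cast hdim

/-! ### Truncation -/

/-- The restriction of vectors to a finite set. -/
def truncation (S : Finset A) : EllTwo A →L[ℂ] EllTwo A :=
  ∑ x ∈ S, InnerProductSpace.rankOne ℂ (unitVector x) (unitVector x)

open Classical in
lemma truncation_apply (S : Finset A) (v : EllTwo A) (x : A) :
    truncation S v x = if x ∈ S then v x else 0 := by
  have h : truncation S v = ∑ y ∈ S, v y • unitVector y := by
    simp [truncation, inner_unitVector]
  rw [h, lp.coeFn_sum, Finset.sum_apply]
  split_ifs with hx
  · rw [Finset.sum_eq_single x]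
    · simp [unitVector_apply_self]
    · intro y _ hy
      simp [unitVector_apply_ne hy.symm]
    · exact fun h => absurd hx h
  · refine Finset.sum_eq_zero fun y hy => ?_
    have : x ≠ y := fun h => hx (h ▸ hy)
    simp [unitVector_apply_ne this]

lemma truncation_eq_self {S : Finset A} {v : EllTwo A} (h : ∀ x, x ∉ S → v x = 0) :
    truncation S v = v := by
  classical
  refine ellTwo_ext fun x => ?_
  rw [truncation_apply]
  split_ifs with hx
  · rfl
  · exact (h x hx).symm

lemma truncation_isSelfAdjoint (S : Finset A) : IsSelfAdjoint (truncation S) := by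
  refine isSelfAdjoint_sum _ fun x _ => ?_
  exact (InnerProductSpace.isPositive_rankOne_self _).isSelfAdjoint

lemma norm_truncation_le (S : Finset A) : ‖truncation S‖ ≤ 1 := by
  have h : IsStarProjection (truncation S) := by
    classical
    refine ⟨?_, truncation_isSelfAdjoint S⟩
    ext1 v
    exact truncation_eq_self fun x hx => (truncation_apply S v x).trans (if_neg hx)
  exact h.norm_le

open Classical in
lemma matrixElement_truncation (S : Finset A) (x y : A) :
    matrixElement (truncation S) x y = if x = y ∧ x ∈ S then 1 else 0 := by
  rw [matrixElement_def, truncation_apply]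
  by_cases hx : x ∈ S
  · by_cases hxy : x = y
    · subst hxy
      simp [hx, unitVector_apply_self]
    · simp [hx, hxy, unitVector_apply_ne hxy]
  · simp [hx]

/-- Truncation commutes with `T` on vectors `v` for which `T` does not connect the support of `v`
inside `S` with the complement of `S` and vice versa. -/
lemma apply_truncation_eq (T : EllTwo A →L[ℂ] EllTwo A) (S : Finset A) (v : EllTwo A)
    (h : ∀ x y, matrixElement T x y ≠ 0 → v y ≠ 0 → (x ∈ S ↔ y ∈ S)) :
    T (truncation S v) = truncation S (T v) := by
  classical
  refine ellTwo_ext fun x => ?_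
  have h1 := hasSum_matrixElement_mul T (truncation S v) x
  have h2 := hasSum_matrixElement_mul T v x
  rw [truncation_apply]
  split_ifs with hx
  · refine h1.unique ?_
    convert h2 using 2 with y
    rw [truncation_apply]
    by_cases hT : matrixElement T x y = 0
    · simp [hT]
    · by_cases hv : v y = 0
      · simp [hv]
      · simp [(h x y hT hv).1 hx]
  · refine h1.unique ?_
    convert hasSum_zero using 2 with y
    rw [truncation_apply]
    by_cases hT : matrixElement T x y = 0
    · simp [hT]
    · by_cases hv : v y = 0
      · simp [hv]
      · simp [(not_iff_not.2 (h x y hT hv)).1 hx]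

end EllTwo

/-! ### Compactly supported solutions -/

section Solutions

variable {X : Type*} {A : Set X} (T : EllTwo A →L[ℂ] EllTwo A) (lam : ℝ)

lemma mem_solutionSpace {T : EllTwo A →L[ℂ] EllTwo A} {lam : ℝ} {v : EllTwo A} :
    v ∈ solutionSpace T lam ↔ T v = (lam : ℂ) • v := Module.End.mem_eigenspace_iff

lemma solutionSpace_eq_ker : solutionSpace T lam = (T - (lam : ℂ) • 1).ker := by
  ext v
  rw [mem_solutionSpace]
  change _ ↔ (T - (lam : ℂ) • 1) v = 0
  rw [sub_apply, sub_eq_zero]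
  rfl

lemma isClosed_solutionSpace : IsClosed (solutionSpace T lam : Set (EllTwo A)) := by
  rw [solutionSpace_eq_ker]
  exact ContinuousLinearMap.isClosed_ker _

lemma compactSolutions_subset : compactSolutions T lam ⊆ solutionSpace T lam := fun _ h => h.1

/-- The closed linear span of the compactly supported solutions. -/
def compactSpan : Submodule ℂ (EllTwo A) :=
  (Submodule.span ℂ (compactSolutions T lam)).topologicalClosure

instance : CompleteSpace (compactSpan T lam) :=
  (Submodule.isClosed_topologicalClosure _).completeSpace_coe

lemma compactSpan_le : compactSpan T lam ≤ solutionSpace T lam :=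
  Submodule.topologicalClosure_minimal _ (Submodule.span_le.2 (compactSolutions_subset T lam))
    (isClosed_solutionSpace T lam)

/-- The solutions that are orthogonal to all compactly supported solutions. -/
def residualSpace : Submodule ℂ (EllTwo A) := (compactSpan T lam)ᗮ ⊓ solutionSpace T lam

instance : CompleteSpace (residualSpace T lam) :=
  ((Submodule.isClosed_orthogonal _).inter (isClosed_solutionSpace T lam)).completeSpace_coe

/-- The projection onto the solution space. -/
def eigenProj : EllTwo A →L[ℂ] EllTwo A := kerProj (T - (lam : ℂ) • 1)

/-- The projection onto the residual space. -/
def residualProj : EllTwo A →L[ℂ] EllTwo A := (residualSpace T lam).starProjection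

instance : CompleteSpace (solutionSpace T lam) := (isClosed_solutionSpace T lam).completeSpace_coe

lemma eigenProj_eq : eigenProj T lam = (solutionSpace T lam).starProjection := by
  unfold eigenProj kerProj
  congr!
  exact (solutionSpace_eq_ker T lam).symm

/-- This form passes measurability and equivariance to the residual projection from the two
projections on the right. -/
lemma residualProj_eq :
    residualProj T lam = eigenProj T lam - (compactSpan T lam).starProjection := by
  rw [eigenProj_eq]
  have : ((compactSpan T lam)ᗮ ⊓ solutionSpace T lam).HasOrthogonalProjection :=
    inferInstanceAs (residualSpace T lam).HasOrthogonalProjection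
  exact starProjection_sub_starProjection (compactSpan T lam) (solutionSpace T lam)
    (compactSpan_le T lam)

lemma compactSpan_eq_solutionSpace_of_residualProj (h : residualProj T lam = 0) :
    compactSpan T lam = solutionSpace T lam := by
  refine le_antisymm (compactSpan_le T lam) fun v hv => ?_
  rw [residualProj_eq, eigenProj_eq, sub_eq_zero] at h
  have h1 := DFunLike.congr_fun h v
  rw [Submodule.starProjection_eq_self_iff.2 hv] at h1
  rw [h1]
  exact Submodule.starProjection_apply_mem _ _

lemma eigenProj_eq_zero_iff : eigenProj T lam = 0 ↔ solutionSpace T lam = ⊥ := by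
  rw [eigenProj_eq]
  constructor
  · intro h
    rw [eq_bot_iff]
    intro v hv
    have h1 := Submodule.starProjection_eq_self_iff.2 hv
    rw [h] at h1
    exact h1.symm
  · intro h
    ext1 v
    have := Submodule.starProjection_apply_mem (solutionSpace T lam) v
    exact (Submodule.mem_bot ℂ).1 (h.le this)

lemma compactSolutions_nonempty_of_residualProj (h : residualProj T lam = 0)
    (h' : eigenProj T lam ≠ 0) : (compactSolutions T lam).Nonempty := by
  by_contra hne
  rw [not_nonempty_iff_eq_empty] at hne
  refine h' ((eigenProj_eq_zero_iff T lam).2 ?_)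
  rw [← compactSpan_eq_solutionSpace_of_residualProj T lam h, compactSpan, hne,
    Submodule.span_empty, eq_bot_iff]
  exact Submodule.topologicalClosure_minimal _ le_rfl isClosed_singleton

lemma eigenProj_ne_zero (h : (compactSolutions T lam).Nonempty) : eigenProj T lam ≠ 0 := by
  obtain ⟨v, hv, hv0, -⟩ := h
  rw [Ne, eigenProj_eq_zero_iff]
  intro h
  rw [h] at hv
  exact hv0 ((Submodule.mem_bot ℂ).1 hv)

/-- An operator whose kernel consists of the solutions that are supported in `S`. -/
def localOperator (S : Finset A) : EllTwo A →L[ℂ] EllTwo A :=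
  (1 - truncation S) + truncation S * (T - (lam : ℂ) • 1) ^ 2 * truncation S

lemma sub_smul_isSelfAdjoint {T : EllTwo A →L[ℂ] EllTwo A} (hT : IsSelfAdjoint T) (lam : ℝ) :
    IsSelfAdjoint (T - (lam : ℂ) • 1) :=
  hT.sub (IsSelfAdjoint.smul (Complex.conj_ofReal lam) (IsSelfAdjoint.one _))

lemma localOperator_isSelfAdjoint {T : EllTwo A →L[ℂ] EllTwo A} (hT : IsSelfAdjoint T)
    (lam : ℝ) (S : Finset A) : IsSelfAdjoint (localOperator T lam S) := by
  refine ((IsSelfAdjoint.one _).sub (truncation_isSelfAdjoint S)).add ?_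
  have h := ((sub_smul_isSelfAdjoint hT lam).pow 2).conjugate (truncation S)
  rwa [(truncation_isSelfAdjoint S).star_eq] at h

lemma norm_sub_smul_one_le {T : EllTwo A →L[ℂ] EllTwo A} {M : ℝ} (hM : ‖T‖ ≤ M) (lam : ℝ) :
    ‖T - (lam : ℂ) • 1‖ ≤ M + |lam| := by
  have h1 : ‖(1 : EllTwo A →L[ℂ] EllTwo A)‖ ≤ 1 := ContinuousLinearMap.norm_id_le
  refine (norm_sub_le _ _).trans (add_le_add hM ?_)
  rw [norm_smul, Complex.norm_real, Real.norm_eq_abs]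
  exact mul_le_of_le_one_right (abs_nonneg _) h1

lemma norm_localOperator_le {T : EllTwo A →L[ℂ] EllTwo A} {M : ℝ} (hM : ‖T‖ ≤ M) (lam : ℝ)
    (S : Finset A) : ‖localOperator T lam S‖ ≤ 2 + (M + |lam|) ^ 2 := by
  have h1 : ‖(1 : EllTwo A →L[ℂ] EllTwo A)‖ ≤ 1 := ContinuousLinearMap.norm_id_le
  have h2 := norm_truncation_le S
  have h3 := norm_sub_smul_one_le hM lam
  have h4 : ‖(T - (lam : ℂ) • 1) ^ 2‖ ≤ (M + |lam|) ^ 2 := by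
    rw [pow_two, pow_two]
    exact (norm_mul_le _ _).trans
      (mul_le_mul h3 h3 (norm_nonneg _) ((norm_nonneg _).trans h3))
  refine (norm_add_le _ _).trans (add_le_add ?_ ?_)
  · exact (norm_sub_le _ _).trans (by linarith)
  · refine (norm_mul_le _ _).trans ?_
    refine (mul_le_of_le_one_right (norm_nonneg _) h2).trans ?_
    exact (norm_mul_le _ _).trans ((mul_le_of_le_one_left (norm_nonneg _) h2).trans h4)

/-- The two summands take values in vectors supported off `S` and on `S`, so both vanish on the
kernel. The first gives the support condition, and then the second gives ⟨v, G²v⟩ = ‖Gv‖² = 0. -/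
lemma mem_ker_localOperator {T : EllTwo A →L[ℂ] EllTwo A} (hT : IsSelfAdjoint T)
    (lam : ℝ) (S : Finset A) (v : EllTwo A) :
    v ∈ (localOperator T lam S).ker ↔ v ∈ solutionSpace T lam ∧ ∀ x, x ∉ S → v x = 0 := by
  classical
  set G := T - (lam : ℂ) • 1
  have hG : IsSelfAdjoint G := sub_smul_isSelfAdjoint hT lam
  have happ : localOperator T lam S v =
      (v - truncation S v) + truncation S (G (G (truncation S v))) := by
    simp [localOperator, G, pow_two]
  rw [solutionSpace_eq_ker]
  change localOperator T lam S v = 0 ↔ G v = 0 ∧ _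
  rw [happ]
  constructor
  · intro h
    have hv : ∀ x, x ∉ S → v x = 0 := by
      intro x hx
      have h1 := congrArg (fun w : EllTwo A => w x) h
      simpa [truncation_apply, hx] using h1
    refine ⟨?_, hv⟩
    rw [truncation_eq_self hv, sub_self, zero_add] at h
    have h2 : inner ℂ (G v) (G v) = 0 := by
      calc inner ℂ (G v) (G v) = inner ℂ v (G (G v)) := by
            rw [← ContinuousLinearMap.adjoint_inner_right, hG.adjoint_eq]
        _ = inner ℂ (truncation S v) (G (G v)) := by rw [truncation_eq_self hv]
        _ = inner ℂ v (truncation S (G (G v))) := by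
            rw [← ContinuousLinearMap.adjoint_inner_right,
              (truncation_isSelfAdjoint S).adjoint_eq]
        _ = 0 := by rw [h, inner_zero_right]
    exact inner_self_eq_zero.1 h2
  · rintro ⟨h1, h2⟩
    rw [truncation_eq_self h2, h1]
    simp

/-- The kernels increase with `n` and their union is the span of the compactly supported solutions.
Projections onto increasing subspaces converge strongly to the projection onto the closure of the
union. -/
lemma tendsto_kerProj_localOperator {T : EllTwo A →L[ℂ] EllTwo A} (hT : IsSelfAdjoint T)
    (lam : ℝ) {S : ℕ → Finset A} (hS : Monotone S) (hexh : ∀ x, ∃ n, x ∈ S n) (v : EllTwo A) :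
    Tendsto (fun n => kerProj (localOperator T lam (S n)) v) atTop
      (𝓝 ((compactSpan T lam).starProjection v)) := by
  classical
  have hmono : Monotone fun n => (localOperator T lam (S n)).ker := by
    intro m n hmn w hw
    rw [mem_ker_localOperator hT] at hw ⊢
    exact ⟨hw.1, fun x hx => hw.2 x fun hx' => hx (hS hmn hx')⟩
  have hsup : (⨆ n, (localOperator T lam (S n)).ker) =
      Submodule.span ℂ (compactSolutions T lam) := by
    refine le_antisymm (iSup_le fun n w hw => ?_) (Submodule.span_le.2 fun w hw => ?_)
    · rw [mem_ker_localOperator hT] at hw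
      by_cases hw0 : w = 0
      · rw [hw0]
        exact Submodule.zero_mem _
      · refine Submodule.subset_span ⟨hw.1, hw0, (S n).finite_toSet.subset fun x hx => ?_⟩
        by_contra h
        exact hx (hw.2 x h)
    · obtain ⟨h1, -, h3⟩ := hw
      choose N hN using hexh
      -- A finite support is contained in `S n` as soon as `n` exceeds the largest `N x` over the
      -- support.
      have hle : ∀ x ∈ h3.toFinset, N x ≤ h3.toFinset.sup N := fun x hx => Finset.le_sup hx
      refine Submodule.mem_iSup_of_mem (h3.toFinset.sup N) ?_
      rw [mem_ker_localOperator hT]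
      refine ⟨h1, fun x hx => ?_⟩
      by_contra hwx
      exact hx (hS (hle x (by simpa using hwx)) (hN x))
  have h := Submodule.starProjection_tendsto_closure_iSup
    (fun n => (localOperator T lam (S n)).ker) hmono v
  have hsup' : compactSpan T lam =
      (⨆ n, (localOperator T lam (S n)).ker).topologicalClosure := by rw [hsup, compactSpan]
  simp only [hsup']
  exact h

/-- Vectors in the residual space that vanish on the boundary of `S` vanish on `S`. -/
lemma residualSpace_eq_zero_of_boundary (S B : Finset A)
    (h : ∀ x y, matrixElement T x y ≠ 0 → y ∉ B → (x ∈ S ↔ y ∈ S)) :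
    ∀ v ∈ residualSpace T lam, (∀ x ∈ B, v x = 0) → ∀ x ∈ S, v x = 0 := by
  classical
  rintro v ⟨hv1, hv2⟩ hvB
  -- Only points `y` with `v y ≠ 0` matter, and these lie off `B`, where `T` does not link `S` to
  -- its complement.
  have hcomm := apply_truncation_eq T S v fun x y hT hv =>
    h x y hT fun hy => hv (hvB y hy)
  have hsol : truncation S v ∈ solutionSpace T lam := by
    rw [mem_solutionSpace, hcomm, mem_solutionSpace.1 hv2, map_smul]
  have hmem : truncation S v ∈ compactSpan T lam := by
    by_cases h0 : truncation S v = 0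
    · rw [h0]
      exact Submodule.zero_mem _
    · refine Submodule.le_topologicalClosure _ (Submodule.subset_span ⟨hsol, h0, ?_⟩)
      refine S.finite_toSet.subset fun x hx => ?_
      by_contra hxS
      exact hx (by rw [truncation_apply]; exact if_neg hxS)
  -- The truncated vector is in the closed span of the compactly supported solutions, hence
  -- orthogonal to `v`; as truncation is an orthogonal projection, this inner product is also its
  -- squared norm.
  have h0 : inner ℂ (truncation S v) v = 0 := hv1 _ hmem
  have h1 : truncation S (truncation S v) = truncation S v :=
    truncation_eq_self fun x hx => by rw [truncation_apply, if_neg hx]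
  have h2 : inner ℂ (truncation S v) (truncation S v) = 0 := by
    nth_rewrite 1 [← (truncation_isSelfAdjoint S).adjoint_eq]
    rw [ContinuousLinearMap.adjoint_inner_left, h1, ← inner_conj_symm, h0, map_zero]
  have h3 : truncation S v = 0 := inner_self_eq_zero.1 h2
  intro x hx
  have h4 := congrArg (fun w : EllTwo A => w x) h3
  simpa [truncation_apply, hx] using h4

end Solutions

/-! ### Unitary equivalences induced by bijections and phases -/

section Phase

variable {X : Type*} {A A' : Set X}

lemma memℓp_of_norm_eq {e : A ≃ A'} {f : A' → ℂ} (v : EllTwo A)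
    (h : ∀ y, ‖f y‖ = ‖v (e.symm y)‖) : Memℓp f 2 := by
  rw [memℓp_gen_iff (by norm_num)]
  simp_rw [h]
  exact (e.symm.summable_iff (f := fun x => ‖v x‖ ^ (2 : ℝ≥0∞).toReal)).2
    ((memℓp_gen_iff (by norm_num)).1 (lp.memℓp v))

lemma star_mul_self_of_norm_eq_one {z : ℂ} (hz : ‖z‖ = 1) : conj z * z = 1 := by
  rw [← Complex.normSq_eq_conj_mul_self, Complex.normSq_eq_norm_sq, hz]
  norm_num

/-- The unitary operator `v ↦ c v`, transported by the bijection `e`. -/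
def phaseEquiv (e : A ≃ A') (c : A → ℂ) (hc : ∀ x, ‖c x‖ = 1) : EllTwo A ≃ₗᵢ[ℂ] EllTwo A' where
  toFun v := ⟨fun y => c (e.symm y) * v (e.symm y), memℓp_of_norm_eq v fun y => by
    rw [norm_mul, hc, one_mul]⟩
  invFun w := ⟨fun x => conj (c x) * w (e x), memℓp_of_norm_eq (e := e.symm) w fun x => by
    rw [norm_mul, RCLike.norm_conj, hc, one_mul, Equiv.symm_symm]⟩
  map_add' v w := ellTwo_ext fun y => by
    change c _ * (v _ + w _) = c _ * v _ + c _ * w _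
    ring
  map_smul' a v := ellTwo_ext fun y => by
    change c _ * (a * v _) = a * (c _ * v _)
    ring
  left_inv v := ellTwo_ext fun x => by
    change conj (c x) * (c (e.symm (e x)) * v (e.symm (e x))) = v x
    rw [Equiv.symm_apply_apply, ← mul_assoc, star_mul_self_of_norm_eq_one (hc x), one_mul]
  right_inv w := ellTwo_ext fun y => by
    change c (e.symm y) * (conj (c (e.symm y)) * w (e (e.symm y))) = w y
    rw [Equiv.apply_symm_apply, ← mul_assoc, mul_comm (c _),
      star_mul_self_of_norm_eq_one (hc _), one_mul]
  norm_map' v := by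
    have h2 : (0 : ℝ) < (2 : ℝ≥0∞).toReal := by norm_num
    refine (Real.rpow_left_inj (norm_nonneg _) (norm_nonneg _) h2.ne').1 ?_
    rw [lp.norm_rpow_eq_tsum h2, lp.norm_rpow_eq_tsum h2, ← e.symm.tsum_eq]
    refine tsum_congr fun y => ?_
    change ‖c _ * v _‖ ^ _ = _
    rw [norm_mul, hc, one_mul]

variable (e : A ≃ A') (c : A → ℂ) (hc : ∀ x, ‖c x‖ = 1)

lemma phaseEquiv_apply (v : EllTwo A) (x : A) : phaseEquiv e c hc v (e x) = c x * v x := by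
  change c (e.symm (e x)) * v (e.symm (e x)) = _
  rw [Equiv.symm_apply_apply]

lemma phaseEquiv_symm_apply (w : EllTwo A') (x : A) :
    (phaseEquiv e c hc).symm w x = conj (c x) * w (e x) := rfl

lemma phaseEquiv_symm_unitVector (x : A) :
    (phaseEquiv e c hc).symm (unitVector (e x)) = conj (c x) • unitVector x := by
  refine ellTwo_ext fun y => ?_
  rw [phaseEquiv_symm_apply]
  change _ = conj (c x) * unitVector x y
  by_cases h : y = x
  · rw [h, unitVector_apply_self, unitVector_apply_self]
  · rw [unitVector_apply_ne h, unitVector_apply_ne fun h' => h (e.injective h')]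
    simp

lemma matrixElement_conj (T : EllTwo A →L[ℂ] EllTwo A) (x y : A) :
    matrixElement ((phaseEquiv e c hc).conjStarAlgEquiv T) (e x) (e y) =
      c x * matrixElement T x y * conj (c y) := by
  rw [matrixElement_def, LinearIsometryEquiv.conjStarAlgEquiv_apply_apply,
    phaseEquiv_symm_unitVector, map_smul, map_smul]
  change conj (c y) * (phaseEquiv e c hc _ : EllTwo A') (e x) = _
  rw [phaseEquiv_apply, matrixElement_def]
  ring

lemma matrixElement_conj_self (T : EllTwo A →L[ℂ] EllTwo A) (x : A) :
    matrixElement ((phaseEquiv e c hc).conjStarAlgEquiv T) (e x) (e x) = matrixElement T x x := by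
  rw [matrixElement_conj, mul_right_comm, mul_comm (c x), star_mul_self_of_norm_eq_one (hc x),
    one_mul]

lemma solutionSpace_conj (T : EllTwo A →L[ℂ] EllTwo A) (lam : ℝ) :
    solutionSpace ((phaseEquiv e c hc).conjStarAlgEquiv T) lam =
      (solutionSpace T lam).map ((phaseEquiv e c hc).toLinearEquiv : EllTwo A →ₗ[ℂ] EllTwo A') := by
  set U := phaseEquiv e c hc
  ext w
  rw [mem_solutionSpace, LinearIsometryEquiv.conjStarAlgEquiv_apply_apply, Submodule.mem_map]
  constructor
  · intro h
    refine ⟨U.symm w, mem_solutionSpace.2 ?_, U.apply_symm_apply w⟩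
    apply U.injective
    rw [h, map_smul, U.apply_symm_apply]
  · rintro ⟨v, hv, rfl⟩
    change U (T (U.symm (U v))) = (lam : ℂ) • U v
    rw [U.symm_apply_apply, mem_solutionSpace.1 hv, map_smul]

/-- The phases never vanish, so supports are carried over by the bijection and stay finite. -/
lemma compactSolutions_conj (T : EllTwo A →L[ℂ] EllTwo A) (lam : ℝ) :
    compactSolutions ((phaseEquiv e c hc).conjStarAlgEquiv T) lam =
      phaseEquiv e c hc '' compactSolutions T lam := by
  set U := phaseEquiv e c hc with hU
  have hsupp : ∀ v : EllTwo A, (Function.support (U v : A' → ℂ)) =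
      e '' Function.support (v : A → ℂ) := by
    intro v
    ext y
    obtain ⟨x, rfl⟩ := e.surjective y
    have hcx : c x ≠ 0 := fun h => by simpa [h] using hc x
    rw [Function.mem_support, hU, phaseEquiv_apply, e.injective.mem_set_image,
      Function.mem_support, mul_ne_zero_iff]
    simp [hcx]
  ext w
  constructor
  · rintro ⟨h1, h2, h3⟩
    rw [solutionSpace_conj] at h1
    obtain ⟨v, hv, rfl⟩ := h1
    refine ⟨v, ⟨hv, fun h => h2 (by rw [h, map_zero]), ?_⟩, rfl⟩
    change (Function.support (U v : A' → ℂ)).Finite at h3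
    rw [hsupp] at h3
    exact h3.of_finite_image e.injective.injOn
  · rintro ⟨v, ⟨h1, h2, h3⟩, rfl⟩
    refine ⟨?_, fun h => h2 (U.map_eq_zero_iff.1 h), ?_⟩
    · rw [solutionSpace_conj]
      exact ⟨v, h1, rfl⟩
    · rw [hsupp]
      exact h3.image e

lemma compactSpan_conj (T : EllTwo A →L[ℂ] EllTwo A) (lam : ℝ) :
    compactSpan ((phaseEquiv e c hc).conjStarAlgEquiv T) lam =
      (compactSpan T lam).map ((phaseEquiv e c hc).toLinearEquiv : EllTwo A →ₗ[ℂ] EllTwo A') := by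
  set U := phaseEquiv e c hc
  have h1 : Submodule.span ℂ (U '' compactSolutions T lam) =
      (Submodule.span ℂ (compactSolutions T lam)).map
        (U.toLinearEquiv : EllTwo A →ₗ[ℂ] EllTwo A') :=
    Submodule.span_image (U.toLinearEquiv : EllTwo A →ₗ[ℂ] EllTwo A')
  rw [compactSpan, compactSolutions_conj, h1]
  refine SetLike.coe_injective ?_
  rw [Submodule.topologicalClosure_coe, Submodule.map_coe, Submodule.map_coe, compactSpan,
    Submodule.topologicalClosure_coe]
  exact (U.toHomeomorph.image_closure _).symm

lemma starProjection_conj (K : Submodule ℂ (EllTwo A)) [K.HasOrthogonalProjection]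
    (K' : Submodule ℂ (EllTwo A')) [K'.HasOrthogonalProjection]
    (h : K' = K.map ((phaseEquiv e c hc).toLinearEquiv : EllTwo A →ₗ[ℂ] EllTwo A')) :
    K'.starProjection = (phaseEquiv e c hc).conjStarAlgEquiv K.starProjection := by
  subst h
  ext1 w
  rw [LinearIsometryEquiv.conjStarAlgEquiv_apply_apply]
  exact Submodule.starProjection_map_apply (phaseEquiv e c hc) K w

lemma eigenProj_conj (T : EllTwo A →L[ℂ] EllTwo A) (lam : ℝ) :
    eigenProj ((phaseEquiv e c hc).conjStarAlgEquiv T) lam =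
      (phaseEquiv e c hc).conjStarAlgEquiv (eigenProj T lam) := by
  rw [eigenProj_eq, eigenProj_eq]
  exact starProjection_conj e c hc _ _ (solutionSpace_conj e c hc T lam)

lemma residualProj_conj (T : EllTwo A →L[ℂ] EllTwo A) (lam : ℝ) :
    residualProj ((phaseEquiv e c hc).conjStarAlgEquiv T) lam =
      (phaseEquiv e c hc).conjStarAlgEquiv (residualProj T lam) := by
  rw [residualProj_eq, residualProj_eq, eigenProj_conj, map_sub,
    starProjection_conj e c hc _ _ (compactSpan_conj e c hc T lam)]

end Phase

/-! ### Measurable families of operators -/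

namespace Config

variable {X Y : Type*} [MetricSpace X]

open Classical in
/-- The matrix element of `T` between the points of the configuration in `B` and `B'`. -/
def entry (B B' : Set X) (ω : Config X Y) (T : EllTwo ω.carrier →L[ℂ] EllTwo ω.carrier) : ℂ :=
  if h : ω ∈ occupied B then
    if h' : ω ∈ occupied B' then matrixElement T (cellPoint h) (cellPoint h') else 0
  else 0

/-- A countable partition of `X` into small cells. -/
structure IsCellPartition (B : ℕ → Set X) : Prop where
  small : ∀ i, IsSmallCell (B i)
  disjoint : Pairwise (Function.onFun Disjoint B)
  cover : ⋃ i, B i = univ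

namespace IsCellPartition

variable {B : ℕ → Set X} (hB : IsCellPartition B)
include hB

lemma exists_mem (x : X) : ∃ i, x ∈ B i := by
  have : x ∈ ⋃ i, B i := hB.cover ▸ mem_univ x
  simpa using this

lemma eq_of_mem {x : X} {i j : ℕ} (hi : x ∈ B i) (hj : x ∈ B j) : i = j := by
  by_contra h
  exact Set.disjoint_left.1 (hB.disjoint h) hi hj

end IsCellPartition

open Classical in
/-- The index of the cell that contains `x`. -/
def cellIndex (B : ℕ → Set X) (x : X) : ℕ := if h : ∃ i, x ∈ B i then h.choose else 0

lemma mem_cellIndex {B : ℕ → Set X} (hB : IsCellPartition B) (x : X) : x ∈ B (cellIndex B x) := by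
  have h := hB.exists_mem x
  rw [cellIndex, dif_pos h]
  exact h.choose_spec

lemma cellIndex_eq {B : ℕ → Set X} (hB : IsCellPartition B) {x : X} {i : ℕ} (h : x ∈ B i) :
    cellIndex B x = i := hB.eq_of_mem (mem_cellIndex hB x) h

lemma occupied_cellIndex {B : ℕ → Set X} (hB : IsCellPartition B) {ω : Config X Y}
    (x : ω.carrier) : ω ∈ occupied (B (cellIndex B x)) := ⟨x, mem_cellIndex hB x, x.2⟩

lemma cellPoint_cellIndex {B : ℕ → Set X} (hB : IsCellPartition B) {ω : Config X Y}
    (x : ω.carrier) (h : ω ∈ occupied (B (cellIndex B x))) : cellPoint h = x :=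
  (eq_cellPoint (hB.small _) h (mem_cellIndex hB x)).symm

lemma cellIndex_cellPoint {B : ℕ → Set X} (hB : IsCellPartition B) {ω : Config X Y} {i : ℕ}
    (h : ω ∈ occupied (B i)) : cellIndex B (cellPoint h : X) = i :=
  cellIndex_eq hB (cellPoint_mem h)

lemma cellIndex_injective {B : ℕ → Set X} (hB : IsCellPartition B) (ω : Config X Y) :
    Function.Injective fun x : ω.carrier => cellIndex B (x : X) := by
  intro x y hxy
  have hx := mem_cellIndex hB (x : X)
  have hy := mem_cellIndex hB (y : X)
  change cellIndex B (x : X) = cellIndex B (y : X) at hxy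
  rw [← hxy] at hy
  exact Subtype.ext (ω.uniformlyDiscrete.eq_of_dist_lt x.2 y.2 ((hB.small _).dist_lt _ hx _ hy))

open Classical in
-- Sums over the points of `ω`, an index set that varies with `ω`, become series over ℕ. In this
-- form their partial sums can be measurable in `ω`.
lemma hasSum_cell_iff {M : Type*} [AddCommMonoid M] [TopologicalSpace M] {B : ℕ → Set X}
    (hB : IsCellPartition B) (ω : Config X Y) (f : ω.carrier → M) (a : M) :
    HasSum (fun i => if h : ω ∈ occupied (B i) then f (cellPoint h) else 0) a ↔ HasSum f a := by
  rw [← (cellIndex_injective hB ω).hasSum_iff]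
  · refine iff_of_eq (congrArg (HasSum · a) (funext fun x => ?_))
    rw [Function.comp_apply, dif_pos (occupied_cellIndex hB x), cellPoint_cellIndex hB]
  · intro i hi
    rw [dif_neg]
    exact fun h => hi ⟨cellPoint h, cellIndex_cellPoint hB h⟩

open Classical in
lemma tsum_cell {B : ℕ → Set X} (hB : IsCellPartition B) (ω : Config X Y)
    (f : ω.carrier → ℝ≥0∞) :
    ∑' i, (if h : ω ∈ occupied (B i) then f (cellPoint h) else 0) = ∑' x, f x :=
  ((hasSum_cell_iff hB ω f _).2 ENNReal.summable.hasSum).tsum_eq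

/-- The finite set of the points in the first `n` cells. -/
def firstPoints {B : ℕ → Set X} (hB : IsCellPartition B) (ω : Config X Y) (n : ℕ) :
    Finset ω.carrier :=
  ((Set.finite_Iio n).preimage (cellIndex_injective hB ω).injOn).toFinset

lemma mem_firstPoints {B : ℕ → Set X} (hB : IsCellPartition B) (ω : Config X Y) (n : ℕ)
    (x : ω.carrier) : x ∈ firstPoints hB ω n ↔ cellIndex B (x : X) < n := by
  simp [firstPoints]

lemma firstPoints_monotone {B : ℕ → Set X} (hB : IsCellPartition B) (ω : Config X Y) :
    Monotone (firstPoints hB ω) := fun m n hmn x hx => by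
  rw [mem_firstPoints] at hx ⊢
  exact hx.trans_le hmn

/-- A family of operators whose matrix elements are (almost everywhere) measurable. -/
def IsMeasurableFamily [TopologicalSpace Y] (B : ℕ → Set X) (μ : Measure (Config X Y))
    (T : ∀ ω : Config X Y, EllTwo ω.carrier →L[ℂ] EllTwo ω.carrier) : Prop :=
  ∀ i j, AEMeasurable (fun ω => entry (B i) (B j) ω (T ω)) μ

namespace IsMeasurableFamily

variable [TopologicalSpace Y] {B : ℕ → Set X} {μ : Measure (Config X Y)}
  {S T : ∀ ω : Config X Y, EllTwo ω.carrier →L[ℂ] EllTwo ω.carrier}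

lemma congr (hT : IsMeasurableFamily B μ T) (h : ∀ᵐ ω ∂μ, T ω = S ω) : IsMeasurableFamily B μ S :=
  fun i j => (hT i j).congr (h.mono fun ω hω => by simp only [hω])

lemma add (hS : IsMeasurableFamily B μ S) (hT : IsMeasurableFamily B μ T) :
    IsMeasurableFamily B μ fun ω => S ω + T ω := fun i j => by
  refine ((hS i j).add (hT i j)).congr (ae_of_all _ fun ω => ?_)
  simp only [entry, Pi.add_apply]
  split_ifs <;> simp [matrixElement_add]

lemma smul (c : ℂ) (hT : IsMeasurableFamily B μ T) : IsMeasurableFamily B μ fun ω => c • T ω :=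
  fun i j => by
  refine ((hT i j).const_mul c).congr (ae_of_all _ fun ω => ?_)
  simp only [entry]
  split_ifs <;> simp [matrixElement_smul]

lemma sub (hS : IsMeasurableFamily B μ S) (hT : IsMeasurableFamily B μ T) :
    IsMeasurableFamily B μ fun ω => S ω - T ω := fun i j => by
  refine ((hS i j).sub (hT i j)).congr (ae_of_all _ fun ω => ?_)
  simp only [entry, Pi.sub_apply]
  split_ifs <;> simp [matrixElement_sub]

/-- The matrix product is a convergent series over the intermediate cell, so its entries are limits
of measurable partial sums. -/
lemma mul (hB : IsCellPartition B) (hS : IsMeasurableFamily B μ S)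
    (hT : IsMeasurableFamily B μ T) : IsMeasurableFamily B μ fun ω => S ω * T ω := fun i j => by
  classical
  refine aemeasurable_of_tendsto_metrizable_ae atTop
    (f := fun n ω => ∑ k ∈ Finset.range n, entry (B i) (B k) ω (S ω) * entry (B k) (B j) ω (T ω))
    (fun n => Finset.aemeasurable_fun_sum _ fun k _ => (hS i k).mul (hT k j))
    (ae_of_all _ fun ω => ?_)
  refine HasSum.tendsto_sum_nat ?_
  unfold entry
  by_cases hi : ω ∈ occupied (B i)
  · by_cases hj : ω ∈ occupied (B j)
    · simp only [hi, hj, dif_pos]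
      convert (hasSum_cell_iff hB ω _ _).2
        (hasSum_matrixElement_comp (S ω) (T ω) (cellPoint hi) (cellPoint hj)) using 2 with k
      split_ifs <;> simp
    · simp only [hj, dif_neg, not_false_eq_true]
      simp [hasSum_zero]
  · simp only [hi, dif_neg, not_false_eq_true]
    simp [hasSum_zero]

lemma of_tendsto {T' : ℕ → ∀ ω : Config X Y, EllTwo ω.carrier →L[ℂ] EllTwo ω.carrier}
    (hT' : ∀ n, IsMeasurableFamily B μ (T' n))
    (h : ∀ᵐ ω ∂μ, ∀ v, Tendsto (fun n => T' n ω v) atTop (𝓝 (T ω v))) :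
    IsMeasurableFamily B μ T := fun i j => by
  refine aemeasurable_of_tendsto_metrizable_ae atTop (fun n => hT' n i j) ?_
  filter_upwards [h] with ω hω
  unfold entry
  split_ifs with hi hj
  · exact tendsto_matrixElement hω _ _
  · exact tendsto_const_nhds
  · exact tendsto_const_nhds

/-- Covers the identity and the truncations to finitely many cells; for these an entry depends only
on which cells are occupied. -/
lemma of_diagonal [CompactSpace Y] (hB : IsCellPartition B) (p : ℕ → Prop)
    (h : ∀ ω : Config X Y, ∀ x y : ω.carrier, (x ≠ y → matrixElement (T ω) x y = 0) ∧
      (p (cellIndex B (x : X)) → matrixElement (T ω) x x = 1) ∧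
      (¬ p (cellIndex B (x : X)) → matrixElement (T ω) x x = 0)) : IsMeasurableFamily B μ T := by
  classical
  intro i j
  have hm : Measurable ((occupied (B i) : Set (Config X Y)).indicator
      fun _ => if i = j ∧ p i then (1 : ℂ) else 0) :=
    measurable_const.indicator (measurableSet_occupied (hB.small i))
  refine hm.aemeasurable.congr (ae_of_all _ fun ω => ?_)
  unfold entry
  by_cases hi : ω ∈ occupied (B i)
  · by_cases hj : ω ∈ occupied (B j)
    · simp only [hi, hj, dif_pos, indicator_of_mem]
      obtain ⟨h1, h2, h3⟩ := h ω (cellPoint hi) (cellPoint hj)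
      rw [cellIndex_cellPoint hB hi] at h2 h3
      by_cases hij : i = j
      · subst hij
        by_cases hp : p i
        · simp [hp, h2 hp]
        · simp [hp, h3 hp]
      · rw [h1, if_neg fun h => hij h.1]
        intro h
        apply hij
        rw [← cellIndex_cellPoint hB hi, ← cellIndex_cellPoint hB hj, h]
    · have hij : i ≠ j := by
        rintro rfl
        exact hj hi
      simp [hi, hj, hij]
  · simp [hi]

lemma one [CompactSpace Y] (hB : IsCellPartition B) :
    IsMeasurableFamily B μ fun _ => 1 :=
  of_diagonal hB (fun _ => True) fun ω x y => by simp +contextual [matrixElement_one]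

lemma pow [CompactSpace Y] (hB : IsCellPartition B) (hT : IsMeasurableFamily B μ T) (n : ℕ) :
    IsMeasurableFamily B μ fun ω => T ω ^ n := by
  induction n with
  | zero => simpa using one hB
  | succ n ih => simpa only [pow_succ] using ih.mul hB hT

lemma truncation [CompactSpace Y] (hB : IsCellPartition B) (n : ℕ) :
    IsMeasurableFamily B μ fun ω => truncation (firstPoints hB ω n) :=
  of_diagonal hB (fun i => i < n) fun ω x y => by
    simp +contextual [matrixElement_truncation, mem_firstPoints]

lemma kerProj [CompactSpace Y] (hB : IsCellPartition B) (hT : IsMeasurableFamily B μ T) {M : ℝ}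
    (hsa : ∀ᵐ ω ∂μ, IsSelfAdjoint (T ω)) (hM : ∀ᵐ ω ∂μ, ‖T ω‖ ≤ M) :
    IsMeasurableFamily B μ fun ω => kerProj (T ω) := by
  -- The scaling constant must be positive, and `max M 1` is so whatever the sign of `M`.
  refine of_tendsto (fun n => ((one hB).sub ((hT.smul (((max M 1)⁻¹ : ℝ) : ℂ)).pow hB 2)).pow hB n)
    ?_
  filter_upwards [hsa, hM] with ω h1 h2 v
  exact tendsto_kerProj_of_norm_le h1 (by positivity) (h2.trans (le_max_left _ _)) v

lemma eigenProj [CompactSpace Y] (hB : IsCellPartition B) (hT : IsMeasurableFamily B μ T) {M : ℝ}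
    (hsa : ∀ᵐ ω ∂μ, IsSelfAdjoint (T ω)) (hM : ∀ᵐ ω ∂μ, ‖T ω‖ ≤ M) (lam : ℝ) :
    IsMeasurableFamily B μ fun ω => eigenProj (T ω) lam := by
  refine kerProj hB (M := M + |lam|) (hT.sub ((one hB).smul (lam : ℂ))) ?_ ?_
  · filter_upwards [hsa] with ω h
    exact sub_smul_isSelfAdjoint h lam
  · filter_upwards [hM] with ω h
    exact norm_sub_smul_one_le h lam

/-- The closed span of the compactly supported solutions is not given by a formula in `T`. Its
projection is the strong limit of the kernel projections of `localOperator` over the first `n`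
cells, and each of those is itself a limit of polynomials. -/
lemma residualProj [CompactSpace Y] (hB : IsCellPartition B) (hT : IsMeasurableFamily B μ T)
    {M : ℝ} (hsa : ∀ᵐ ω ∂μ, IsSelfAdjoint (T ω)) (hM : ∀ᵐ ω ∂μ, ‖T ω‖ ≤ M) (lam : ℝ) :
    IsMeasurableFamily B μ fun ω => residualProj (T ω) lam := by
  have hloc : ∀ n, IsMeasurableFamily B μ fun ω =>
      localOperator (T ω) lam (firstPoints hB ω n) := fun n =>
    ((one hB).sub (truncation hB n)).add
      (((truncation hB n).mul hB (((hT.sub ((one hB).smul (lam : ℂ))).pow hB 2))).mul hB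
        (truncation hB n))
  have hspan : IsMeasurableFamily B μ fun ω => (compactSpan (T ω) lam).starProjection := by
    refine of_tendsto (fun n => kerProj hB (M := 2 + (M + |lam|) ^ 2) (hloc n) ?_ ?_) ?_
    · filter_upwards [hsa] with ω h
      exact localOperator_isSelfAdjoint h lam _
    · filter_upwards [hM] with ω h
      exact norm_localOperator_le h lam _
    · filter_upwards [hsa] with ω h v
      exact tendsto_kerProj_localOperator h lam (firstPoints_monotone hB ω)
        (fun x => ⟨cellIndex B (x : X) + 1, by simp [mem_firstPoints]⟩) v
  refine ((eigenProj hB hT hsa hM lam).sub hspan).congr (ae_of_all _ fun ω => ?_)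
  exact (residualProj_eq (T ω) lam).symm

lemma polynomialOperator [CompactSpace Y] (hB : IsCellPartition B)
    (hT : IsMeasurableFamily B μ T) (p : Polynomial ℝ) :
    IsMeasurableFamily B μ fun ω => polynomialOperator p (T ω) := by
  unfold _root_.polynomialOperator
  induction Finset.range (p.natDegree + 1) using Finset.induction_on with
  | empty => simpa using (one hB (μ := μ)).smul 0
  | insert a s ha ih =>
    simp only [Finset.sum_insert ha]
    exact ((hT.pow hB a).smul _).add ih

/-- Weierstrass approximation on [-M, M], which contains almost every spectrum, gives norm limits of
polynomials in `T ω`. -/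
lemma functionalCalculus [CompactSpace Y] (hB : IsCellPartition B)
    (hT : IsMeasurableFamily B μ T) {M : ℝ} (hsa : ∀ᵐ ω ∂μ, IsSelfAdjoint (T ω))
    (hM : ∀ᵐ ω ∂μ, ‖T ω‖ ≤ M) {φ : ℝ → ℝ} (hφ : Continuous φ) :
    IsMeasurableFamily B μ fun ω => functionalCalculus φ (T ω) := by
  have hex : ∀ n : ℕ, ∃ p : Polynomial ℝ, ∀ x ∈ Icc (-M) M,
      |p.eval x - φ x| < 1 / ((n : ℝ) + 1) := fun n =>
    exists_polynomial_near_of_continuousOn _ _ _ hφ.continuousOn _ (by positivity)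
  choose p hp using hex
  refine of_tendsto (fun n => polynomialOperator hB hT (p n)) ?_
  filter_upwards [hsa, hM] with ω h1 h2 v
  rw [tendsto_iff_norm_sub_tendsto_zero]
  have hlim : Tendsto (fun n : ℕ => 1 / ((n : ℝ) + 1) * ‖v‖) atTop (𝓝 0) := by
    simpa using tendsto_one_div_add_atTop_nhds_zero_nat.mul_const ‖v‖
  refine squeeze_zero (fun _ => norm_nonneg _) (fun n => ?_) hlim
  rw [← cfc_polynomial_eq h1, ← sub_apply]
  refine (ContinuousLinearMap.le_opNorm _ v).trans
    (mul_le_mul_of_nonneg_right ?_ (norm_nonneg v))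
  exact norm_functionalCalculus_sub_le h2 (p n).continuous hφ (by positivity)
    fun t ht => (hp n t ht).le

end IsMeasurableFamily

/-- The kernel takes values in the compactification, so `ι` has to be inverted continuously. Matrix
elements stay in the closed ball of radius `C`, which embeds as a closed subset of the compact
Hausdorff space `Y`, and Tietze extends the inverse to a continuous `ψ` on `Y`. -/
lemma isMeasurableFamily_of_kernel [TopologicalSpace Y] [CompactSpace Y] [T2Space Y] {ι : ℂ → Y}
    (hι : IsDenseEmbedding ι) {B : ℕ → Set X} (hB : IsCellPartition B)
    {μ : Measure (Config X Y)}
    {T : ∀ ω : Config X Y, EllTwo ω.carrier →L[ℂ] EllTwo ω.carrier} {C : ℝ}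
    (hker : ∀ᵐ ω ∂μ, ∀ x y : ω.carrier, ω.h x y = ι (matrixElement (T ω) x y))
    (hC : ∀ᵐ ω ∂μ, ‖T ω‖ ≤ C) : IsMeasurableFamily B μ T := by
  classical
  have hcont : Continuous fun z : Metric.closedBall (0 : ℂ) C => ι z :=
    hι.continuous.comp continuous_subtype_val
  have hemb : IsClosedEmbedding fun z : Metric.closedBall (0 : ℂ) C => ι z :=
    hcont.isClosedEmbedding (hι.injective.comp Subtype.val_injective)
  obtain ⟨ψ, hψ⟩ := ContinuousMap.exists_extension hemb
    (⟨fun z => (z : ℂ), continuous_subtype_val⟩ : C(Metric.closedBall (0 : ℂ) C, ℂ))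
  have hψ' : ∀ z : ℂ, ‖z‖ ≤ C → ψ (ι z) = z := fun z hz =>
    DFunLike.congr_fun hψ ⟨z, by simpa using hz⟩
  intro i j
  refine (measurable_kernel (hB.small i) (hB.small j) ψ).aemeasurable.congr ?_
  filter_upwards [hker, hC] with ω h1 h2
  unfold entry
  split_ifs with hi hj
  · rw [h1, hψ' _ ((norm_matrixElement_le _ _ _).trans h2)]
  · rfl
  · rfl

end Config

/-! ### Invariant measures on the space -/

section Invariant

variable {X Γ : Type*} [MetricSpace X] [MeasurableSpace X] [BorelSpace X]
  [MetricSpace Γ] [ProperSpace Γ] [Group Γ] [IsTopologicalGroup Γ]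
  [MeasurableSpace Γ] [BorelSpace Γ]

omit [ProperSpace Γ] [IsTopologicalGroup Γ] [MeasurableSpace Γ] [BorelSpace Γ] in
lemma inv_closedBall_one [IsIsometricSMul Γ Γ] (r : ℝ) :
    (Metric.closedBall (1 : Γ) r)⁻¹ = Metric.closedBall 1 r := by
  ext γ
  rw [Set.mem_inv, Metric.mem_closedBall, Metric.mem_closedBall]
  have : dist γ⁻¹ 1 = dist γ 1 := by
    have h := dist_smul γ γ⁻¹ 1
    simp only [smul_eq_mul, mul_inv_cancel, mul_one] at h
    rw [← h, dist_comm]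
  rw [this]

/-- A Haar measure on a unimodular group is invariant under inversion. -/
lemma isInvInvariant_of_unimodular [IsIsometricSMul Γ Γ] (haarΓ : Measure Γ)
    [haarΓ.IsHaarMeasure] [haarΓ.IsMulRightInvariant] : haarΓ.IsInvInvariant := by
  have hfin : IsFiniteMeasureOnCompacts haarΓ.inv := ⟨fun K hK => by
    rw [Measure.inv_apply]
    exact hK.inv.measure_lt_top⟩
  have h := Measure.isMulLeftInvariant_eq_smul haarΓ.inv haarΓ
  set c := haarΓ.inv.haarScalarFactor haarΓ
  -- The closed unit ball is symmetric and has positive finite measure, so it forces the Haar scalar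
  -- factor to be 1.
  have h1 := congrArg (fun ν : Measure Γ => ν (Metric.closedBall 1 1)) h
  simp only [Measure.inv_apply, inv_closedBall_one, Measure.smul_apply] at h1
  have hpos : haarΓ (Metric.closedBall 1 1) ≠ 0 :=
    (Metric.measure_closedBall_pos haarΓ 1 one_pos).ne'
  have hfin' : haarΓ (Metric.closedBall 1 1) ≠ ∞ :=
    (isCompact_closedBall 1 1).measure_lt_top.ne
  have hc : c = 1 := by
    have h2 : (1 : ℝ≥0∞) * haarΓ (Metric.closedBall 1 1) =
        (c : ℝ≥0∞) * haarΓ (Metric.closedBall 1 1) := by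
      rw [one_mul]
      exact h1
    have h3 := (ENNReal.mul_left_inj hpos hfin').1 h2
    exact_mod_cast h3.symm
  rw [hc, one_smul] at h
  exact ⟨h⟩

variable [MulAction Γ X] {F : Set X}

/-- The map `Φ` that sends the points of `γ F` to `γ`. -/
def domainMap (hF : IsStrictFundamentalDomain Γ F) (x : X) : Γ := (hF x).choose

section

omit [MeasurableSpace X] [BorelSpace X] [ProperSpace Γ] [IsTopologicalGroup Γ]
  [MeasurableSpace Γ] [BorelSpace Γ] [MetricSpace X] [MetricSpace Γ]

variable (hF : IsStrictFundamentalDomain Γ F)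
include hF

lemma mem_domainMap_smul (x : X) : x ∈ domainMap hF x • F := (hF x).choose_spec.1

lemma mem_smul_iff_domainMap (x : X) (γ : Γ) : x ∈ γ • F ↔ domainMap hF x = γ :=
  ⟨fun h => ((hF x).choose_spec.2 γ h).symm, fun h => h ▸ mem_domainMap_smul hF x⟩

lemma domainMap_smul (γ : Γ) (x : X) : domainMap hF (γ • x) = γ * domainMap hF x := by
  rw [← mem_smul_iff_domainMap hF, mul_smul]
  exact Set.smul_mem_smul_set (mem_domainMap_smul hF x)

lemma domainMap_preimage (J : Set Γ) : domainMap hF ⁻¹' J = J • F := by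
  ext x
  rw [mem_preimage]
  constructor
  · intro h
    obtain ⟨y, hy, hxy⟩ := mem_domainMap_smul hF x
    exact ⟨_, h, y, hy, hxy⟩
  · rintro ⟨γ, hγ, y, hy, rfl⟩
    have : domainMap hF (γ • y) = γ :=
      (mem_smul_iff_domainMap hF _ γ).1 (Set.smul_mem_smul_set hy)
    change domainMap hF (γ • y) ∈ J
    rwa [this]

end

variable (hF : IsStrictFundamentalDomain Γ F)

omit [IsTopologicalGroup Γ] in
include hF in
-- The preimage of a closed set C is C • F, a countable union of compact sets: C is exhausted by
-- compact sets since Γ is proper, and F is σ-compact.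
lemma measurable_domainMap [ContinuousSMul Γ X] (hF_sigma : IsSigmaCompact F) :
    Measurable (domainMap hF : X → Γ) := by
  refine measurable_of_isClosed fun C hC => ?_
  rw [domainMap_preimage]
  obtain ⟨K, hK, rfl⟩ := hF_sigma
  have : C • (⋃ n, K n) = ⋃ (n : ℕ) (m : ℕ), (C ∩ Metric.closedBall 1 n) • K m := by
    ext x
    simp only [mem_iUnion]
    constructor
    · rintro ⟨γ, hγ, y, hy, rfl⟩
      obtain ⟨m, hm⟩ := mem_iUnion.1 hy
      obtain ⟨n, hn⟩ := exists_nat_ge (dist γ 1)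
      exact ⟨n, m, γ, ⟨hγ, hn⟩, y, hm, rfl⟩
    · rintro ⟨n, m, γ, ⟨hγ, -⟩, y, hy, rfl⟩
      exact ⟨γ, hγ, y, mem_iUnion.2 ⟨m, hy⟩, rfl⟩
  rw [this]
  refine MeasurableSet.iUnion fun n => MeasurableSet.iUnion fun m => ?_
  have hc : IsCompact (C ∩ Metric.closedBall 1 (n : ℝ)) :=
    (isCompact_closedBall 1 _).inter_left hC
  exact (hc.smul_set (hK m)).measurableSet

variable [SecondCountableTopology X] [ContinuousSMul Γ X]
  (haarΓ : Measure Γ) [haarΓ.IsHaarMeasure]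

/-- Averaging one function over the group against another one is a symmetric operation. -/
lemma lintegral_mul_average_comm [haarΓ.IsInvInvariant] (m : Measure X) [SFinite m]
    [SMulInvariantMeasure Γ X m] {g g' : X → ℝ≥0∞} (hg : Measurable g) (hg' : Measurable g') :
    ∫⁻ x, g x * ∫⁻ γ : Γ, g' (γ⁻¹ • x) ∂haarΓ ∂m =
      ∫⁻ x, g' x * ∫⁻ γ : Γ, g (γ⁻¹ • x) ∂haarΓ ∂m := by
  have hsm : Measurable fun p : Γ × X => p.1 • p.2 := continuous_smul.measurable
  have hsm' : Measurable fun p : X × Γ => p.2⁻¹ • p.1 :=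
    hsm.comp ((measurable_inv.comp measurable_snd).prodMk measurable_fst)
  calc ∫⁻ x, g x * ∫⁻ γ : Γ, g' (γ⁻¹ • x) ∂haarΓ ∂m
      = ∫⁻ x, ∫⁻ γ : Γ, g x * g' (γ⁻¹ • x) ∂haarΓ ∂m := by
        refine lintegral_congr fun x => ?_
        rw [lintegral_const_mul]
        exact hg'.comp (hsm'.comp (measurable_const.prodMk measurable_id))
    _ = ∫⁻ γ : Γ, ∫⁻ x, g x * g' (γ⁻¹ • x) ∂m ∂haarΓ :=
        lintegral_lintegral_swap
          ((hg.comp measurable_fst).mul (hg'.comp hsm')).aemeasurable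
    -- Invariance of `m` moves the translation to the other factor; inversion invariance of Haar
    -- measure then restores the inverse.
    _ = ∫⁻ γ : Γ, ∫⁻ x, g (γ • x) * g' x ∂m ∂haarΓ := by
        refine lintegral_congr fun γ => ?_
        have hm : Measurable fun x => g x * g' (γ⁻¹ • x) :=
          hg.mul (hg'.comp (hsm'.comp (measurable_id.prodMk measurable_const)))
        rw [← (measurePreserving_smul γ m).lintegral_comp hm]
        simp
    _ = ∫⁻ x, ∫⁻ γ : Γ, g (γ • x) * g' x ∂haarΓ ∂m :=
        lintegral_lintegral_swap
          ((hg.comp hsm).mul (hg'.comp measurable_snd)).aemeasurable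
    _ = ∫⁻ x, g' x * ∫⁻ γ : Γ, g (γ⁻¹ • x) ∂haarΓ ∂m := by
        refine lintegral_congr fun x => ?_
        rw [lintegral_mul_const, mul_comm, ← lintegral_inv_eq_self (fun γ : Γ => g (γ • x))]
        exact hg.comp (hsm.comp (measurable_id.prodMk measurable_const))

/-- The mean density of a measure, relative to the unit ball of the group. -/
def unitDensity (F : Set X) (m : Measure X) : ℝ≥0∞ :=
  m (Metric.closedBall (1 : Γ) 1 • F) / haarΓ (Metric.closedBall (1 : Γ) 1)

omit [IsTopologicalGroup Γ] [ProperSpace Γ] [BorelSpace Γ] in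
lemma haar_unitBall_ne_zero : haarΓ (Metric.closedBall (1 : Γ) 1) ≠ 0 :=
  (Metric.measure_closedBall_pos haarΓ 1 one_pos).ne'

omit [IsTopologicalGroup Γ] [BorelSpace Γ] in
lemma haar_unitBall_ne_top : haarΓ (Metric.closedBall (1 : Γ) 1) ≠ ∞ :=
  (isCompact_closedBall 1 1).measure_lt_top.ne

section

variable [haarΓ.IsInvInvariant] [haarΓ.IsMulRightInvariant] (hF_sigma : IsSigmaCompact F)
include hF hF_sigma

omit [MetricSpace X] [MeasurableSpace X] [BorelSpace X] [ProperSpace Γ]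
  [SecondCountableTopology X] [ContinuousSMul Γ X] [haarΓ.IsHaarMeasure] hF_sigma in
-- By equivariance of `domainMap` the average is the Haar measure of the γ with γ⁻¹Φ(x) ∈ J.
-- Inversion and right invariance make it independent of `x`; this is where unimodularity enters.
lemma average_indicator {J : Set Γ} (hJ : MeasurableSet J) (x : X) :
    ∫⁻ γ : Γ, (J • F).indicator 1 (γ⁻¹ • x) ∂haarΓ = haarΓ J := by
  have h1 : ∀ γ : Γ, (J • F).indicator (1 : X → ℝ≥0∞) (γ⁻¹ • x) =
      J.indicator 1 (γ⁻¹ * domainMap hF x) := by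
    intro γ
    rw [← domainMap_preimage hF]
    have h2 : γ⁻¹ • x ∈ domainMap hF ⁻¹' J ↔ γ⁻¹ * domainMap hF x ∈ J := by
      rw [mem_preimage, domainMap_smul hF]
    by_cases h3 : γ⁻¹ * domainMap hF x ∈ J
    · rw [indicator_of_mem h3, indicator_of_mem (h2.2 h3)]
      rfl
    · rw [indicator_of_notMem h3, indicator_of_notMem fun h => h3 (h2.1 h)]
  simp_rw [h1]
  rw [lintegral_inv_eq_self (fun γ : Γ => J.indicator (1 : Γ → ℝ≥0∞) (γ * domainMap hF x)),
    lintegral_mul_right_eq_self (fun γ : Γ => J.indicator (1 : Γ → ℝ≥0∞) γ),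
    lintegral_indicator_one hJ]

omit [IsTopologicalGroup Γ] [SecondCountableTopology X] in
lemma measurableSet_smul_domain {J : Set Γ} (hJ : MeasurableSet J) : MeasurableSet (J • F) := by
  rw [← domainMap_preimage hF]
  exact measurable_domainMap hF hF_sigma hJ

/-- Averaging the indicators of JF and of the unit ball times F against each other gives
m(JF)·|ball| = m(ball·F)·|J|. -/
lemma measure_smul_domain (m : Measure X) [SFinite m] [SMulInvariantMeasure Γ X m]
    {J : Set Γ} (hJ : MeasurableSet J) : m (J • F) = haarΓ J * unitDensity haarΓ F m := by
  set b := haarΓ (Metric.closedBall (1 : Γ) 1)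
  have hB : MeasurableSet (Metric.closedBall (1 : Γ) 1) := Metric.isClosed_closedBall.measurableSet
  have hmJ := measurableSet_smul_domain hF hF_sigma hJ
  have hmB := measurableSet_smul_domain hF hF_sigma hB
  have h := lintegral_mul_average_comm haarΓ m
    ((measurable_one (α := ℝ≥0∞) (β := X)).indicator hmJ) (measurable_one.indicator hmB)
  simp only [average_indicator hF haarΓ hB, average_indicator hF haarΓ hJ] at h
  rw [lintegral_mul_const _ (measurable_one.indicator hmJ),
    lintegral_mul_const _ (measurable_one.indicator hmB), lintegral_indicator_one hmJ,
    lintegral_indicator_one hmB] at h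
  rw [unitDensity, ← mul_div_assoc, mul_comm (haarΓ J), ← h,
    ENNReal.mul_div_cancel_right (haar_unitBall_ne_zero haarΓ) (haar_unitBall_ne_top haarΓ)]

/-- Take J = Γ in `measure_smul_domain`: the translates of F cover X. -/
lemma measure_eq_zero_of_unitDensity (m : Measure X) [SFinite m] [SMulInvariantMeasure Γ X m]
    (h : unitDensity haarΓ F m = 0) : m = 0 := by
  have h1 := measure_smul_domain hF haarΓ hF_sigma m MeasurableSet.univ
  rw [h, mul_zero, ← domainMap_preimage hF, preimage_univ] at h1
  exact Measure.measure_univ_eq_zero.1 h1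

/-- Averaged against the indicator of ball·F, the positive part of `u` exceeds the negative part by
exactly m(ball·F), because the group average of `u` is 1. No subtraction appears, since the
integrals may be infinite. -/
lemma lintegral_pos_part_eq (m : Measure X) [SFinite m] [SMulInvariantMeasure Γ X m]
    {u : X → ℝ} (hu : Measurable u) (hu1 : ∀ x, ∫ γ : Γ, u (γ⁻¹ • x) ∂haarΓ = 1) :
    ∫⁻ x, ENNReal.ofReal (u x) ∂m =
      ∫⁻ x, ENNReal.ofReal (-u x) ∂m + unitDensity haarΓ F m := by
  set b := haarΓ (Metric.closedBall (1 : Γ) 1)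
  have hb0 : b ≠ 0 := haar_unitBall_ne_zero haarΓ
  have hbt : b ≠ ∞ := haar_unitBall_ne_top haarΓ
  have hB : MeasurableSet (Metric.closedBall (1 : Γ) 1) := Metric.isClosed_closedBall.measurableSet
  have hmB := measurableSet_smul_domain hF hF_sigma hB
  have hmi : Measurable ((Metric.closedBall (1 : Γ) 1 • F).indicator (1 : X → ℝ≥0∞)) :=
    measurable_one.indicator hmB
  have hpos : Measurable fun x => ENNReal.ofReal (u x) := hu.ennreal_ofReal
  have hneg : Measurable fun x => ENNReal.ofReal (-u x) := hu.neg.ennreal_ofReal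
  have hdiff : ∀ x, ∫⁻ γ : Γ, ENNReal.ofReal (u (γ⁻¹ • x)) ∂haarΓ =
      ∫⁻ γ : Γ, ENNReal.ofReal (-u (γ⁻¹ • x)) ∂haarΓ + 1 := by
    intro x
    -- A nonintegrable function would have Bochner integral 0, not 1.
    have hint : Integrable (fun γ : Γ => u (γ⁻¹ • x)) haarΓ := by
      by_contra h
      have := hu1 x
      rw [integral_undef h] at this
      exact zero_ne_one this
    have h1 := integral_eq_lintegral_pos_part_sub_lintegral_neg_part hint
    rw [hu1 x] at h1
    have hp : ∫⁻ γ : Γ, ENNReal.ofReal (u (γ⁻¹ • x)) ∂haarΓ ≠ ∞ :=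
      (hint.lintegral_lt_top).ne
    have hn : ∫⁻ γ : Γ, ENNReal.ofReal (-u (γ⁻¹ • x)) ∂haarΓ ≠ ∞ :=
      (hint.neg.lintegral_lt_top).ne
    rw [← ENNReal.toReal_eq_toReal_iff' hp (ENNReal.add_ne_top.2 ⟨hn, ENNReal.one_ne_top⟩),
      ENNReal.toReal_add hn ENNReal.one_ne_top, ENNReal.toReal_one]
    linarith
  have e1 := lintegral_mul_average_comm haarΓ m hpos hmi
  have e2 := lintegral_mul_average_comm haarΓ m hneg hmi
  simp only [average_indicator hF haarΓ hB] at e1 e2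
  rw [lintegral_mul_const _ hpos] at e1
  rw [lintegral_mul_const _ hneg] at e2
  have e3 : (∫⁻ x, ENNReal.ofReal (u x) ∂m) * b = (∫⁻ x, ENNReal.ofReal (-u x) ∂m) * b +
      m (Metric.closedBall (1 : Γ) 1 • F) := by
    rw [e1, e2, ← lintegral_indicator_one hmB, ← lintegral_add_right _ hmi]
    refine lintegral_congr fun x => ?_
    rw [hdiff, mul_add, mul_one]
  rw [← ENNReal.mul_left_inj hb0 hbt, e3, add_mul, unitDensity, ENNReal.div_mul_cancel hb0 hbt]

end

end Invariant

/-! ### Campbell measures of weighted configurations -/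

namespace Config

variable {X Y Γ : Type*} [MetricSpace X] [TopologicalSpace Y]

open Classical in
/-- The weight of the point in the `i`-th cell. -/
def cellWeight (B : Set X) (w : ∀ ω : Config X Y, ω.carrier → ℝ≥0∞) (ω : Config X Y) : ℝ≥0∞ :=
  if h : ω ∈ occupied B then w ω (cellPoint h) else 0

variable [MeasurableSpace X] [Nonempty X]

/-- The measure `g ↦ ∫ ∑_{x ∈ A} g(x) w_ω(x) dμ(ω)` on `X`. -/
def campbell (B : ℕ → Set X) (μ : Measure (Config X Y))
    (w : ∀ ω : Config X Y, ω.carrier → ℝ≥0∞) : Measure X :=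
  Measure.sum fun i => (μ.withDensity (cellWeight (B i) w)).map (point (B i))

instance (B : ℕ → Set X) (μ : Measure (Config X Y)) [SFinite μ]
    (w : ∀ ω : Config X Y, ω.carrier → ℝ≥0∞) : SFinite (campbell B μ w) := by
  unfold campbell
  infer_instance

/-- Measurability of a weight. -/
def IsMeasurableWeight (B : ℕ → Set X) (μ : Measure (Config X Y))
    (w : ∀ ω : Config X Y, ω.carrier → ℝ≥0∞) : Prop :=
  ∀ i, AEMeasurable (cellWeight (B i) w) μ

variable {B : ℕ → Set X} {μ : Measure (Config X Y)} {w : ∀ ω : Config X Y, ω.carrier → ℝ≥0∞}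

omit [MeasurableSpace X] [TopologicalSpace Y] in
lemma tsum_mul_cellWeight (hB : IsCellPartition B) (ω : Config X Y) (g : X → ℝ≥0∞) :
    ∑' i, cellWeight (B i) w ω * g (point (B i) ω) = ∑' x : ω.carrier, g x * w ω x := by
  classical
  rw [← tsum_cell hB ω fun x => g x * w ω x]
  refine tsum_congr fun i => ?_
  unfold cellWeight
  split_ifs with h
  · rw [point_eq h, mul_comm]
  · rw [zero_mul]

variable [BorelSpace X] [CompactSpace Y]

lemma IsMeasurableWeight.aemeasurable_tsum (hw : IsMeasurableWeight B μ w)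
    (hB : IsCellPartition B) {g : X → ℝ≥0∞} (hg : Measurable g) :
    AEMeasurable (fun ω : Config X Y => ∑' x : ω.carrier, g x * w ω x) μ := by
  simp_rw [← tsum_mul_cellWeight hB]
  exact AEMeasurable.tsum fun i =>
    (hw i).mul (hg.comp (measurable_point (hB.small i))).aemeasurable

lemma lintegral_campbell (hB : IsCellPartition B) (hw : IsMeasurableWeight B μ w)
    {g : X → ℝ≥0∞} (hg : Measurable g) :
    ∫⁻ x, g x ∂campbell B μ w = ∫⁻ ω, ∑' x : ω.carrier, g x * w ω x ∂μ := by
  have hm : ∀ i, Measurable fun ω : Config X Y => g (point (B i) ω) := fun i =>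
    hg.comp (measurable_point (hB.small i))
  rw [campbell, lintegral_sum_measure]
  simp_rw [← tsum_mul_cellWeight hB]
  rw [lintegral_tsum (f := fun i ω => cellWeight (B i) w ω * g (point (B i) ω))
    fun i => (hw i).mul (hm i).aemeasurable]
  refine tsum_congr fun i => ?_
  rw [lintegral_map hg (measurable_point (hB.small i)),
    lintegral_withDensity_eq_lintegral_mul₀ (hw i) (hm i).aemeasurable]
  rfl

lemma campbell_apply (hB : IsCellPartition B) (hw : IsMeasurableWeight B μ w) {s : Set X}
    (hs : MeasurableSet s) :
    campbell B μ w s = ∫⁻ ω, ∑' x : ω.carrier, s.indicator 1 (x : X) * w ω x ∂μ := by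
  rw [← lintegral_indicator_one hs, lintegral_campbell hB hw (measurable_one.indicator hs)]

section Invariance

variable [Group Γ] [MulAction Γ X] [IsIsometricSMul Γ X]

/-- Invariance of a weight under the group. -/
def IsInvariantWeight (Γ : Type*) [Group Γ] [MulAction Γ X] [IsIsometricSMul Γ X]
    (μ : Measure (Config X Y)) (w : ∀ ω : Config X Y, ω.carrier → ℝ≥0∞) : Prop :=
  ∀ γ : Γ, ∀ᵐ ω ∂μ, ∀ x : ω.carrier, w (γ • ω) (ω.translate γ x) = w ω x

omit [MeasurableSpace X] [Nonempty X] [BorelSpace X] in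
lemma measurePreserving_smul [SMulInvariantMeasure Γ (Config X Y) μ] (γ : Γ) :
    MeasurePreserving (fun ω : Config X Y => γ • ω) μ μ := by
  refine ⟨measurable_const_smul γ, Measure.ext fun s hs => ?_⟩
  rw [Measure.map_apply (measurable_const_smul γ) hs]
  exact SMulInvariantMeasure.measure_preimage_smul γ hs

/-- The sum over `ω` equals the sum over γω by invariance of the weight; invariance of `μ` then
replaces γω by `ω`. -/
lemma smulInvariantMeasure_campbell [SMulInvariantMeasure Γ (Config X Y) μ]
    (hB : IsCellPartition B) (hw : IsMeasurableWeight B μ w) (hinv : IsInvariantWeight Γ μ w) :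
    SMulInvariantMeasure Γ X (campbell B μ w) := by
  refine ⟨fun γ s hs => ?_⟩
  have hsm : Measurable fun x : X => γ • x := (isometry_smul X γ).continuous.measurable
  have hs' : MeasurableSet ((γ • ·) ⁻¹' s : Set X) := hsm hs
  rw [campbell_apply hB hw hs', campbell_apply hB hw hs]
  have hmp := measurePreserving_smul (μ := μ) γ
  have hae := hw.aemeasurable_tsum hB ((measurable_one (α := ℝ≥0∞) (β := X)).indicator hs)
  calc _ = ∫⁻ ω, ∑' x : (γ • ω).carrier, s.indicator 1 (x : X) * w (γ • ω) x ∂μ := by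
        refine lintegral_congr_ae ?_
        filter_upwards [hinv γ] with ω hω
        refine Eq.trans (tsum_congr fun x => ?_) ((Set.translateEquiv γ ω.carrier).tsum_eq
          fun x : (γ • ω).carrier => s.indicator (1 : X → ℝ≥0∞) (x : X) * w (γ • ω) x)
        rw [← hω x]
        rfl
    _ = ∫⁻ ω, ∑' x : ω.carrier, s.indicator 1 (x : X) * w ω x ∂(μ.map fun ω => γ • ω) := by
        rw [lintegral_map' (by rwa [hmp.map_eq]) hmp.measurable.aemeasurable]
    _ = _ := by rw [hmp.map_eq]

end Invariance

/-! ### The intensity measure -/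

omit [MeasurableSpace X] [BorelSpace X] [CompactSpace Y] [Nonempty X] [TopologicalSpace Y] in
lemma tsum_indicator_eq_encard (ω : Config X Y) (s : Set X) :
    ∑' x : ω.carrier, s.indicator (1 : X → ℝ≥0∞) (x : X) = ((s ∩ ω.carrier).encard : ℝ≥0∞) := by
  have h1 : ∀ x : ω.carrier, s.indicator (1 : X → ℝ≥0∞) (x : X) =
      (Subtype.val ⁻¹' s : Set ω.carrier).indicator (fun _ => (1 : ℝ≥0∞)) x := fun x => rfl
  simp_rw [h1]
  rw [← tsum_subtype, ENNReal.tsum_set_one]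
  congr 1
  rw [← Subtype.val_injective.encard_image, Subtype.image_preimage_coe, inter_comm]

omit [Nonempty X] [MeasurableSpace X] [BorelSpace X] in
lemma isMeasurableWeight_one (hB : IsCellPartition B) :
    IsMeasurableWeight B μ (fun _ _ => 1) := fun i =>
  ((measurable_one (α := ℝ≥0∞) (β := Config X Y)).indicator
    (measurableSet_occupied (hB.small i))).aemeasurable.congr (ae_of_all _ fun ω => by
      by_cases h : ω ∈ occupied (B i) <;> simp [cellWeight, h])

lemma campbell_one_apply (hB : IsCellPartition B) {s : Set X} (hs : MeasurableSet s) :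
    campbell B μ (fun _ _ => 1) s = intensity μ s := by
  rw [campbell_apply hB (isMeasurableWeight_one hB) hs, intensity]
  simp_rw [mul_one, tsum_indicator_eq_encard]

omit [MeasurableSpace X] [BorelSpace X] [CompactSpace Y] [Nonempty X] in
lemma intensity_lt_top [IsFiniteMeasure μ] {s K : Set X} (hK : IsCompact K) (hs : s ⊆ K) :
    intensity μ s < ∞ := by
  obtain ⟨N, hN⟩ := hK.exists_encard_inter_le
  have hle : intensity μ s ≤ ∫⁻ _ω, (N : ℝ≥0∞) ∂μ := by
    refine lintegral_mono fun ω => ?_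
    have h1 : (s ∩ ω.carrier).encard ≤ (N : ℕ∞) :=
      (encard_le_encard (inter_subset_inter_left _ hs)).trans (hN _ ω.uniformlyDiscrete)
    simpa using ENat.toENNReal_le.2 h1
  refine hle.trans_lt ?_
  rw [lintegral_const]
  exact ENNReal.mul_lt_top (ENNReal.natCast_lt_top N) (measure_lt_top μ univ)

/-- A bump function at a point of `ω₀` yields an open neighbourhood of `ω₀` consisting of nonempty
configurations. It has positive measure because `ω₀` is in the support. -/
lemma campbell_one_ne_zero (hB : IsCellPartition B)
    (h : ∃ ω ∈ μ.support, ω.carrier.Nonempty) [LocallyCompactSpace X] :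
    campbell B μ (fun _ _ => 1) ≠ 0 := by
  obtain ⟨ω₀, hω₀, x₀, hx₀⟩ := h
  intro h0
  obtain ⟨f, hf1, hfc, hf01⟩ : ∃ f : C(X, ℝ), f x₀ = 1 ∧ HasCompactSupport f ∧
      ∀ x, f x ∈ Icc (0 : ℝ) 1 := by
    obtain ⟨f, h1, -, h3, h4⟩ := exists_continuous_one_zero_of_isCompact
      (isCompact_singleton (x := x₀)) (isClosed_empty (X := X)) (by simp)
    exact ⟨f, h1 rfl, h3, h4⟩
  let g : C(X, ℂ) := ⟨fun x => (f x : ℂ), Complex.continuous_ofReal.comp f.continuous⟩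
  have hg0 : ∀ x, x ∉ tsupport f → g x = 0 := fun x hx => by
    simp [g, image_eq_zero_of_notMem_tsupport hx]
  have hcont := continuous_finsum (Y := Y) g hfc hg0
  set U := (fun ω : Config X Y => ∑ᶠ x : ω.carrier, g x) ⁻¹' {0}ᶜ
  have hU : IsOpen U := isOpen_compl_singleton.preimage hcont
  have hmem : ω₀ ∈ U := by
    change ∑ᶠ x : ω₀.carrier, g x ≠ 0
    have h1 : ∑ᶠ x : ω₀.carrier, g x = ((∑ᶠ x : ω₀.carrier, f x : ℝ) : ℂ) :=
      (Complex.ofRealHom.toAddMonoidHom.map_finsum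
        (ω₀.uniformlyDiscrete.finite_support hfc (fun x : ω₀.carrier => f x) fun x hx =>
          image_eq_zero_of_notMem_tsupport hx)).symm
    have h2 : f x₀ ≤ ∑ᶠ x : ω₀.carrier, f x :=
      single_le_finsum (⟨x₀, hx₀⟩ : ω₀.carrier)
        (ω₀.uniformlyDiscrete.finite_support hfc (fun x : ω₀.carrier => f x) fun x hx =>
          image_eq_zero_of_notMem_tsupport hx) fun x => (hf01 x).1
    rw [h1, Complex.ofReal_ne_zero]
    linarith
  have hpos : 0 < μ U := (Measure.mem_support_iff_forall ω₀).1 hω₀ U (hU.mem_nhds hmem)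
  have hm := campbell_one_apply (μ := μ) hB (MeasurableSet.univ (α := X))
  have hae := (isMeasurableWeight_one (μ := μ) hB).aemeasurable_tsum hB
    (measurable_one (α := ℝ≥0∞) (β := X))
  have h2 := lintegral_campbell hB (isMeasurableWeight_one (μ := μ) hB)
    (measurable_one (α := ℝ≥0∞) (β := X))
  rw [h0, lintegral_zero_measure] at h2
  have h3 := (lintegral_eq_zero_iff' hae).1 h2.symm
  have h4 : U ⊆ {ω : Config X Y | ¬ ∑' x : ω.carrier, (1 : X → ℝ≥0∞) x * 1 = 0} := by
    intro ω hω h5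
    refine hω ?_
    rw [ENNReal.tsum_eq_zero] at h5
    refine finsum_eq_zero_of_forall_eq_zero fun x => ?_
    exact absurd (h5 x) (by simp)
  exact hpos.ne' (measure_mono_null h4 h3)

end Config

/-! ### Weighted traces -/

section WeightedTrace

variable {X : Type*} [MetricSpace X] {A : Set X}

lemma finite_support_mul {u : X → ℝ} (hA : IsUniformlyDiscrete A) (hu : HasCompactSupport u)
    (f : A → ℂ) : (Function.support fun x : A => (u x : ℂ) * f x).Finite :=
  hA.finite_support hu _ fun x hx => by simp [image_eq_zero_of_notMem_tsupport hx]

lemma weightedTrace_add {u : X → ℝ} (hA : IsUniformlyDiscrete A) (hu : HasCompactSupport u)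
    (S T : EllTwo A →L[ℂ] EllTwo A) :
    weightedTrace u (S + T) = weightedTrace u S + weightedTrace u T := by
  unfold weightedTrace
  rw [← finsum_add_distrib (finite_support_mul hA hu _) (finite_support_mul hA hu _)]
  exact finsum_congr fun x => by rw [matrixElement_add, mul_add]

omit [MetricSpace X] in
lemma weightedTrace_smul {u : X → ℝ} (c : ℂ) (T : EllTwo A →L[ℂ] EllTwo A) :
    weightedTrace u (c • T) = c * weightedTrace u T := by
  unfold weightedTrace
  rw [mul_finsum]
  exact finsum_congr fun x => by rw [matrixElement_smul]; ring

/-- The points of a uniformly discrete set in the support of `u`. -/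
def supportPoints {u : X → ℝ} (hA : IsUniformlyDiscrete A) (hu : HasCompactSupport u) :
    Finset A :=
  (hA.finite_support (M := ℝ) hu (fun x : A => u x) fun _ hx =>
    image_eq_zero_of_notMem_tsupport hx).toFinset

lemma notMem_supportPoints {u : X → ℝ} (hA : IsUniformlyDiscrete A) (hu : HasCompactSupport u)
    {x : A} (hx : x ∉ supportPoints hA hu) : u x = 0 := by
  simpa [supportPoints] using hx

lemma weightedTrace_eq_sum {u : X → ℝ} (hA : IsUniformlyDiscrete A) (hu : HasCompactSupport u)
    (T : EllTwo A →L[ℂ] EllTwo A) :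
    weightedTrace u T = ∑ x ∈ supportPoints hA hu, (u x : ℂ) * matrixElement T x x :=
  finsum_eq_sum_of_support_subset _ fun x hx => by
    by_contra h
    exact hx (by simp [notMem_supportPoints hA hu h])

lemma tsum_eq_sum_supportPoints {u : X → ℝ} (hA : IsUniformlyDiscrete A)
    (hu : HasCompactSupport u) {f : A → ℝ≥0∞} (hf : ∀ x : A, u x = 0 → f x = 0) :
    ∑' x, f x = ∑ x ∈ supportPoints hA hu, f x :=
  tsum_eq_sum fun x hx => hf x (notMem_supportPoints hA hu hx)

lemma norm_weightedTrace_le {u : X → ℝ} (hA : IsUniformlyDiscrete A) (hu : HasCompactSupport u)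
    {T : EllTwo A →L[ℂ] EllTwo A} {M : ℝ} (hM : ‖T‖ ≤ M) :
    ‖weightedTrace u T‖ ≤ M * (∑' x : A, ENNReal.ofReal |u x|).toReal := by
  rw [tsum_eq_sum_supportPoints hA hu (fun x hx => by simp [hx]),
    ENNReal.toReal_sum fun x _ => ENNReal.ofReal_ne_top, weightedTrace_eq_sum hA hu, Finset.mul_sum]
  refine (norm_sum_le _ _).trans (Finset.sum_le_sum fun x _ => ?_)
  rw [norm_mul, Complex.norm_real, Real.norm_eq_abs, ENNReal.toReal_ofReal (abs_nonneg _), mul_comm]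
  exact mul_le_mul_of_nonneg_right ((norm_matrixElement_le T x x).trans hM) (abs_nonneg _)

/-- The diagonal of a positive operator is real and nonnegative. Splitting `u` by sign expresses the
trace through extended nonnegative sums, the kind that Campbell measures integrate. -/
lemma weightedTrace_eq_sub {u : X → ℝ} (hA : IsUniformlyDiscrete A) (hu : HasCompactSupport u)
    {T : EllTwo A →L[ℂ] EllTwo A} (hT : T.IsPositive) :
    weightedTrace u T =
      (((∑' x : A, ENNReal.ofReal (u x) * ENNReal.ofReal (matrixElement T x x).re).toReal -
        (∑' x : A, ENNReal.ofReal (-u x) * ENNReal.ofReal (matrixElement T x x).re).toReal : ℝ) :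
          ℂ) := by
  rw [tsum_eq_sum_supportPoints hA hu (fun x hx => by simp [hx]),
    tsum_eq_sum_supportPoints hA hu (fun x hx => by simp [hx]),
    ENNReal.toReal_sum fun x _ => ENNReal.mul_ne_top ENNReal.ofReal_ne_top ENNReal.ofReal_ne_top,
    ENNReal.toReal_sum fun x _ => ENNReal.mul_ne_top ENNReal.ofReal_ne_top ENNReal.ofReal_ne_top,
    ← Finset.sum_sub_distrib, weightedTrace_eq_sum hA hu, Complex.ofReal_sum]
  refine Finset.sum_congr rfl fun x _ => ?_
  have h1 : matrixElement T x x = ((matrixElement T x x).re : ℂ) :=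
    Complex.ext rfl (by simp [matrixElement_self_im hT x])
  have h2 := matrixElement_self_re_nonneg hT x
  rw [h1, Complex.ofReal_re, ← Complex.ofReal_mul]
  congr 1
  rw [ENNReal.toReal_mul, ENNReal.toReal_mul, ENNReal.toReal_ofReal h2, ENNReal.toReal_ofReal',
    ENNReal.toReal_ofReal']
  rcases le_total 0 (u x) with h | h
  · rw [max_eq_left h, max_eq_right (by linarith)]
    ring
  · rw [max_eq_right h, max_eq_left (by linarith)]
    ring

lemma tendsto_weightedTrace {u : X → ℝ} (hA : IsUniformlyDiscrete A) (hu : HasCompactSupport u)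
    {T : ℕ → EllTwo A →L[ℂ] EllTwo A} {S : EllTwo A →L[ℂ] EllTwo A}
    (h : ∀ v, Tendsto (fun n => T n v) atTop (𝓝 (S v))) :
    Tendsto (fun n => weightedTrace u (T n)) atTop (𝓝 (weightedTrace u S)) := by
  simp_rw [weightedTrace_eq_sum hA hu]
  exact tendsto_finsetSum _ fun x _ => (tendsto_matrixElement h x x).const_mul _

end WeightedTrace

namespace Config

variable {X Y Γ : Type*} [MetricSpace X] [TopologicalSpace Y]
  {B : ℕ → Set X} {μ : Measure (Config X Y)}
  {T : ∀ ω : Config X Y, EllTwo ω.carrier →L[ℂ] EllTwo ω.carrier}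

lemma IsMeasurableFamily.aemeasurable_weightedTrace [MeasurableSpace X] [BorelSpace X]
    [Nonempty X] [CompactSpace Y] (hB : IsCellPartition B) (hT : IsMeasurableFamily B μ T)
    {u : X → ℝ} (hu : Measurable u) (huc : HasCompactSupport u) :
    AEMeasurable (fun ω => weightedTrace u (T ω)) μ := by
  classical
  refine aemeasurable_of_tendsto_metrizable_ae atTop
    (f := fun n ω => ∑ k ∈ Finset.range n,
      (u (point (B k) ω) : ℂ) * entry (B k) (B k) ω (T ω))
    (fun n => Finset.aemeasurable_fun_sum _ fun k _ => AEMeasurable.mul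
      (Complex.measurable_ofReal.comp (hu.comp (measurable_point (hB.small k)))).aemeasurable
      (hT k k)) (ae_of_all _ fun ω => ?_)
  refine HasSum.tendsto_sum_nat ?_
  have h1 : HasSum (fun x : ω.carrier => (u x : ℂ) * matrixElement (T ω) x x)
      (weightedTrace u (T ω)) := by
    rw [weightedTrace_eq_sum ω.uniformlyDiscrete huc]
    exact hasSum_sum_of_ne_finset_zero fun x hx => by
      simp [notMem_supportPoints ω.uniformlyDiscrete huc hx]
  convert (hasSum_cell_iff hB ω _ _).2 h1 using 2 with k
  unfold entry
  split_ifs with h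
  · rw [point_eq h]
  · rw [mul_zero]

/-- The diagonal matrix elements of a positive operator as weights. -/
def traceWeight (T : ∀ ω : Config X Y, EllTwo ω.carrier →L[ℂ] EllTwo ω.carrier) (ω : Config X Y)
    (x : ω.carrier) : ℝ≥0∞ := ENNReal.ofReal (matrixElement (T ω) x x).re

lemma IsMeasurableFamily.isMeasurableWeight (hT : IsMeasurableFamily B μ T) :
    IsMeasurableWeight B μ (traceWeight T) := fun i =>
  (Complex.measurable_re.comp_aemeasurable (hT i i)).ennreal_ofReal.congr
    (ae_of_all _ fun ω => by
      unfold cellWeight traceWeight entry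
      split_ifs with h <;> simp [h])

/-! ### Equivariant families of operators -/

section Equivariance

variable [Group Γ] [MulAction Γ X] [IsIsometricSMul Γ X] {s : Γ → X → ℂ}

/-- Conjugation with the unitary operator `ℓ²(A) → ℓ²(γ A)` induced by `γ` and the phases. -/
def shiftConj (hs : ∀ γ x, ‖s γ x‖ = 1) (γ : Γ) (ω : Config X Y) :
    (EllTwo ω.carrier →L[ℂ] EllTwo ω.carrier) ≃⋆ₐ[ℂ]
      (EllTwo (γ • ω).carrier →L[ℂ] EllTwo (γ • ω).carrier) :=
  (phaseEquiv (A' := (γ • ω).carrier) (Set.translateEquiv γ ω.carrier)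
    (fun x => conj (s γ x)) fun x => by rw [RCLike.norm_conj, hs]).conjStarAlgEquiv

/-- Equivariance of a family of operators, up to phases. -/
def IsEquivariantFamily (hs : ∀ γ x, ‖s γ x‖ = 1) (μ : Measure (Config X Y))
    (T : ∀ ω : Config X Y, EllTwo ω.carrier →L[ℂ] EllTwo ω.carrier) : Prop :=
  ∀ γ, ∀ᵐ ω ∂μ, T (γ • ω) = shiftConj hs γ ω (T ω)

variable {hs : ∀ γ x, ‖s γ x‖ = 1}

/-- The relation expresses `T ω` through `T (γ • ω)`; solving it for the latter puts the conjugate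
phases into `shiftConj`. -/
lemma isEquivariantFamily_of_matrixElement
    (h : ∀ γ, ∀ᵐ ω ∂μ, ∀ x y : ω.carrier, s γ x * matrixElement (T (γ • ω)) (ω.translate γ x)
      (ω.translate γ y) * conj (s γ y) = matrixElement (T ω) x y) :
    IsEquivariantFamily hs μ T := by
  intro γ
  filter_upwards [h γ] with ω hω
  refine operator_ext fun x y => ?_
  obtain ⟨x, rfl⟩ := (Set.translateEquiv γ ω.carrier).surjective x
  obtain ⟨y, rfl⟩ := (Set.translateEquiv γ ω.carrier).surjective y
  unfold shiftConj
  refine Eq.trans ?_ (matrixElement_conj (A' := (γ • ω).carrier) _ _ _ (T ω) x y).symm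
  rw [← hω x y, Complex.conj_conj]
  have hx := star_mul_self_of_norm_eq_one (hs γ x)
  have hy := star_mul_self_of_norm_eq_one (hs γ y)
  calc matrixElement (T (γ • ω)) (ω.translate γ x) (ω.translate γ y)
      = (conj (s γ x) * s γ x) * matrixElement (T (γ • ω)) (ω.translate γ x) (ω.translate γ y) *
        (conj (s γ y) * s γ y) := by rw [hx, hy, one_mul, mul_one]
    _ = _ := by ring

/-- The phases cancel on the diagonal. -/
lemma IsEquivariantFamily.isInvariantWeight (h : IsEquivariantFamily hs μ T) :
    IsInvariantWeight Γ μ (traceWeight T) := by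
  intro γ
  filter_upwards [h γ] with ω hω x
  unfold traceWeight
  rw [hω]
  exact congrArg (fun z : ℂ => ENNReal.ofReal z.re)
    (matrixElement_conj_self (A' := (γ • ω).carrier) (Set.translateEquiv γ ω.carrier) _ _ (T ω) x)

lemma IsEquivariantFamily.eigenProj (h : IsEquivariantFamily hs μ T) (lam : ℝ) :
    IsEquivariantFamily hs μ fun ω => eigenProj (T ω) lam := by
  intro γ
  filter_upwards [h γ] with ω hω
  rw [hω]
  exact eigenProj_conj (A' := (γ • ω).carrier) _ _ _ (T ω) lam

lemma IsEquivariantFamily.residualProj (h : IsEquivariantFamily hs μ T) (lam : ℝ) :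
    IsEquivariantFamily hs μ fun ω => residualProj (T ω) lam := by
  intro γ
  filter_upwards [h γ] with ω hω
  rw [hω]
  exact residualProj_conj (A' := (γ • ω).carrier) _ _ _ (T ω) lam

lemma IsEquivariantFamily.functionalCalculus (h : IsEquivariantFamily hs μ T)
    (hsa : ∀ᵐ ω ∂μ, IsSelfAdjoint (T ω)) {φ : ℝ → ℝ} (hφ : Continuous φ) :
    IsEquivariantFamily hs μ fun ω => functionalCalculus φ (T ω) := by
  intro γ
  filter_upwards [h γ, hsa] with ω hω h1
  rw [hω]
  exact functionalCalculus_conj _ h1 hφ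

/-- The families of positive operators to which the trace formula applies. -/
structure IsTraceFamily (B : ℕ → Set X) (hs : ∀ γ x, ‖s γ x‖ = 1) (μ : Measure (Config X Y))
    (T : ∀ ω : Config X Y, EllTwo ω.carrier →L[ℂ] EllTwo ω.carrier) : Prop where
  measurable : IsMeasurableFamily B μ T
  equivariant : IsEquivariantFamily hs μ T
  positive : ∀ᵐ ω ∂μ, (T ω).IsPositive
  bounded : ∃ M : ℝ, ∀ᵐ ω ∂μ, ‖T ω‖ ≤ M

end Equivariance

end Config

/-! ### The trace formula -/

namespace Config

section TraceFormula

variable {X Y Γ : Type*} [MetricSpace X] [SecondCountableTopology X]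
  [MeasurableSpace X] [BorelSpace X] [Nonempty X]
  [MetricSpace Γ] [ProperSpace Γ] [Group Γ] [IsTopologicalGroup Γ] [MeasurableSpace Γ]
  [BorelSpace Γ] {haarΓ : Measure Γ} [haarΓ.IsHaarMeasure] [haarΓ.IsMulRightInvariant]
  [haarΓ.IsInvInvariant] [MulAction Γ X] [ContinuousSMul Γ X] [IsIsometricSMul Γ X]
  {F : Set X} [TopologicalSpace Y] [CompactSpace Y] {B : ℕ → Set X}
  {μ : Measure (Config X Y)} [IsProbabilityMeasure μ] [SMulInvariantMeasure Γ (Config X Y) μ]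
  {s : Γ → X → ℂ} {hs : ∀ γ x, ‖s γ x‖ = 1}
  {T : ∀ ω : Config X Y, EllTwo ω.carrier →L[ℂ] EllTwo ω.carrier} {u : X → ℝ}

omit [SecondCountableTopology X] [BorelSpace X] [Nonempty X] [MetricSpace Γ] [ProperSpace Γ]
  [IsTopologicalGroup Γ] [BorelSpace Γ] [haarΓ.IsHaarMeasure] [haarΓ.IsMulRightInvariant]
  [haarΓ.IsInvInvariant] [ContinuousSMul Γ X] [IsIsometricSMul Γ X] [CompactSpace Y]
  [IsProbabilityMeasure μ] [SMulInvariantMeasure Γ (Config X Y) μ] in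
lemma integrable_abs_weight (hB : IsCellPartition B) [BorelSpace X] [Nonempty X] [CompactSpace Y]
    (hu : IsAdmissible haarΓ μ u) :
    Integrable (fun ω : Config X Y => (∑' x : ω.carrier, ENNReal.ofReal |u x|).toReal) μ := by
  have hm : AEMeasurable (fun ω : Config X Y => ∑' x : ω.carrier, ENNReal.ofReal |u x|) μ := by
    have h := (isMeasurableWeight_one (μ := μ) hB).aemeasurable_tsum hB
      (g := fun x => ENNReal.ofReal |u x|) hu.measurable.abs.ennreal_ofReal
    simpa using h
  exact integrable_toReal_of_lintegral_ne_top hm hu.integrable.ne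

omit [SecondCountableTopology X] [BorelSpace X] [Nonempty X] [MetricSpace Γ] [ProperSpace Γ]
  [IsTopologicalGroup Γ] [BorelSpace Γ] [haarΓ.IsHaarMeasure] [haarΓ.IsMulRightInvariant]
  [haarΓ.IsInvInvariant] [ContinuousSMul Γ X] [IsIsometricSMul Γ X] [CompactSpace Y]
  [IsProbabilityMeasure μ] [SMulInvariantMeasure Γ (Config X Y) μ] in
lemma integrable_weightedTrace [BorelSpace X] [Nonempty X] [CompactSpace Y]
    (hB : IsCellPartition B) (hT : IsMeasurableFamily B μ T)
    {M : ℝ} (hM : ∀ᵐ ω ∂μ, ‖T ω‖ ≤ M) (hu : IsAdmissible haarΓ μ u) :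
    Integrable (fun ω => weightedTrace u (T ω)) μ := by
  refine ((integrable_abs_weight hB hu).const_mul M).mono'
    (hT.aemeasurable_weightedTrace hB hu.measurable hu.hasCompactSupport).aestronglyMeasurable ?_
  filter_upwards [hM] with ω h
  exact norm_weightedTrace_le ω.uniformlyDiscrete hu.hasCompactSupport h

/-- The mean trace per unit volume of a family of positive operators. -/
def traceDensity (haarΓ : Measure Γ) (F : Set X) (B : ℕ → Set X) (μ : Measure (Config X Y))
    (T : ∀ ω : Config X Y, EllTwo ω.carrier →L[ℂ] EllTwo ω.carrier) : ℝ≥0∞ :=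
  unitDensity haarΓ F (campbell B μ (traceWeight T))

/-- The expectation of the trace does not depend on the weight `u`. -/
lemma integral_weightedTrace (hF : IsStrictFundamentalDomain Γ F) (hF_sigma : IsSigmaCompact F)
    (hB : IsCellPartition B) (hT : IsTraceFamily B hs μ T) (hu : IsAdmissible haarΓ μ u) :
    ∫ ω, weightedTrace u (T ω) ∂μ = ((traceDensity haarΓ F B μ T).toReal : ℂ) := by
  obtain ⟨M, hM⟩ := hT.bounded
  have hw := hT.measurable.isMeasurableWeight
  have : SMulInvariantMeasure Γ X (campbell B μ (traceWeight T)) :=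
    smulInvariantMeasure_campbell hB hw hT.equivariant.isInvariantWeight
  have hpm : Measurable fun x => ENNReal.ofReal (u x) := hu.measurable.ennreal_ofReal
  have hnm : Measurable fun x => ENNReal.ofReal (-u x) := hu.measurable.neg.ennreal_ofReal
  -- Boundedness of `T` together with ∫ |u| dm < ∞ makes both signed parts finite, so that they may
  -- be subtracted.
  have hfin : ∀ g : X → ℝ, (∀ x, g x ≤ |u x|) →
      ∫⁻ ω, ∑' x : ω.carrier, ENNReal.ofReal (g x) * traceWeight T ω x ∂μ ≠ ∞ := by
    intro g hg
    have h1 : ∫⁻ ω, ∑' x : ω.carrier, ENNReal.ofReal (g x) * traceWeight T ω x ∂μ ≤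
        ∫⁻ ω, ENNReal.ofReal M * ∑' x : ω.carrier, ENNReal.ofReal |u x| ∂μ := by
      refine lintegral_mono_ae ?_
      filter_upwards [hM] with ω h
      rw [← ENNReal.tsum_mul_left]
      refine ENNReal.tsum_le_tsum fun x => ?_
      rw [mul_comm]
      exact mul_le_mul' (ENNReal.ofReal_le_ofReal ((Complex.re_le_norm _).trans
        ((norm_matrixElement_le _ _ _).trans h))) (ENNReal.ofReal_le_ofReal (hg x))
    refine ne_top_of_le_ne_top ?_ h1
    rw [lintegral_const_mul' _ _ ENNReal.ofReal_ne_top]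
    exact ENNReal.mul_ne_top ENNReal.ofReal_ne_top hu.integrable.ne
  have hp := hfin u fun x => le_abs_self _
  have hn := hfin (fun x => -u x) fun x => neg_le_abs _
  have hpa := hw.aemeasurable_tsum hB hpm
  have hna := hw.aemeasurable_tsum hB hnm
  have key := lintegral_pos_part_eq hF haarΓ hF_sigma (campbell B μ (traceWeight T))
    hu.measurable hu.integral_eq_one
  rw [lintegral_campbell hB hw hpm, lintegral_campbell hB hw hnm] at key
  -- The density is a summand of the finite positive-part integral.
  have hdens : unitDensity haarΓ F (campbell B μ (traceWeight T)) ≠ ∞ := by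
    intro h
    rw [h, add_top] at key
    exact hp key
  have hint : ∫ ω, weightedTrace u (T ω) ∂μ =
      ∫ ω, (((∑' x : ω.carrier, ENNReal.ofReal (u x) * traceWeight T ω x).toReal -
        (∑' x : ω.carrier, ENNReal.ofReal (-u x) * traceWeight T ω x).toReal : ℝ) : ℂ) ∂μ := by
    refine integral_congr_ae ?_
    filter_upwards [hT.positive] with ω h
    exact weightedTrace_eq_sub ω.uniformlyDiscrete hu.hasCompactSupport h
  rw [hint, integral_complex_ofReal,
    integral_sub (integrable_toReal_of_lintegral_ne_top hpa hp)
      (integrable_toReal_of_lintegral_ne_top hna hn),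
    integral_toReal hpa (ae_lt_top' hpa hp), integral_toReal hna (ae_lt_top' hna hn), key,
    ENNReal.toReal_add hn hdens, add_sub_cancel_left]
  rfl

/-- Density zero makes the whole Campbell measure zero, and its total mass is the expectation of the
full trace, a sum of nonnegative diagonal terms. -/
lemma traceDensity_eq_zero_iff (hF : IsStrictFundamentalDomain Γ F)
    (hF_sigma : IsSigmaCompact F) (hB : IsCellPartition B) (hT : IsTraceFamily B hs μ T) :
    traceDensity haarΓ F B μ T = 0 ↔
      ∀ᵐ ω ∂μ, ∀ x : ω.carrier, matrixElement (T ω) x x = 0 := by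
  have hw := hT.measurable.isMeasurableWeight
  have : SMulInvariantMeasure Γ X (campbell B μ (traceWeight T)) :=
    smulInvariantMeasure_campbell hB hw hT.equivariant.isInvariantWeight
  have hmono := hw.aemeasurable_tsum hB (measurable_one (α := ℝ≥0∞) (β := X))
  constructor
  · intro h
    have h0 := measure_eq_zero_of_unitDensity hF haarΓ hF_sigma _ h
    have h1 := lintegral_campbell hB hw (measurable_one (α := ℝ≥0∞) (β := X))
    rw [h0, lintegral_zero_measure] at h1
    filter_upwards [(lintegral_eq_zero_iff' hmono).1 h1.symm, hT.positive] with ω h2 h3 x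
    have h4 := ENNReal.tsum_eq_zero.1 h2 x
    simp only [Pi.one_apply, one_mul, traceWeight, ENNReal.ofReal_eq_zero] at h4
    exact Complex.ext (le_antisymm h4 (matrixElement_self_re_nonneg h3 x))
      (matrixElement_self_im h3 x)
  · intro h
    have h1 := lintegral_campbell hB hw (measurable_one (α := ℝ≥0∞) (β := X))
    have h2 : ∫⁻ ω, ∑' x : ω.carrier, (1 : X → ℝ≥0∞) x * traceWeight T ω x ∂μ = 0 := by
      rw [lintegral_eq_zero_iff' hmono]
      filter_upwards [h] with ω hω
      simp [traceWeight, hω]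
    rw [h2] at h1
    simp only [Pi.one_apply, lintegral_const, one_mul] at h1
    have h3 := Measure.measure_univ_eq_zero.1 h1
    rw [traceDensity, h3, unitDensity]
    simp

lemma unitDensity_campbell_ne_top (hF : IsStrictFundamentalDomain Γ F)
    (hF_compact : IsCompact (closure F)) (hF_sigma : IsSigmaCompact F)
    (hB : IsCellPartition B) : unitDensity haarΓ F (campbell B μ fun _ _ => 1) ≠ ∞ := by
  refine (ENNReal.div_lt_top ?_ (haar_unitBall_ne_zero haarΓ)).ne
  rw [campbell_one_apply hB (measurableSet_smul_domain hF hF_sigma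
    Metric.isClosed_closedBall.measurableSet)]
  exact (intensity_lt_top ((isCompact_closedBall (1 : Γ) 1).smul_set hF_compact)
    (Set.smul_subset_smul_left subset_closure)).ne

end TraceFormula

end Config

/-! ### The residual projection has vanishing trace density -/

section Geometry

variable {X Γ : Type*} [MetricSpace X] [MetricSpace Γ] [Group Γ] [IsIsometricSMul Γ Γ]
  [MulAction Γ X] {F : Set X}

/-- The metric is left-invariant, so multiplying by a ball on the right is metric thickening. -/
lemma mem_mul_closedBall_iff {J : Set Γ} {r : ℝ} {g : Γ} :
    g ∈ J * Metric.closedBall 1 r ↔ ∃ j ∈ J, dist g j ≤ r := by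
  constructor
  · rintro ⟨j, hj, k, hk, rfl⟩
    refine ⟨j, hj, ?_⟩
    have := dist_smul j k 1
    simp only [smul_eq_mul, mul_one] at this
    change dist (j * k) j ≤ r
    rw [this]
    exact hk
  · rintro ⟨j, hj, h⟩
    refine ⟨j, hj, j⁻¹ * g, ?_, mul_inv_cancel_left j g⟩
    rw [Metric.mem_closedBall]
    have := dist_smul j⁻¹ g j
    simp only [smul_eq_mul, inv_mul_cancel] at this
    rwa [this]

omit [IsIsometricSMul Γ Γ] in
-- The lower rough isometry bound turns finite hopping range in X into finite range in Γ. The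
-- maximum with 0 keeps `r` nonnegative even for negative `R`.
lemma IsRoughIsometryOfDomain.exists_dist_domainMap_le (h : IsRoughIsometryOfDomain Γ F)
    (hF : IsStrictFundamentalDomain Γ F) (R : ℝ) :
    ∃ r : ℝ, 0 ≤ r ∧ ∀ x y : X, dist x y < R → dist (domainMap hF x) (domainMap hF y) ≤ r := by
  obtain ⟨a, b, ha, -, hab⟩ := h
  refine ⟨max 0 (a * (R + b)), le_max_left _ _, fun x y hxy => le_max_of_le_right ?_⟩
  have h1 := (hab x y _ _ (mem_domainMap_smul hF x) (mem_domainMap_smul hF y)).1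
  have h2 : 1 / a * dist (domainMap hF x) (domainMap hF y) ≤ R + b := by linarith
  have ha' : 0 < a := by linarith
  rwa [one_div, inv_mul_le_iff₀ ha'] at h2

/-- The `r`-boundary of `J` separates the thickened set from its complement. -/
lemma mem_thickening_iff {J : Set Γ} {r : ℝ} {g g' : Γ} (hr : 0 ≤ r) (h : dist g g' ≤ r)
    (hg' : g' ∉ (J * Metric.closedBall 1 r * Metric.closedBall 1 r) \ J) :
    g ∈ J * Metric.closedBall 1 r ↔ g' ∈ J * Metric.closedBall 1 r := by
  by_cases hJ : g' ∈ J
  · exact ⟨fun _ => mem_mul_closedBall_iff.2 ⟨g', hJ, by simpa using hr⟩,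
      fun _ => mem_mul_closedBall_iff.2 ⟨g', hJ, h⟩⟩
  · have hnot : g' ∉ J * Metric.closedBall 1 r * Metric.closedBall 1 r :=
      fun h' => hg' ⟨h', hJ⟩
    refine ⟨fun hg => absurd (mem_mul_closedBall_iff.2 ⟨g, hg, ?_⟩) hnot, fun hg =>
      absurd (mem_mul_closedBall_iff.2 ⟨g', hg, by simpa using hr⟩) hnot⟩
    rwa [dist_comm]

end Geometry

/-- Følner sets are almost invariant under left products, whereas thickening in a left-invariant
metric is a right product. Inverting the sets exchanges the two, and Haar measure is inversion
invariant. -/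
lemma IsAmenableGroup.exists_almost_invariant {Γ : Type*} [Group Γ] [TopologicalSpace Γ]
    [IsTopologicalGroup Γ] [MeasurableSpace Γ] [BorelSpace Γ] {haarΓ : Measure Γ}
    [haarΓ.IsInvInvariant] (h : IsAmenableGroup haarΓ) {K : Set Γ} (hK : IsCompact K)
    (hne : K.Nonempty) {ε : ℝ} (hε : 0 < ε) :
    ∃ J : Set Γ, IsCompact J ∧ haarΓ ((J * K) \ J) ≤ ENNReal.ofReal ε * haarΓ J ∧ haarΓ J ≠ 0 := by
  obtain ⟨I, hI, hfol⟩ := h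
  obtain ⟨n, hn⟩ := (hfol K⁻¹ hK.inv hne.inv ε hε).exists
  refine ⟨(I n)⁻¹, (hI n).1.inv, ?_, ?_⟩
  · have h1 : ((I n)⁻¹ * K) \ (I n)⁻¹ = ((K⁻¹ * I n) \ I n)⁻¹ := by
      change _ = (K⁻¹ * I n)⁻¹ \ (I n)⁻¹
      rw [mul_inv_rev, inv_inv]
    rw [h1, Measure.measure_inv, Measure.measure_inv]
    exact (measure_mono subset_union_right).trans hn.le
  · rw [Measure.measure_inv]
    -- The Følner inequality is strict, so a null Følner set would give a measure below 0.
    intro h0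
    rw [h0, mul_zero] at hn
    exact not_lt_zero hn

namespace Config

variable {X Y Γ : Type*} [MetricSpace X] [SecondCountableTopology X]
  [MeasurableSpace X] [BorelSpace X] [Nonempty X]
  [MetricSpace Γ] [ProperSpace Γ] [Group Γ] [IsTopologicalGroup Γ] [IsIsometricSMul Γ Γ]
  [MeasurableSpace Γ]
  [BorelSpace Γ] {haarΓ : Measure Γ} [haarΓ.IsHaarMeasure] [haarΓ.IsMulRightInvariant]
  [haarΓ.IsInvInvariant] [MulAction Γ X] [ContinuousSMul Γ X] [IsIsometricSMul Γ X]
  {F : Set X} [TopologicalSpace Y] [CompactSpace Y] {B : ℕ → Set X}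
  {μ : Measure (Config X Y)} [IsProbabilityMeasure μ] [SMulInvariantMeasure Γ (Config X Y) μ]
  {s : Γ → X → ℂ} {hs : ∀ γ x, ‖s γ x‖ = 1}
  {T : ∀ ω : Config X Y, EllTwo ω.carrier →L[ℂ] EllTwo ω.carrier}

omit [SecondCountableTopology X] [MeasurableSpace X] [BorelSpace X] [Nonempty X]
  [MeasurableSpace Γ] [BorelSpace Γ] [IsIsometricSMul Γ X]
  [TopologicalSpace Y] [CompactSpace Y] in
/-- The trace of the residual projection over a thickened set is bounded by the number of points
in its boundary. -/
lemma tsum_residualProj_le (hF : IsStrictFundamentalDomain Γ F) {r R : ℝ} (hr : 0 ≤ r)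
    (hrR : ∀ x y : X, dist x y < R → dist (domainMap hF x) (domainMap hF y) ≤ r)
    (lam : ℝ) (hF_compact : IsCompact (closure F)) {J : Set Γ}
    (hJ : IsCompact J) (ω : Config X Y)
    (hω : ∀ x y : ω.carrier, R ≤ dist (x : X) y → matrixElement (T ω) x y = 0) :
    ∑' x : ω.carrier, ((J * Metric.closedBall 1 r) • F).indicator (1 : X → ℝ≥0∞) (x : X) *
        traceWeight (fun ω => residualProj (T ω) lam) ω x ≤
      ∑' x : ω.carrier, (((J * Metric.closedBall 1 r * Metric.closedBall 1 r) \ J) • F).indicator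
        (1 : X → ℝ≥0∞) (x : X) * 1 := by
  classical
  have hfin : ∀ {L : Set Γ} {L' : Set Γ}, IsCompact L' → L ⊆ L' →
      {x : ω.carrier | (x : X) ∈ L • F}.Finite := by
    intro L L' hL' hLL'
    refine ((ω.uniformlyDiscrete.finite_inter (hL'.smul_set hF_compact)).preimage
      Subtype.val_injective.injOn).subset fun x hx => ⟨?_, x.2⟩
    exact Set.smul_subset_smul hLL' subset_closure hx
  have hball := isCompact_closedBall (1 : Γ) r
  have hS := hfin (hJ.mul hball) subset_rfl
  have hBd := hfin ((hJ.mul hball).mul hball) (sdiff_subset (t := J))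
  set S := hS.toFinset
  set Bd := hBd.toFinset
  have hSm : ∀ x, x ∈ S ↔ domainMap hF (x : X) ∈ J * Metric.closedBall 1 r := fun x => by
    rw [Set.Finite.mem_toFinset, ← mem_preimage, domainMap_preimage]
    rfl
  have hBm : ∀ x, x ∈ Bd ↔ domainMap hF (x : X) ∈
      (J * Metric.closedBall 1 r * Metric.closedBall 1 r) \ J := fun x => by
    rw [Set.Finite.mem_toFinset, ← mem_preimage (s := (J * Metric.closedBall 1 r *
      Metric.closedBall 1 r) \ J), domainMap_preimage]
    rfl
  -- Points linked by `T` are closer than `R`, so their images in Γ are within `r`, and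
  -- `mem_thickening_iff` shows that `Bd` separates `S` from its complement.
  have hbound := sum_starProjection_le_card (residualSpace (T ω) lam) S Bd
    (residualSpace_eq_zero_of_boundary (T ω) lam S Bd fun x y hT hy => by
      rw [hSm, hSm]
      refine mem_thickening_iff hr (hrR x y ?_) fun h => hy ((hBm y).2 h)
      by_contra h
      exact hT (hω x y (not_lt.1 h)))
  have hleft : ∑' x : ω.carrier, ((J * Metric.closedBall 1 r) • F).indicator (1 : X → ℝ≥0∞)
      (x : X) * traceWeight (fun ω => residualProj (T ω) lam) ω x =
      ∑ x ∈ S, ENNReal.ofReal (‖(residualSpace (T ω) lam).starProjection (unitVector x)‖ ^ 2) := by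
    rw [tsum_eq_sum (s := S) fun x hx => ?_]
    · refine Finset.sum_congr rfl fun x hx => ?_
      have hx' : (x : X) ∈ (J * Metric.closedBall 1 r) • F := (Set.Finite.mem_toFinset hS).1 hx
      rw [indicator_of_mem hx', Pi.one_apply, one_mul, traceWeight]
      unfold residualProj
      rw [matrixElement_starProjection_self, Complex.ofReal_re]
    · have hx' : (x : X) ∉ (J * Metric.closedBall 1 r) • F := fun h =>
        hx ((Set.Finite.mem_toFinset hS).2 h)
      rw [indicator_of_notMem hx', zero_mul]
  have hright : ∑' x : ω.carrier, (((J * Metric.closedBall 1 r * Metric.closedBall 1 r) \ J) •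
      F).indicator (1 : X → ℝ≥0∞) (x : X) * 1 = Bd.card := by
    rw [tsum_eq_sum (s := Bd) fun x hx => ?_]
    · rw [Finset.card_eq_sum_ones, Nat.cast_sum]
      refine Finset.sum_congr rfl fun x hx => ?_
      have hx' : (x : X) ∈ ((J * Metric.closedBall 1 r * Metric.closedBall 1 r) \ J) • F :=
        (Set.Finite.mem_toFinset hBd).1 hx
      rw [indicator_of_mem hx']
      simp
    · have hx' : (x : X) ∉ ((J * Metric.closedBall 1 r * Metric.closedBall 1 r) \ J) • F :=
        fun h => hx ((Set.Finite.mem_toFinset hBd).2 h)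
      rw [indicator_of_notMem hx', zero_mul]
  rw [hleft, hright, ← ENNReal.ofReal_sum_of_nonneg fun _ _ => sq_nonneg _]
  exact (ENNReal.ofReal_le_ofReal hbound).trans (by rw [ENNReal.ofReal_natCast])

/-- The solutions that are orthogonal to all compactly supported solutions have density zero. -/
lemma traceDensity_residualProj (hF : IsStrictFundamentalDomain Γ F)
    (hF_compact : IsCompact (closure F)) (hF_sigma : IsSigmaCompact F)
    (hF_rough : IsRoughIsometryOfDomain Γ F) (amenable : IsAmenableGroup haarΓ)
    (hB : IsCellPartition B) {lam : ℝ}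
    (hT : IsTraceFamily B hs μ fun ω => residualProj (T ω) lam) {R : ℝ}
    (hR : ∀ᵐ ω ∂μ, ∀ x y : ω.carrier, R ≤ dist (x : X) y → matrixElement (T ω) x y = 0) :
    traceDensity haarΓ F B μ (fun ω => residualProj (T ω) lam) = 0 := by
  obtain ⟨r, hr, hrR⟩ := hF_rough.exists_dist_domainMap_le hF R
  have hw := hT.measurable.isMeasurableWeight
  set m := campbell B μ (traceWeight fun ω => residualProj (T ω) lam)
  set m₁ : Measure X := campbell B μ fun _ _ => 1
  have hw₁ := isMeasurableWeight_one (μ := μ) hB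
  have : SMulInvariantMeasure Γ X m :=
    smulInvariantMeasure_campbell hB hw hT.equivariant.isInvariantWeight
  have : SMulInvariantMeasure Γ X m₁ :=
    smulInvariantMeasure_campbell hB hw₁ fun γ => ae_of_all _ fun ω x => rfl
  have hball := isCompact_closedBall (1 : Γ) r
  have hball_ne : (Metric.closedBall (1 : Γ) r).Nonempty := ⟨1, by simpa using hr⟩
  have hD : unitDensity haarΓ F m₁ ≠ ∞ :=
    unitDensity_campbell_ne_top hF hF_compact hF_sigma hB
  have hle : ∀ ε : ℝ, 0 < ε →
      unitDensity haarΓ F m ≤ ENNReal.ofReal ε * unitDensity haarΓ F m₁ := by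
    intro ε hε
    -- The separating layer reaches two thickenings beyond J, so almost invariance is needed for the
    -- product of two balls.
    obtain ⟨J, hJ, hJε, hJ0⟩ := amenable.exists_almost_invariant (hball.mul hball)
      (hball_ne.mul hball_ne) hε
    rw [← mul_assoc] at hJε
    have hJm : MeasurableSet J := hJ.measurableSet
    have hSm : MeasurableSet (J * Metric.closedBall 1 r) := (hJ.mul hball).measurableSet
    have hBm : MeasurableSet ((J * Metric.closedBall 1 r * Metric.closedBall 1 r) \ J) :=
      ((hJ.mul hball).mul hball).measurableSet.diff hJm
    have hsub : J ⊆ J * Metric.closedBall 1 r := fun g hg =>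
      mem_mul_closedBall_iff.2 ⟨g, hg, by simpa using hr⟩
    have h1 : m ((J * Metric.closedBall 1 r) • F) ≤
        m₁ (((J * Metric.closedBall 1 r * Metric.closedBall 1 r) \ J) • F) := by
      rw [campbell_apply hB hw (measurableSet_smul_domain hF hF_sigma hSm),
        campbell_apply hB hw₁ (measurableSet_smul_domain hF hF_sigma hBm)]
      refine lintegral_mono_ae ?_
      filter_upwards [hR] with ω hω
      exact tsum_residualProj_le hF hr hrR lam hF_compact hJ ω hω
    rw [measure_smul_domain hF haarΓ hF_sigma m hSm,
      measure_smul_domain hF haarΓ hF_sigma m₁ hBm] at h1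
    -- Volume times density bounds the trace from below on the thickened set and counts the points
    -- of the layer; the factor |J|, positive and finite, cancels.
    have h2 : haarΓ J * unitDensity haarΓ F m ≤
        haarΓ J * (ENNReal.ofReal ε * unitDensity haarΓ F m₁) :=
      calc haarΓ J * unitDensity haarΓ F m
          ≤ haarΓ (J * Metric.closedBall 1 r) * unitDensity haarΓ F m := by gcongr
        _ ≤ _ := h1
        _ ≤ (ENNReal.ofReal ε * haarΓ J) * unitDensity haarΓ F m₁ := by gcongr
        _ = _ := by ring
    exact (ENNReal.mul_le_mul_iff_right hJ0 hJ.measure_lt_top.ne).1 h2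
  change unitDensity haarΓ F m = 0
  refine le_antisymm ?_ zero_le
  have hlim : Tendsto (fun n : ℕ => ENNReal.ofReal (1 / ((n : ℝ) + 1)) * unitDensity haarΓ F m₁)
      atTop (𝓝 0) := by
    have h1 := (ENNReal.continuous_ofReal.tendsto 0).comp
      (tendsto_one_div_add_atTop_nhds_zero_nat (𝕜 := ℝ))
    have h2 := ENNReal.Tendsto.mul_const h1 (Or.inr hD)
    simpa using h2
  exact ge_of_tendsto' hlim fun n => hle _ (by positivity)

end Config

/-! ### Atoms of measures on the line -/

section Line

/-- The function is right-continuous by continuity of ν from above, and its left limit is ν(-∞, lam)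
by continuity from below; the jump is the mass of the point. -/
lemma continuousAt_distributionFunction_iff (ν : Measure ℝ) [IsFiniteMeasure ν] (lam : ℝ) :
    ContinuousAt (distributionFunction ν) lam ↔ ν {lam} = 0 := by
  have hmono : Monotone (distributionFunction ν) := fun s t hst =>
    ENNReal.toReal_mono (measure_ne_top ν _) (measure_mono (Iic_subset_Iic.2 hst))
  have hright : ContinuousWithinAt (distributionFunction ν) (Ici lam) lam :=
    continuousWithinAt_Ioi_iff_Ici.1 <| by
      refine (ENNReal.tendsto_toReal (measure_ne_top ν _)).comp ?_
      have h : Iic lam = ⋂ t > lam, Iic t := by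
        ext x
        simp only [mem_Iic, mem_iInter]
        exact forall_gt_imp_ge_iff_le_of_dense.symm
      rw [h]
      exact tendsto_measure_biInter_gt (fun t _ => measurableSet_Iic.nullMeasurableSet)
        (fun s t _ hst => Iic_subset_Iic.2 hst) ⟨lam + 1, by simp, measure_ne_top ν _⟩
  have hleft : Tendsto (distributionFunction ν) (𝓝[<] lam) (𝓝 (ν (Iio lam)).toReal) := by
    refine (ENNReal.tendsto_toReal (measure_ne_top ν _)).comp ?_
    have h : Iio lam = ⋃ t : Iio lam, Iic (t : ℝ) := by
      ext x
      simp only [mem_Iio, mem_iUnion, mem_Iic, Subtype.exists, exists_prop]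
      exact ⟨fun hx => ⟨x, hx, le_rfl⟩, fun ⟨t, ht, hx⟩ => hx.trans_lt ht⟩
    have hm : Monotone fun t => ν (Iic t) := fun s t hst => measure_mono (Iic_subset_Iic.2 hst)
    have h1 : ν (Iio lam) = ⨆ t : Iio lam, ν (Iic (t : ℝ)) := (congrArg ν h).trans <|
      Monotone.measure_iUnion (s := fun t : Iio lam => Iic (t : ℝ))
        fun s t hst => Iic_subset_Iic.2 hst
    have h2 := hm.tendsto_nhdsLT lam
    rwa [sSup_image', ← h1] at h2
  have hsplit : ν (Iic lam) = ν (Iio lam) + ν {lam} := by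
    rw [← Iio_union_right, measure_union (by simp) (measurableSet_singleton lam)]
  have hkey : (ν (Iio lam)).toReal = distributionFunction ν lam ↔ ν {lam} = 0 := by
    rw [distributionFunction, hsplit, ENNReal.toReal_add (measure_ne_top ν _) (measure_ne_top ν _),
      left_eq_add, ENNReal.toReal_eq_zero_iff, or_iff_left (measure_ne_top ν _)]
  rw [← hkey]
  constructor
  · intro h
    exact tendsto_nhds_unique hleft (h.tendsto.mono_left nhdsWithin_le_nhds)
  · intro h
    refine continuousAt_iff_continuous_left'_right'.2
      ⟨?_, continuousWithinAt_Ioi_iff_Ici.2 hright⟩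
    change Tendsto _ _ _
    rwa [h] at hleft

/-- Truncated powers that concentrate at `lam`. -/
def bump (lam M : ℝ) (n : ℕ) (t : ℝ) : ℝ := max 0 (1 - (M⁻¹ * (t - lam)) ^ 2) ^ (n + 1)

variable {lam M : ℝ}

lemma continuous_bump (n : ℕ) : Continuous (bump lam M n) := by
  unfold bump
  fun_prop

lemma bump_mem_Icc (n : ℕ) (t : ℝ) : bump lam M n t ∈ Icc (0 : ℝ) 1 :=
  ⟨by unfold bump; positivity, pow_le_one₀ (le_max_left _ _)
    (max_le zero_le_one (sub_le_self _ (sq_nonneg _)))⟩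

lemma sq_inv_mul_le_one_iff (hM : 0 < M) (t : ℝ) :
    (M⁻¹ * (t - lam)) ^ 2 ≤ 1 ↔ |t - lam| ≤ M := by
  rw [sq_le_one_iff_abs_le_one, abs_mul, abs_of_pos (inv_pos.2 hM), inv_mul_le_iff₀ hM, mul_one]

lemma bump_eq (hM : 0 < M) (n : ℕ) {t : ℝ} (ht : |t - lam| ≤ M) :
    bump lam M n t = (1 - (M⁻¹ * (t - lam)) ^ 2) ^ (n + 1) := by
  unfold bump
  rw [max_eq_right (sub_nonneg.2 ((sq_inv_mul_le_one_iff hM t).2 ht))]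

/-- The truncated base vanishes beyond distance M from `lam`, and the exponent n + 1 in `bump`
excludes 0^0 = 1, which would spoil the case n = 0. -/
lemma hasCompactSupport_bump (hM : 0 < M) (n : ℕ) : HasCompactSupport (bump lam M n) := by
  refine HasCompactSupport.intro (isCompact_closedBall lam M) fun t ht => ?_
  rw [Metric.mem_closedBall, Real.dist_eq, ← sq_inv_mul_le_one_iff hM, not_le] at ht
  unfold bump
  rw [max_eq_left (by linarith), zero_pow (Nat.succ_ne_zero n)]

lemma tendsto_bump (hM : 0 < M) (t : ℝ) :
    Tendsto (fun n => bump lam M n t) atTop (𝓝 (({lam} : Set ℝ).indicator 1 t)) := by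
  by_cases ht : t = lam
  · subst ht
    simp [bump]
  · rw [indicator_of_notMem (by simpa using ht)]
    have h1 : 0 < (M⁻¹ * (t - lam)) ^ 2 :=
      sq_pos_of_ne_zero (mul_ne_zero (inv_ne_zero hM.ne') (sub_ne_zero.2 ht))
    exact (tendsto_pow_atTop_nhds_zero_of_lt_one (le_max_left _ _)
      (max_lt zero_lt_one (sub_lt_self _ h1))).comp (tendsto_add_atTop_nat 1)

lemma tendsto_integral_bump (ν : Measure ℝ) [IsFiniteMeasure ν] (hM : 0 < M) :
    Tendsto (fun n => ∫ t, bump lam M n t ∂ν) atTop (𝓝 (ν {lam}).toReal) := by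
  have h : (ν {lam}).toReal = ∫ t, ({lam} : Set ℝ).indicator 1 t ∂ν := by
    rw [integral_indicator_one (measurableSet_singleton lam)]
    rfl
  rw [h]
  refine tendsto_integral_of_dominated_convergence (fun _ => 1)
    (fun n => (continuous_bump n).aestronglyMeasurable) (integrable_const _)
    (fun n => ae_of_all _ fun t => ?_) (ae_of_all _ fun t => tendsto_bump hM t)
  rw [Real.norm_of_nonneg (bump_mem_Icc n t).1]
  exact (bump_mem_Icc n t).2

/-- A locally finite measure is finite if its integrals only see a bounded interval. -/
lemma isFiniteMeasure_of_integral_eq_zero (ν : Measure ℝ) [IsLocallyFiniteMeasure ν] (C : ℝ)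
    (h : ∀ φ : C_c(ℝ, ℝ), (∀ t ∈ Icc (-C) C, φ t = 0) → ∫ t, φ t ∂ν = 0) :
    IsFiniteMeasure ν := by
  have hn : ∀ n : ℕ, ν {t | C < |t| ∧ |t| < n} = 0 := by
    intro n
    -- This test function is positive exactly where C < |t| < n, so a zero integral makes that set
    -- null.
    have hc : Continuous fun t : ℝ => max 0 (min (|t| - C) (n - |t|)) := by fun_prop
    let φ : C_c(ℝ, ℝ) := ⟨⟨_, hc⟩, HasCompactSupport.intro (isCompact_closedBall 0 (n : ℝ))
      fun t ht => by
        rw [Metric.mem_closedBall, dist_zero_right, Real.norm_eq_abs, not_le] at ht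
        exact max_eq_left ((min_le_right _ _).trans (by linarith))⟩
    have hφ := h φ fun t ht =>
      max_eq_left ((min_le_left _ _).trans (by linarith [abs_le.2 ht]))
    rw [integral_eq_zero_iff_of_nonneg (f := φ) (fun t => le_max_left _ _) φ.integrable] at hφ
    refine measure_mono_null (fun t ht => ?_) hφ
    change max 0 (min (|t| - C) (n - |t|)) ≠ 0
    have : 0 < min (|t| - C) (n - |t|) := lt_min (by linarith [ht.1]) (by linarith [ht.2])
    rw [max_eq_right this.le]
    exact this.ne'
  refine ⟨?_⟩
  have hU : (univ : Set ℝ) ⊆ Icc (-C) C ∪ ⋃ n : ℕ, {t | C < |t| ∧ |t| < n} := by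
    intro t _
    by_cases ht : |t| ≤ C
    · exact Or.inl (abs_le.1 ht)
    · obtain ⟨n, hn⟩ := exists_nat_gt |t|
      exact Or.inr (mem_iUnion.2 ⟨n, not_le.1 ht, hn⟩)
  calc ν univ ≤ ν (Icc (-C) C) + ν (⋃ n : ℕ, {t | C < |t| ∧ |t| < n}) :=
        (measure_mono hU).trans (measure_union_le _ _)
    _ = ν (Icc (-C) C) := by rw [measure_iUnion_null hn, add_zero]
    _ < ∞ := isCompact_Icc.measure_lt_top

end Line

/-! ### The density of states measure -/

namespace Config

variable {X Y Γ : Type*} [MetricSpace X] [SecondCountableTopology X]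
  [MeasurableSpace X] [BorelSpace X] [Nonempty X]
  [MetricSpace Γ] [ProperSpace Γ] [Group Γ] [IsTopologicalGroup Γ]
  [MeasurableSpace Γ] [BorelSpace Γ] {haarΓ : Measure Γ} [haarΓ.IsHaarMeasure]
  [haarΓ.IsMulRightInvariant] [haarΓ.IsInvInvariant] [MulAction Γ X] [ContinuousSMul Γ X]
  [IsIsometricSMul Γ X] {F : Set X} [TopologicalSpace Y] [CompactSpace Y] {B : ℕ → Set X}
  {μ : Measure (Config X Y)} [IsProbabilityMeasure μ]
  {s : Γ → X → ℂ} {hs : ∀ γ x, ‖s γ x‖ = 1} {u : X → ℝ}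
  {H T : ∀ ω : Config X Y, EllTwo ω.carrier →L[ℂ] EllTwo ω.carrier} {C : ℝ}

/-- The equivariant measurable families of uniformly bounded selfadjoint operators. -/
structure IsSelfAdjointFamily (B : ℕ → Set X) (hs : ∀ γ x, ‖s γ x‖ = 1)
    (μ : Measure (Config X Y))
    (H : ∀ ω : Config X Y, EllTwo ω.carrier →L[ℂ] EllTwo ω.carrier) (C : ℝ) : Prop where
  measurable : IsMeasurableFamily B μ H
  equivariant : IsEquivariantFamily hs μ H
  selfAdjoint : ∀ᵐ ω ∂μ, IsSelfAdjoint (H ω)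
  norm_le : ∀ᵐ ω ∂μ, ‖H ω‖ ≤ C

namespace IsSelfAdjointFamily

lemma functionalCalculus (hH : IsSelfAdjointFamily B hs μ H C) (hB : IsCellPartition B)
    {φ : ℝ → ℝ} (hφ : Continuous φ) (h0 : ∀ t, 0 ≤ φ t) {K : ℝ} (hK : ∀ t, |φ t| ≤ K) :
    IsTraceFamily B hs μ fun ω => functionalCalculus φ (H ω) where
  measurable := hH.measurable.functionalCalculus hB hH.selfAdjoint hH.norm_le hφ
  equivariant := hH.equivariant.functionalCalculus hH.selfAdjoint hφ
  positive := ae_of_all _ fun _ => functionalCalculus_isPositive h0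
  bounded := ⟨K, ae_of_all _ fun _ =>
    norm_functionalCalculus_le ((abs_nonneg _).trans (hK 0)) hK⟩

lemma eigenProj (hH : IsSelfAdjointFamily B hs μ H C) (hB : IsCellPartition B) (lam : ℝ) :
    IsTraceFamily B hs μ fun ω => eigenProj (H ω) lam where
  measurable := hH.measurable.eigenProj hB hH.selfAdjoint hH.norm_le lam
  equivariant := hH.equivariant.eigenProj lam
  positive := ae_of_all _ fun _ => kerProj_isPositive _
  bounded := ⟨1, ae_of_all _ fun _ => norm_kerProj_le _⟩

lemma residualProj (hH : IsSelfAdjointFamily B hs μ H C) (hB : IsCellPartition B) (lam : ℝ) :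
    IsTraceFamily B hs μ fun ω => residualProj (H ω) lam where
  measurable := hH.measurable.residualProj hB hH.selfAdjoint hH.norm_le lam
  equivariant := hH.equivariant.residualProj lam
  positive := ae_of_all _ fun _ =>
    ContinuousLinearMap.IsPositive.of_isStarProjection isStarProjection_starProjection
  bounded := ⟨1, ae_of_all _ fun _ => Submodule.starProjection_norm_le _⟩

end IsSelfAdjointFamily

lemma traceDensity_ne_top (hF : IsStrictFundamentalDomain Γ F)
    (hF_compact : IsCompact (closure F)) (hF_sigma : IsSigmaCompact F)
    (hB : IsCellPartition B) (hT : IsTraceFamily B hs μ T) :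
    traceDensity haarΓ F B μ T ≠ ∞ := by
  obtain ⟨M, hM⟩ := hT.bounded
  have hmeas : MeasurableSet (Metric.closedBall (1 : Γ) 1 • F) :=
    measurableSet_smul_domain hF hF_sigma Metric.isClosed_closedBall.measurableSet
  refine (ENNReal.div_lt_top ?_ (haar_unitBall_ne_zero haarΓ)).ne
  rw [campbell_apply hB hT.measurable.isMeasurableWeight hmeas]
  have hle : ∫⁻ ω, ∑' x : ω.carrier, (Metric.closedBall (1 : Γ) 1 • F).indicator 1 (x : X) *
      traceWeight T ω x ∂μ ≤ ∫⁻ ω, ENNReal.ofReal M * ∑' x : ω.carrier,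
        (Metric.closedBall (1 : Γ) 1 • F).indicator 1 (x : X) ∂μ := by
    refine lintegral_mono_ae ?_
    filter_upwards [hM] with ω h
    rw [← ENNReal.tsum_mul_left]
    refine ENNReal.tsum_le_tsum fun x => ?_
    rw [mul_comm]
    exact mul_le_mul_left (ENNReal.ofReal_le_ofReal ((Complex.re_le_norm _).trans
      ((norm_matrixElement_le _ _ _).trans h))) _
  refine ne_top_of_le_ne_top ?_ hle
  rw [lintegral_const_mul' _ _ ENNReal.ofReal_ne_top]
  simp_rw [tsum_indicator_eq_encard]
  exact ENNReal.mul_ne_top ENNReal.ofReal_ne_top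
    (intensity_lt_top ((isCompact_closedBall (1 : Γ) 1).smul_set hF_compact)
      (Set.smul_subset_smul_left subset_closure)).ne

variable [SMulInvariantMeasure Γ (Config X Y) μ]

lemma meanDensity_pos [LocallyCompactSpace X] (hF : IsStrictFundamentalDomain Γ F)
    (hF_compact : IsCompact (closure F)) (hF_sigma : IsSigmaCompact F) (hB : IsCellPartition B)
    (h : ∃ ω ∈ μ.support, ω.carrier.Nonempty) : 0 < meanDensity haarΓ F μ := by
  have hw := isMeasurableWeight_one (μ := μ) hB
  have : SMulInvariantMeasure Γ X (campbell B μ fun _ _ => 1) :=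
    smulInvariantMeasure_campbell hB hw fun γ => ae_of_all _ fun ω x => rfl
  have h1 : meanDensity haarΓ F μ = (unitDensity haarΓ F (campbell B μ fun _ _ => 1)).toReal := by
    rw [unitDensity, campbell_one_apply hB (measurableSet_smul_domain hF hF_sigma
      Metric.isClosed_closedBall.measurableSet)]
    rfl
  rw [h1]
  refine ENNReal.toReal_pos (fun h0 => campbell_one_ne_zero hB h ?_)
    (unitDensity_campbell_ne_top hF hF_compact hF_sigma hB)
  exact measure_eq_zero_of_unitDensity hF haarΓ hF_sigma _ h0

/-- The expectation of the trace of a function of the operators. -/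
def meanTrace (μ : Measure (Config X Y))
    (H : ∀ ω : Config X Y, EllTwo ω.carrier →L[ℂ] EllTwo ω.carrier) (u : X → ℝ)
    (φ : ℝ → ℝ) : ℂ :=
  ∫ ω, weightedTrace u (_root_.functionalCalculus φ (H ω)) ∂μ

lemma exists_abs_le (φ : C_c(ℝ, ℝ)) : ∃ K, ∀ t, |φ t| ≤ K :=
  φ.hasCompactSupport.exists_bound_of_continuous φ.continuous

omit [SMulInvariantMeasure Γ (Config X Y) μ] [IsTopologicalGroup Γ] in
lemma integrable_functionalCalculus (hH : IsSelfAdjointFamily B hs μ H C)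
    (hB : IsCellPartition B) (hu : IsAdmissible haarΓ μ u) {φ : ℝ → ℝ} (hφ : Continuous φ)
    {K : ℝ} (hK : ∀ t, |φ t| ≤ K) :
    Integrable (fun ω => weightedTrace u (functionalCalculus φ (H ω))) μ :=
  integrable_weightedTrace hB (hH.measurable.functionalCalculus hB hH.selfAdjoint hH.norm_le hφ)
    (ae_of_all _ fun _ => norm_functionalCalculus_le ((abs_nonneg _).trans (hK 0)) hK) hu

lemma meanTrace_add (hH : IsSelfAdjointFamily B hs μ H C)
    (hB : IsCellPartition B) (hu : IsAdmissible haarΓ μ u) {φ ψ : ℝ → ℝ} (hφ : Continuous φ)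
    (hψ : Continuous ψ) {K L : ℝ} (hK : ∀ t, |φ t| ≤ K) (hL : ∀ t, |ψ t| ≤ L) :
    meanTrace μ H u (fun t => φ t + ψ t) = meanTrace μ H u φ + meanTrace μ H u ψ := by
  unfold meanTrace
  rw [← integral_add (integrable_functionalCalculus hH hB hu hφ hK)
    (integrable_functionalCalculus hH hB hu hψ hL)]
  refine integral_congr_ae (ae_of_all _ fun ω => ?_)
  change weightedTrace u _ = _
  rw [functionalCalculus_add _ hφ hψ,
    weightedTrace_add ω.uniformlyDiscrete hu.hasCompactSupport]

lemma meanTrace_smul (c : ℝ) {φ : ℝ → ℝ} (hφ : Continuous φ) :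
    meanTrace μ H u (fun t => c * φ t) = c * meanTrace μ H u φ := by
  unfold meanTrace
  rw [← integral_const_mul]
  refine integral_congr_ae (ae_of_all _ fun ω => ?_)
  change weightedTrace u _ = _
  rw [functionalCalculus_smul _ c hφ, weightedTrace_smul]

/-- `u` may change sign, so the integrand need not be nonnegative. Positivity of the expectation
comes from the trace formula, which identifies it with the density of a measure. -/
lemma meanTrace_of_nonneg (hF : IsStrictFundamentalDomain Γ F)
    (hF_sigma : IsSigmaCompact F) (hH : IsSelfAdjointFamily B hs μ H C)
    (hB : IsCellPartition B) (hu : IsAdmissible haarΓ μ u) {φ : ℝ → ℝ} (hφ : Continuous φ)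
    (h0 : ∀ t, 0 ≤ φ t) {K : ℝ} (hK : ∀ t, |φ t| ≤ K) :
    ∃ c : ℝ, 0 ≤ c ∧ meanTrace μ H u φ = c :=
  ⟨_, ENNReal.toReal_nonneg,
    integral_weightedTrace hF hF_sigma hB (hH.functionalCalculus hB hφ h0 hK) hu⟩

lemma meanTrace_eq_re (hF : IsStrictFundamentalDomain Γ F)
    (hF_sigma : IsSigmaCompact F) (hH : IsSelfAdjointFamily B hs μ H C)
    (hB : IsCellPartition B) (hu : IsAdmissible haarΓ μ u) {φ : ℝ → ℝ} (hφ : Continuous φ)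
    {K : ℝ} (hK : ∀ t, |φ t| ≤ K) :
    meanTrace μ H u φ = ((meanTrace μ H u φ).re : ℂ) := by
  have hp : Continuous fun t => max (φ t) 0 := by fun_prop
  have hn : Continuous fun t => max (-φ t) 0 := by fun_prop
  have hpK : ∀ t, |max (φ t) 0| ≤ K := fun t => by
    rw [abs_of_nonneg (le_max_right _ _)]
    exact max_le ((le_abs_self _).trans (hK t)) ((abs_nonneg _).trans (hK t))
  have hnK : ∀ t, |max (-φ t) 0| ≤ K := fun t => by
    rw [abs_of_nonneg (le_max_right _ _)]
    exact max_le ((neg_le_abs _).trans (hK t)) ((abs_nonneg _).trans (hK t))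
  obtain ⟨a, -, ha⟩ :=
    meanTrace_of_nonneg hF hF_sigma hH hB hu hp (fun t => le_max_right _ _) hpK
  obtain ⟨b, -, hb⟩ :=
    meanTrace_of_nonneg hF hF_sigma hH hB hu hn (fun t => le_max_right _ _) hnK
  have hsplit : (fun t => max (φ t) 0) = fun t => φ t + max (-φ t) 0 := by
    funext t
    rcases le_total 0 (φ t) with h | h
    · rw [max_eq_left h, max_eq_right (by linarith), add_zero]
    · rw [max_eq_right h, max_eq_left (by linarith), add_neg_cancel]
  rw [hsplit, meanTrace_add hH hB hu hφ hn hK hnK, hb] at ha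
  have h1 : meanTrace μ H u φ = ((a - b : ℝ) : ℂ) := by
    rw [Complex.ofReal_sub, ← ha, add_sub_cancel_right]
  rw [h1, Complex.ofReal_re]

/-- The mean trace is a positive linear functional on `C_c(ℝ, ℝ)`, represented by its Riesz measure;
locally finite measures on ℝ are determined by such integrals. -/
lemma existsUnique_isDensityOfStates
    (hF : IsStrictFundamentalDomain Γ F) (hF_sigma : IsSigmaCompact F)
    (hH : IsSelfAdjointFamily B hs μ H C) (hB : IsCellPartition B)
    (hu : IsAdmissible haarΓ μ u) (hdens : 0 < meanDensity haarΓ F μ) :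
    ∃! ν : Measure ℝ, IsDensityOfStates haarΓ F μ H u ν := by
  set D := meanDensity haarΓ F μ
  let L : C_c(ℝ, ℝ) →ₗ[ℝ] ℝ :=
    { toFun := fun φ => D⁻¹ * (meanTrace μ H u φ).re
      map_add' := fun φ ψ => by
        obtain ⟨K, hK⟩ := exists_abs_le φ
        obtain ⟨K', hK'⟩ := exists_abs_le ψ
        have h := meanTrace_add hH hB hu (map_continuous φ) (map_continuous ψ) hK hK'
        change D⁻¹ * (meanTrace μ H u fun t => φ t + ψ t).re = _
        rw [h, Complex.add_re, mul_add]
      map_smul' := fun c φ => by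
        change D⁻¹ * (meanTrace μ H u fun t => c * φ t).re = c * _
        rw [meanTrace_smul c (map_continuous φ), Complex.re_ofReal_mul]
        ring }
  let P : C_c(ℝ, ℝ) →ₚ[ℝ] ℝ := PositiveLinearMap.mk₀ L fun φ hφ => by
    obtain ⟨K, hK⟩ := exists_abs_le φ
    obtain ⟨c, hc, h⟩ :=
      meanTrace_of_nonneg hF hF_sigma hH hB hu (map_continuous φ) (fun t => hφ t) hK
    change 0 ≤ D⁻¹ * (meanTrace μ H u φ).re
    rw [h, Complex.ofReal_re]
    positivity
  refine ⟨RealRMK.rieszMeasure P, ⟨inferInstance, fun φ => ?_⟩, fun ν hν => ?_⟩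
  · obtain ⟨K, hK⟩ := exists_abs_le φ
    rw [RealRMK.integral_rieszMeasure]
    change ((D⁻¹ * (meanTrace μ H u φ).re : ℝ) : ℂ) = (D⁻¹ : ℝ) * meanTrace μ H u φ
    rw [Complex.ofReal_mul, ← meanTrace_eq_re hF hF_sigma hH hB hu (map_continuous φ) hK]
  · have := hν.locallyFinite
    refine Measure.ext_of_integral_eq_on_compactlySupported fun φ => ?_
    rw [RealRMK.integral_rieszMeasure]
    have h := congrArg Complex.re (hν.integral_eq φ)
    rwa [Complex.ofReal_re, Complex.re_ofReal_mul] at h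

/-- Almost every spectrum lies in [-C, C], so test functions that vanish there have integral zero.
Finiteness is what makes the distribution function meaningful as a real-valued function. -/
lemma _root_.IsDensityOfStates.isFiniteMeasure {ν : Measure ℝ}
    (hν : IsDensityOfStates haarΓ F μ H u ν) (hH : IsSelfAdjointFamily B hs μ H C) :
    IsFiniteMeasure ν := by
  have := hν.locallyFinite
  refine isFiniteMeasure_of_integral_eq_zero ν C fun φ hφ => ?_
  have h := hν.integral_eq φ
  have h0 : ∫ ω, weightedTrace u (_root_.functionalCalculus φ (H ω)) ∂μ = 0 := by
    rw [← integral_zero (Config X Y) ℂ (μ := μ)]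
    refine integral_congr_ae ?_
    filter_upwards [hH.norm_le] with ω hω
    have h1 : _root_.functionalCalculus φ (H ω) = (0 : ℂ) • _root_.functionalCalculus φ (H ω) := by
      rw [functionalCalculus_congr hω (φ := φ) (ψ := fun t => 0 * φ t)
        fun t ht => by rw [hφ t ht, zero_mul], functionalCalculus_smul _ 0 (map_continuous φ),
        Complex.ofReal_zero, zero_smul, smul_zero]
    rw [h1, weightedTrace_smul, zero_mul]
  rw [h0, mul_zero] at h
  exact_mod_cast h

/-- The spectrum lies within distance M of `lam`, where the truncation in `bump` is inactive, so
these operators are the polynomial powers converging to the kernel projection. -/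
lemma tendsto_functionalCalculus_bump {E : Type*} [NormedAddCommGroup E] [InnerProductSpace ℂ E]
    [CompleteSpace E] {S : E →L[ℂ] E} (hS : IsSelfAdjoint S) {lam M C : ℝ} (hM : 0 < M)
    (hC : ‖S‖ ≤ C) (hCM : C + |lam| ≤ M) (hn : ‖S - (lam : ℂ) • 1‖ ≤ M) (v : E) :
    Tendsto (fun n => _root_.functionalCalculus (bump lam M n) S v) atTop
      (𝓝 (kerProj (S - (lam : ℂ) • 1) v)) := by
  have h1 : ∀ n, _root_.functionalCalculus (bump lam M n) S =
      (1 - (((M⁻¹ : ℝ) : ℂ) • (S - (lam : ℂ) • 1)) ^ 2) ^ (n + 1) := fun n => by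
    rw [← functionalCalculus_one_sub_sq_pow hS]
    refine functionalCalculus_congr hC fun t ht => bump_eq hM n ?_
    exact (abs_sub _ _).trans (by linarith [abs_le.2 ht])
  simp_rw [h1]
  exact (tendsto_kerProj_of_norm_le
    (hS.sub (IsSelfAdjoint.smul (Complex.conj_ofReal lam) (IsSelfAdjoint.one _))) hM hn v).comp
      (tendsto_add_atTop_nat 1)

/-- The atoms of the density of states are the trace densities of the eigenprojections. -/
lemma _root_.IsDensityOfStates.measure_singleton {ν : Measure ℝ}
    (hν : IsDensityOfStates haarΓ F μ H u ν)
    (hF : IsStrictFundamentalDomain Γ F) (hF_sigma : IsSigmaCompact F)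
    (hH : IsSelfAdjointFamily B hs μ H C) (hB : IsCellPartition B)
    (hu : IsAdmissible haarΓ μ u) (lam : ℝ) :
    (ν {lam}).toReal = (meanDensity haarΓ F μ)⁻¹ *
      (traceDensity haarΓ F B μ fun ω => eigenProj (H ω) lam).toReal := by
  have := hν.isFiniteMeasure hH
  -- The absolute value of C and the summand 1 make M positive without knowledge of the sign of C.
  set M := |C| + |lam| + 1
  have hM : 0 < M := by positivity
  have hCM : C + |lam| ≤ M := by linarith [le_abs_self C]
  have h1 := (Complex.continuous_ofReal.tendsto _).comp (tendsto_integral_bump ν hM (lam := lam))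
  -- In the defining identity for the bumps the left side tends to the atom, and the right side to
  -- the expected trace of the eigenprojection, dominated by the sum of |u| over the configuration.
  have h2 : Tendsto (fun n => ∫ ω, weightedTrace u
      (_root_.functionalCalculus (bump lam M n) (H ω)) ∂μ) atTop
      (𝓝 (∫ ω, weightedTrace u (eigenProj (H ω) lam) ∂μ)) := by
    refine tendsto_integral_of_dominated_convergence
      (fun ω => 1 * (∑' x : ω.carrier, ENNReal.ofReal |u x|).toReal) (fun n => ?_)
      ((integrable_abs_weight hB hu).const_mul 1) (fun n => ae_of_all _ fun ω => ?_) ?_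
    · exact ((hH.measurable.functionalCalculus hB hH.selfAdjoint hH.norm_le
        (continuous_bump n)).aemeasurable_weightedTrace hB hu.measurable
          hu.hasCompactSupport).aestronglyMeasurable
    · refine norm_weightedTrace_le ω.uniformlyDiscrete hu.hasCompactSupport
        (norm_functionalCalculus_le zero_le_one fun t => ?_)
      rw [abs_of_nonneg (bump_mem_Icc n t).1]
      exact (bump_mem_Icc n t).2
    · filter_upwards [hH.selfAdjoint, hH.norm_le] with ω h3 h4
      exact tendsto_weightedTrace ω.uniformlyDiscrete hu.hasCompactSupport fun v =>
        tendsto_functionalCalculus_bump h3 hM h4 hCM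
          ((norm_sub_smul_one_le h4 lam).trans hCM) v
  have h5 : ∀ n, ((∫ t, bump lam M n t ∂ν : ℝ) : ℂ) = ((meanDensity haarΓ F μ)⁻¹ : ℝ) *
      ∫ ω, weightedTrace u (_root_.functionalCalculus (bump lam M n) (H ω)) ∂μ := fun n =>
    hν.integral_eq ⟨⟨bump lam M n, continuous_bump n⟩, hasCompactSupport_bump hM n⟩
  have h6 := tendsto_nhds_unique (h1.congr h5) (h2.const_mul _)
  rw [integral_weightedTrace hF hF_sigma hB (hH.eigenProj hB lam) hu] at h6
  exact_mod_cast h6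

end Config

/-! ### The ergodic dichotomy -/

namespace Config

variable {X Y Γ : Type*} [MetricSpace X] [SecondCountableTopology X]
  [MeasurableSpace X] [BorelSpace X] [Nonempty X]
  [MetricSpace Γ] [ProperSpace Γ] [Group Γ] [IsTopologicalGroup Γ]
  [MeasurableSpace Γ] [BorelSpace Γ] {haarΓ : Measure Γ} [haarΓ.IsHaarMeasure]
  [haarΓ.IsMulRightInvariant] [haarΓ.IsInvInvariant] [MulAction Γ X] [ContinuousSMul Γ X]
  [IsIsometricSMul Γ X] {F : Set X} [TopologicalSpace Y] [CompactSpace Y] {B : ℕ → Set X}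
  {μ : Measure (Config X Y)} [IsProbabilityMeasure μ]
  {s : Γ → X → ℂ} {hs : ∀ γ x, ‖s γ x‖ = 1} {u : X → ℝ}
  {H T : ∀ ω : Config X Y, EllTwo ω.carrier →L[ℂ] EllTwo ω.carrier} {C : ℝ}

lemma eigenProj_eq_zero_of_diagonal {A : Set X} {S : EllTwo A →L[ℂ] EllTwo A} {lam : ℝ}
    (h : ∀ x, matrixElement (eigenProj S lam) x x = 0) : eigenProj S lam = 0 := by
  rw [eigenProj_eq] at h ⊢
  exact starProjection_eq_zero_of_diagonal h

lemma traceDensity_eigenProj_eq_zero_iff [SMulInvariantMeasure Γ (Config X Y) μ]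
    (hF : IsStrictFundamentalDomain Γ F)
    (hF_sigma : IsSigmaCompact F) (hB : IsCellPartition B) (hH : IsSelfAdjointFamily B hs μ H C)
    (lam : ℝ) : traceDensity haarΓ F B μ (fun ω => eigenProj (H ω) lam) = 0 ↔
      ∀ᵐ ω ∂μ, eigenProj (H ω) lam = 0 := by
  rw [traceDensity_eq_zero_iff hF hF_sigma hB (hH.eigenProj hB lam)]
  refine eventually_congr (Eventually.of_forall fun ω => ⟨eigenProj_eq_zero_of_diagonal, ?_⟩)
  intro h x
  rw [h]
  rfl

/-- Turns the vanishing of a projection into the vanishing of an almost everywhere measurable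
function of `ω`, so that ergodicity can be applied. -/
lemma tsum_traceWeight_eigenProj_eq_zero_iff (lam : ℝ) (ω : Config X Y) :
    ∑' x : ω.carrier, (1 : X → ℝ≥0∞) x * traceWeight (fun ω => eigenProj (H ω) lam) ω x = 0 ↔
      eigenProj (H ω) lam = 0 := by
  simp only [ENNReal.tsum_eq_zero, Pi.one_apply, one_mul, traceWeight, ENNReal.ofReal_eq_zero]
  constructor
  · refine fun h => eigenProj_eq_zero_of_diagonal fun x => ?_
    have hpos := kerProj_isPositive (H ω - (lam : ℂ) • 1)
    exact Complex.ext (le_antisymm (h x) (matrixElement_self_re_nonneg hpos x))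
      (matrixElement_self_im hpos x)
  · intro h x
    rw [h]
    exact le_rfl

/-- Equivariance holds for almost every `ω` for each γ separately, so the set where the projection
vanishes is invariant and measurable only up to null sets; ergodicity is used in that form. -/
lemma ae_eigenProj_eq_zero_or_ae_ne_zero [ErgodicSMul Γ (Config X Y) μ]
    (hB : IsCellPartition B) (hH : IsSelfAdjointFamily B hs μ H C) (lam : ℝ) :
    (∀ᵐ ω ∂μ, eigenProj (H ω) lam = 0) ∨ ∀ᵐ ω ∂μ, eigenProj (H ω) lam ≠ 0 := by
  have hT := hH.eigenProj hB lam
  have hm := hT.measurable.isMeasurableWeight.aemeasurable_tsum hB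
    (measurable_one (α := ℝ≥0∞) (β := X))
  have hS : NullMeasurableSet {ω : Config X Y | eigenProj (H ω) lam = 0} μ := by
    simp_rw [← tsum_traceWeight_eigenProj_eq_zero_iff]
    exact hm.nullMeasurable (measurableSet_singleton 0)
  have hinv : ∀ γ : Γ, (γ • ·) ⁻¹' {ω : Config X Y | eigenProj (H ω) lam = 0} =ᵐ[μ]
      {ω : Config X Y | eigenProj (H ω) lam = 0} := by
    intro γ
    filter_upwards [hT.equivariant γ] with ω hω
    refine propext ?_
    change eigenProj (H (γ • ω)) lam = 0 ↔ eigenProj (H ω) lam = 0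
    rw [hω]
    exact EmbeddingLike.map_eq_zero_iff
  rcases eventuallyConst_set.1 (aeconst_of_forall_preimage_smul_ae_eq Γ hS hinv) with h | h
  · exact Or.inl h
  · exact Or.inr h

lemma continuousAt_distributionFunction_iff_eigenProj [SMulInvariantMeasure Γ (Config X Y) μ]
    (hF : IsStrictFundamentalDomain Γ F) (hF_compact : IsCompact (closure F))
    (hF_sigma : IsSigmaCompact F) (hB : IsCellPartition B) (hH : IsSelfAdjointFamily B hs μ H C)
    (hu : IsAdmissible haarΓ μ u) (hdens : 0 < meanDensity haarΓ F μ) {ν : Measure ℝ}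
    (hν : IsDensityOfStates haarΓ F μ H u ν) (lam : ℝ) :
    ContinuousAt (distributionFunction ν) lam ↔ ∀ᵐ ω ∂μ, eigenProj (H ω) lam = 0 := by
  have := hν.isFiniteMeasure hH
  have h1 := hν.measure_singleton hF hF_sigma hH hB hu lam
  have h2 : traceDensity haarΓ F B μ (fun ω => eigenProj (H ω) lam) ≠ ∞ :=
    traceDensity_ne_top hF hF_compact hF_sigma hB (hH.eigenProj hB lam)
  have h3 : ν {lam} = 0 ↔ (ν {lam}).toReal = 0 := by
    rw [ENNReal.toReal_eq_zero_iff, or_iff_left (measure_ne_top ν _)]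
  rw [continuousAt_distributionFunction_iff,
    ← traceDensity_eigenProj_eq_zero_iff (haarΓ := haarΓ) hF hF_sigma hB hH,
    h3, h1, mul_eq_zero, or_iff_right (inv_ne_zero hdens.ne'), ENNReal.toReal_eq_zero_iff,
    or_iff_left h2]

lemma ae_residualProj_eq_zero [IsIsometricSMul Γ Γ] [SMulInvariantMeasure Γ (Config X Y) μ]
    (hF : IsStrictFundamentalDomain Γ F) (hF_compact : IsCompact (closure F))
    (hF_sigma : IsSigmaCompact F) (hF_rough : IsRoughIsometryOfDomain Γ F)
    (amenable : IsAmenableGroup haarΓ) (hB : IsCellPartition B)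
    (hH : IsSelfAdjointFamily B hs μ H C) {R : ℝ}
    (hR : ∀ᵐ ω ∂μ, ∀ x y : ω.carrier, R ≤ dist (x : X) y → matrixElement (H ω) x y = 0)
    (lam : ℝ) : ∀ᵐ ω ∂μ, residualProj (H ω) lam = 0 := by
  have hT := hH.residualProj hB lam
  have h := traceDensity_residualProj hF hF_compact hF_sigma hF_rough amenable hB hT hR
  filter_upwards [(traceDensity_eq_zero_iff hF hF_sigma hB hT).1 h] with ω hω
  exact starProjection_eq_zero_of_diagonal hω

end Config

end

/-! ### The density of states and the equivalence of the three conditions -/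

theorem corollary2p4
    {X Γ Y : Type*}
    -- the space `X` and the unimodular amenable group `Γ` with a proper invariant metric
    [MetricSpace X] [LocallyCompactSpace X] [SecondCountableTopology X]
    [MeasurableSpace X] [BorelSpace X]
    [MetricSpace Γ] [ProperSpace Γ] [Group Γ] [IsTopologicalGroup Γ] [IsIsometricSMul Γ Γ]
    [MeasurableSpace Γ] [BorelSpace Γ]
    (haarΓ : Measure Γ) [haarΓ.IsHaarMeasure] [haarΓ.IsMulRightInvariant]
    (amenable : IsAmenableGroup haarΓ)
    -- the action
    [MulAction Γ X] [ContinuousSMul Γ X] [IsIsometricSMul Γ X]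
    (F : Set X) (hF_dom : IsStrictFundamentalDomain Γ F) (hF_compact : IsCompact (closure F))
    (hF_sigma : IsSigmaCompact F) (hF_rough : IsRoughIsometryOfDomain Γ F)
    -- the compactification of `ℂ`
    [TopologicalSpace Y] [CompactSpace Y] [T2Space Y] (ι : ℂ → Y) (hι : IsDenseEmbedding ι)
    -- the ergodic invariant probability measure, which lives on its support
    (μ : Measure (Config X Y)) [IsProbabilityMeasure μ] [ErgodicSMul Γ (Config X Y) μ]
    (hμ_support : μ μ.supportᶜ = 0)
    (hμ_nonempty : ∃ ω ∈ μ.support, ω.carrier.Nonempty)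
    -- the operator
    (s : Γ → X → ℂ)
    (H : ∀ ω : Config X Y, EllTwo ω.carrier →L[ℂ] EllTwo ω.carrier)
    (hH : SatisfiesA ι s μ H)
    (u : X → ℝ) (hu : IsAdmissible haarΓ μ u) (lam : ℝ) :
    (∃! ν : Measure ℝ, IsDensityOfStates haarΓ F μ H u ν) ∧
    ∀ ν : Measure ℝ, IsDensityOfStates haarΓ F μ H u ν →
      List.TFAE [
        ¬ ContinuousAt (distributionFunction ν) lam,
        ∃ Ω' ⊆ μ.support, MeasurableSet Ω' ∧ 0 < μ Ω' ∧
          ∀ ω ∈ Ω', (compactSolutions (H ω) lam).Nonempty,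
        ∀ᵐ ω ∂μ, (compactSolutions (H ω) lam).Nonempty ∧
          (Submodule.span ℂ (compactSolutions (H ω) lam)).topologicalClosure =
            solutionSpace (H ω) lam] := by
  obtain ⟨C, hC⟩ := hH.bounded
  obtain ⟨R, hR⟩ := hH.finiteHoppingRange
  obtain ⟨B, hB₁, hB₂, hB₃⟩ := exists_smallCell_partition X
  have hB : Config.IsCellPartition B := ⟨hB₁, hB₂, hB₃⟩
  have : haarΓ.IsInvInvariant := isInvInvariant_of_unimodular haarΓ
  have : Nonempty X := let ⟨_, _, x, _⟩ := hμ_nonempty; ⟨x⟩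
  have hsupp : ∀ᵐ ω ∂μ, ω ∈ μ.support := hμ_support
  have hfam : Config.IsSelfAdjointFamily B hH.phase_norm μ H C :=
    { measurable := Config.isMeasurableFamily_of_kernel hι hB
        (hsupp.mono fun ω hω => hH.kernel_eq ω hω) (hsupp.mono fun ω hω => hC ω hω)
      equivariant := Config.isEquivariantFamily_of_matrixElement fun γ =>
        hsupp.mono fun ω hω => hH.equivariant γ ω hω
      selfAdjoint := hsupp.mono fun ω hω => hH.selfAdjoint ω hω
      norm_le := hsupp.mono fun ω hω => hC ω hω }
  have hdens : 0 < meanDensity haarΓ F μ :=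
    Config.meanDensity_pos hF_dom hF_compact hF_sigma hB hμ_nonempty
  refine ⟨Config.existsUnique_isDensityOfStates hF_dom hF_sigma hfam hB hu hdens, fun ν hν => ?_⟩
  have hcont := Config.continuousAt_distributionFunction_iff_eigenProj hF_dom hF_compact hF_sigma
    hB hfam hu hdens hν lam
  tfae_have 1 → 3 := by
    intro h
    -- A jump excludes the alternative of vanishing eigenprojections, so they are nonzero almost
    -- everywhere.
    have hne := (Config.ae_eigenProj_eq_zero_or_ae_ne_zero hB hfam lam).resolve_left (mt hcont.2 h)
    have hres := Config.ae_residualProj_eq_zero hF_dom hF_compact hF_sigma hF_rough amenable hB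
      hfam (hsupp.mono fun ω hω => hR ω hω) lam
    filter_upwards [hne, hres] with ω h1 h2
    exact ⟨compactSolutions_nonempty_of_residualProj _ _ h2 h1,
      compactSpan_eq_solutionSpace_of_residualProj _ _ h2⟩
  tfae_have 3 → 2 := by
    intro h
    -- The exceptional set need not be measurable; the complement of a measurable null superset is a
    -- measurable set of full measure on which everything holds.
    obtain ⟨t, hst, htm, ht⟩ := exists_measurable_superset_of_null (ae_iff.1 (h.and hsupp))
    have hsub : ∀ ω ∈ tᶜ, ((compactSolutions (H ω) lam).Nonempty ∧ _) ∧ ω ∈ μ.support :=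
      fun ω hω => by_contra fun h' => hω (hst h')
    refine ⟨tᶜ, fun ω hω => (hsub ω hω).2, htm.compl, ?_, fun ω hω => (hsub ω hω).1.1⟩
    rw [prob_compl_eq_one_sub htm, ht, tsub_zero]
    exact one_pos
  tfae_have 2 → 1 := by
    rintro ⟨Ω', -, -, hpos, hΩ⟩ h
    -- Continuity makes the eigenprojection vanish almost everywhere, whereas a nonzero compactly
    -- supported solution makes it nonzero throughout `Ω'`.
    refine hpos.ne' (measure_mono_null (fun ω hω => ?_) (hcont.1 h))
    exact eigenProj_ne_zero _ _ (hΩ ω hω)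
  tfae_finish
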